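/- Let $k$ be an algebraically closed field of characteristic zero, $A$ a finitely generated commutative $k$-algebra, and $t\in k$ transcendental over $\mathbb{Q}$. **The categories.** For finite sets $U,V$, a recollement of $U,V$ is an equivalence relation on $U\sqcup V$ that meets each of $U$ and $V$ in at most one point per class (a partial bijection between $U$ and $V$). For $s\in k$, $\mathrm{Rep}(S_s)$ is Deligne's category: the pseudo-abelian envelope (the Karoubi envelope of the additive envelope) of the category with objects $[U]$, $U$ a finite set, with $\mathrm{Hom}([U],[V])$ the $k$-vector space on the recollements of $U,V$, and composition $D\circ C=\sum_E P^E_{C,D}(s)\,E$; here $P^E_{C,D}$ is the polynomial such that, for given injections $f:U\to I$, $h:W\to I$ with recollement $E$ and $|I|=n$ large, $P^E_{C,D}(n)$ is the number of injections $g:V\to I$ such that $(f,g)$ has recollement $C$ and $(g,h)$ has recollement $D$. So $[U]$ interpolates the permutation representation of $S_n=\mathrm{Sym}(I)$ on the functions on injections $U\to I$, with basis $(e_f)$. Let $\mathfrak h=[\mathrm{pt}]$, and let $s:\mathfrak h\to\mathbf 1$, $r:\mathfrak h\to\mathfrak h\otimes\mathfrak h$, $\rho:\mathfrak h\otimes\mathfrak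 h\to\mathfrak h$ and $P:\mathfrak h\otimes\mathfrak h\to\mathfrak h\otimes\mathfrak h$ be the morphisms that interpolate $e_i\mapsto 1$, $e_i\mapsto e_i\otimes e_i$, $e_i\otimes e_j\mapsto\delta_{ij}e_i$ and $e_i\otimes e_j\mapsto e_j\otimes e_i$. An object of $\mathrm{Rep}(S_t\ltimes A^{\otimes t})$ is an object $M$ of $\mathrm{Rep}(S_t)$ with a $k$-linear family of morphisms $y_a:\mathfrak h\otimes M\to M$ $(a\in A)$ such that $y_1=s\otimes\mathrm{id}_M$, $y_a\circ(\mathrm{id}_{\mathfrak h}\otimes y_b)\circ(r\otimes\mathrm{id}_M)=y_{ab}$ and $$y_a\circ(\mathrm{id}_{\mathfrak h}\otimes y_b)-y_b\circ(\mathrm{id}_{\mathfrak h}\otimes y_a)\circ(P\otimes\mathrm{id}_M)=y_{ab-ba}\circ(\rho\otimes\mathrm{id}_M).$$ Morphisms are the morphisms of $\mathrm{Rep}(S_t)$ that commute with all the $y_a$. **The data.** Let $l\ge 1$, and let $n_2\ge n_3\ge\dots\ge n_l\ge 1$ be integers, $N=n_2+\dots+n_l$. Let $\chi_1,\dots,\chi_l:A\to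 k$ be pairwise distinct characters ($k$-algebra homomorphisms), $M_1$ a simple object of $\mathrm{Rep}(S_{t-N})$, and $M_j$ a simple (finite-dimensional) representation of $S_{n_j}$ over $k$ for $2\le j\le l$. The object $\mathrm{ind}(V_{\chi_1}(M_1),\dots,V_{\chi_l}(M_l))$ of $\mathrm{Rep}(S_t\ltimes A^{\otimes t})$ is the interpolated parabolic induction of the modules $V_{\chi_j}(M_j)$, where $V_\chi(M)$ is $M$ with every copy of $A$ acting through $\chi$. Explicitly, let $J=J_2\sqcup\dots\sqcup J_l$ with $|J_j|=n_j$. The underlying object of $\mathrm{Rep}(S_t)$ is induced from $M_1\otimes M_2\otimes\dots\otimes M_l$ along $S_{t-N}\times S_{n_2}\times\dots\times S_{n_l}$: it is the image of the averaging idempotent of $\prod_{j\ge2}S_{n_j}$ on $\widetilde M_1\otimes M_2\otimes\dots\otimes M_l$, where $M_1\mapsto\widetilde M_1$ is the additive functor that sends $[U]$ to $[U\sqcup J]$, and $\prod_{j\ge 2} S_{n_j}$ acts on $J$ and on $M_2\otimes\dots\otimes M_l$. The map $y_a$ interpolates $e_i\otimes e_f\otimes m\mapsto\chi_j(a)\,e_f\otimes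 m$ if $i\in f(J_j)$, $j\ge2$, and $e_i\otimes e_f\otimes m\mapsto\chi_1(a)\,e_f\otimes m$ if $i\notin f(J)$. **Theorem.** 1. Every simple object of $\mathrm{Rep}(S_t\ltimes A^{\otimes t})$ is isomorphic to $\mathrm{ind}(V_{\chi_1}(M_1),\dots,V_{\chi_l}(M_l))$ for some data as above. 2. For all data as above, $\mathrm{ind}(V_{\chi_1}(M_1),\dots,V_{\chi_l}(M_l))$ is simple. 3. The objects that belong to two such data are isomorphic if and only if the data agree up to isomorphisms of the $M_j$ and the order of the blocks $j\ge 2$, i.e. $\chi_1=\chi_1'$, $N=N'$, $M_1\cong M_1'$, $l=l'$, and there is a permutation $\pi$ of $\{2,\dots,l\}$ with $n_j=n'_{\pi(j)}$, $\chi_j=\chi'_{\pi(j)}$ and $M_j\cong M'_{\pi(j)}$ for all $j\ge2$. -/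

import Mathlib

namespace DeligneWreath

open CategoryTheory

set_option linter.unusedSectionVars false

section Recollements

variable {k : Type*} [Field k] {U V W X I : Type}

/-- A recollement of two finite sets `U`, `V`: an equivalence relation on `U ⊔ V` whose classes
meet each of `U` and `V` in at most one point, i.e. a partial bijection between `U` and `V`. -/
abbrev Recollement (U V : Type) : Type := U ≃. V

noncomputable instance [Fintype U] [Fintype V] : Fintype (Recollement U V) := by
  classical
  exact Fintype.ofInjective (fun E : U ≃. V => (E : U → Option V)) DFunLike.coe_injective

/-- An injection, regarded as a partial bijection. -/
noncomputable def ofEmb (f : U ↪ I) : U ≃. I where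
  toFun u := some (f u)
  invFun := by
    classical
    exact fun x => if h : ∃ u, f u = x then some h.choose else none
  inv := by
    classical
    intro u x
    constructor
    · intro h
      by_cases hx : ∃ u, f u = x
      · simp only [hx, dite_true, Option.some.injEq] at h
        simp [← h, hx.choose_spec]
      · simp [hx] at h
    · intro h
      simp only [Option.some.injEq] at h
      have hx : ∃ u, f u = x := ⟨u, h⟩
      simp only [hx, dite_true, Option.some.injEq]
      exact f.injective (hx.choose_spec.trans h.symm)

/-- The recollement given by two injections `f : U → I`, `g : V → I`: the points `u` and `v` are glued
if and only if `f u = g v`. -/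
noncomputable def glued (f : U ↪ I) (g : V ↪ I) : Recollement U V := (ofEmb f).trans (ofEmb g).symm

/-- The recollement induced on two subsets. -/
noncomputable def Recollement.restrict (E : Recollement U V) (a : W ↪ U) (b : X ↪ V) : Recollement W X :=
  (ofEmb a).trans (E.trans (ofEmb b).symm)

theorem mem_ofEmb (f : U ↪ I) (u : U) (x : I) : x ∈ ofEmb f u ↔ f u = x := by
  change x ∈ some (f u) ↔ _
  simp

theorem mem_glued (f : U ↪ I) (g : V ↪ I) (u : U) (v : V) :
    v ∈ glued f g u ↔ f u = g v := by
  simp only [glued, PEquiv.mem_trans, PEquiv.mem_iff_mem, mem_ofEmb]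
  grind

theorem mem_restrict (E : Recollement U V) (a : W ↪ U) (b : X ↪ V) (w : W) (x : X) :
    x ∈ E.restrict a b w ↔ b x ∈ E (a w) := by
  simp only [Recollement.restrict, PEquiv.mem_trans, PEquiv.mem_iff_mem, mem_ofEmb]
  grind

theorem rec_ext {E F : Recollement U V} (h : ∀ u v, v ∈ E u ↔ v ∈ F u) : E = F :=
  PEquiv.ext fun u => Option.ext fun v => h u v

theorem restrict_glued (f : U ↪ I) (g : V ↪ I) (a : W ↪ U) (b : X ↪ V) :
    (glued f g).restrict a b = glued (a.trans f) (b.trans g) :=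
  rec_ext fun u v => by rw [mem_restrict, mem_glued, mem_glued]; rfl

/-- `C`, `D`, `E` are the restrictions to the three pairs of one recollement of `U`, `V`, `W`, i.e.
of an equivalence relation on `U ⊔ V ⊔ W` that meets each of the three sets in at most one point.
Such a relation is then unique. -/
def Composable (C : Recollement U V) (D : Recollement V W) (E : Recollement U W) : Prop :=
  (∀ u v, v ∈ C u → D v = E u) ∧ (∀ v w, w ∈ D v → C.symm v = E.symm w)

/-- The number of equivalence classes of a recollement. -/
noncomputable def size [Fintype U] [Fintype W] (E : Recollement U W) : ℕ :=
  Fintype.card U + Nat.card {w : W // E.symm w = none}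

open Classical in
/-- The polynomial `P^E_{C,D}` at `t`. At an integer `t = n`, it is the number of injections
`g : V → I` with `|I| = n` which have recollement `C` with `f` and `D` with `h`, where
`f : U → I` and `h : W → I` are given injections with recollement `E`
(see `structureCoeff_card`): if `C`, `D`, `E` come from one recollement of `U`, `V`, `W`, it is
`(t - |E|) (t - |E| - 1) ⋯ (t - |E| - m + 1)`, where `m` is the number of points of `V` that are
glued to no point of `U` or `W`, and it is zero otherwise. -/
noncomputable def structureCoeff [Fintype U] [Fintype V] [Fintype W] (t : k)
    (C : Recollement U V) (D : Recollement V W) (E : Recollement U W) : k :=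
  if Composable C D E then
    (descPochhammer k (Nat.card {v : V // C.symm v = none ∧ D v = none})).eval (t - size E)
  else 0

theorem glued_symm (f : U ↪ I) (g : V ↪ I) : (glued f g).symm = glued g f :=
  rec_ext fun u v => by rw [PEquiv.mem_iff_mem, mem_glued, mem_glued]; exact eq_comm

theorem composable_glued (f : U ↪ I) (g : V ↪ I) (h : W ↪ I) :
    Composable (glued f g) (glued g h) (glued f h) := by
  constructor
  · intro u v huv
    rw [mem_glued] at huv
    refine Option.ext fun w => ?_
    change w ∈ glued g h v ↔ w ∈ glued f h u
    rw [mem_glued, mem_glued, huv]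
  · intro v w hvw
    rw [mem_glued] at hvw
    refine Option.ext fun u => ?_
    change u ∈ (glued f g).symm v ↔ u ∈ (glued f h).symm w
    rw [glued_symm, glued_symm, mem_glued, mem_glued, hvw]

section Count

variable (f : U ↪ I) (h : W ↪ I) {C : Recollement U V} {D : Recollement V W}

open Classical in
noncomputable def extend
    (e : {v : V // C.symm v = none ∧ D v = none} ↪
      {x : I // (∀ u, f u ≠ x) ∧ ∀ w, h w ≠ x}) (v : V) : I :=
  match hC : C.symm v, hD : D v with
  | some u, _ => f u
  | none, some w => h w
  | none, none => e ⟨v, hC, hD⟩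

section

variable (e : {v : V // C.symm v = none ∧ D v = none} ↪
      {x : I // (∀ u, f u ≠ x) ∧ ∀ w, h w ≠ x})

theorem extend_cases (hc : Composable C D (glued f h)) (v : V) :
    (∃ u, v ∈ C u ∧ extend f h e v = f u) ∨
    (C.symm v = none ∧ ∃ w, w ∈ D v ∧ extend f h e v = h w ∧ ∀ u, f u ≠ h w) ∨
    (∃ hv : C.symm v = none ∧ D v = none, extend f h e v = e ⟨v, hv⟩) := by
  unfold extend
  split
  · rename_i u hu
    exact Or.inl ⟨u, (PEquiv.mem_iff_mem C).1 hu, rfl⟩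
  · rename_i w hC hD
    refine Or.inr (Or.inl ⟨hC, w, hD, rfl, fun u hu => ?_⟩)
    have := hc.2 v w hD
    rw [hC, glued_symm] at this
    have h2 : u ∈ glued h f w := (mem_glued _ _ _ _).2 hu.symm
    rw [← this] at h2
    simp at h2
  · rename_i hC hD
    exact Or.inr (Or.inr ⟨⟨hC, hD⟩, rfl⟩)

theorem extend_eq_left (hc : Composable C D (glued f h)) (u : U) (v : V) :
    f u = extend f h e v ↔ v ∈ C u := by
  rcases extend_cases f h e hc v with ⟨u', h1, h2⟩ | ⟨h1, w, h2, h3, h4⟩ | ⟨hv, h1⟩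
  · rw [h2]
    constructor
    · intro hu; rw [f.injective hu]; exact h1
    · intro hu; rw [C.inj h1 hu]
  · rw [h3]
    refine iff_of_false (h4 u) fun hu => ?_
    rw [← PEquiv.mem_iff_mem, h1] at hu
    simp at hu
  · rw [h1]
    refine iff_of_false ((e ⟨v, hv⟩).2.1 u) fun hu => ?_
    rw [← PEquiv.mem_iff_mem, hv.1] at hu
    simp at hu

theorem extend_eq_right (hc : Composable C D (glued f h)) (v : V) (w : W) :
    extend f h e v = h w ↔ w ∈ D v := by
  rcases extend_cases f h e hc v with ⟨u', h1, h2⟩ | ⟨h1, w', h2, h3, h4⟩ | ⟨hv, h1⟩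
  · rw [h2, hc.1 u' v h1, mem_glued]
  · rw [h3]
    have h2' : D v = some w' := h2
    rw [h2']
    simp only [EmbeddingLike.apply_eq_iff_eq, Option.mem_def, Option.some.injEq]
  · rw [h1, hv.2]
    exact iff_of_false (fun hh => (e ⟨v, hv⟩).2.2 w hh.symm) (by simp)

theorem extend_injective (hc : Composable C D (glued f h)) :
    Function.Injective (extend f h e) := by
  intro v v' hv
  rcases extend_cases f h e hc v with ⟨u', h1, h2⟩ | ⟨h1, w', h2, h3, h4⟩ | ⟨hv1, h1⟩
  · have := (extend_eq_left f h e hc u' v').1 (by rw [← hv, h2])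
    exact Option.some.inj (h1.symm.trans this)
  · have := (extend_eq_right f h e hc v' w').1 (by rw [← hv, h3])
    exact D.inj h2 this
  · rcases extend_cases f h e hc v' with ⟨u', g1, g2⟩ | ⟨g1, w', g2, g3, g4⟩ | ⟨hv2, g1⟩
    · have := (extend_eq_left f h e hc u' v).1 (by rw [hv, g2])
      exact Option.some.inj (this.symm.trans g1)
    · have := (extend_eq_right f h e hc v w').1 (by rw [hv, g3])
      exact D.inj this g2
    · rw [h1, g1] at hv
      have := e.injective (Subtype.ext hv)
      simpa using this

end

variable {f h} in
noncomputable def extensionEquiv (hc : Composable C D (glued f h)) :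
    {g : V ↪ I // glued f g = C ∧ glued g h = D} ≃
      ({v : V // C.symm v = none ∧ D v = none} ↪
        {x : I // (∀ u, f u ≠ x) ∧ ∀ w, h w ≠ x}) where
  toFun g := ⟨fun v => ⟨g.1 v.1, by
      obtain ⟨g, rfl, rfl⟩ := g
      obtain ⟨v, h1, h2⟩ := v
      constructor
      · intro u hu
        have := (mem_glued f g u v).2 hu
        rw [← PEquiv.mem_iff_mem, h1] at this
        simp at this
      · intro w hw
        have := (mem_glued g h v w).2 hw.symm
        rw [h2] at this
        simp at this⟩, fun v v' hv => Subtype.ext (g.1.injective (congrArg Subtype.val hv))⟩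
  invFun e := ⟨⟨extend f h e, extend_injective f h e hc⟩,
    rec_ext fun u v => by rw [mem_glued]; exact extend_eq_left f h e hc u v,
    rec_ext fun v w => by rw [mem_glued]; exact extend_eq_right f h e hc v w⟩
  left_inv := by
    rintro ⟨g, rfl, rfl⟩
    refine Subtype.ext (Function.Embedding.ext fun v => ?_)
    change extend f h _ v = g v
    rcases extend_cases f h _ hc v with ⟨u', h1, h2⟩ | ⟨h1, w', h2, h3, h4⟩ | ⟨hv1, h1⟩
    · rw [h2]; exact (mem_glued _ _ _ _).1 h1
    · rw [h3]; exact ((mem_glued _ _ _ _).1 h2).symm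
    · rw [h1]; rfl
  right_inv := by
    intro e
    refine Function.Embedding.ext fun v => Subtype.ext ?_
    change extend f h e v.1 = e v
    rcases extend_cases f h e hc v.1 with ⟨u', h1, h2⟩ | ⟨h1, w', h2, h3, h4⟩ | ⟨hv1, h1⟩
    · have := v.2.1
      rw [← PEquiv.mem_iff_mem, this] at h1
      simp at h1
    · rw [v.2.2] at h2; simp at h2
    · rw [h1]

end Count

theorem card_free [Fintype U] [Fintype W] [Fintype I] (f : U ↪ I) (h : W ↪ I) :
    Nat.card {x : I // (∀ u, f u ≠ x) ∧ ∀ w, h w ≠ x} + size (glued f h) = Fintype.card I := by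
  classical
  let φ : {x : I // (∀ u, f u ≠ x) ∧ ∀ w, h w ≠ x} ⊕
      (U ⊕ {w : W // (glued f h).symm w = none}) → I :=
    Sum.elim Subtype.val (Sum.elim f (fun w => h w.1))
  have key : ∀ (w : {w : W // (glued f h).symm w = none}) (u : U), f u ≠ h w.1 := by
    intro w u hu
    have h1 : w.1 ∈ glued f h u := (mem_glued _ _ _ _).2 hu
    rw [← PEquiv.mem_iff_mem, w.2] at h1
    simp at h1
  have hφ : Function.Bijective φ := by
    constructor
    · rintro (x | u | w) (x' | u' | w') hh <;> simp only [φ, Sum.elim_inl, Sum.elim_inr] at hh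
      · rw [Subtype.ext hh]
      · exact absurd hh.symm (x.2.1 u')
      · exact absurd hh.symm (x.2.2 w'.1)
      · exact absurd hh (x'.2.1 u)
      · rw [f.injective hh]
      · exact absurd hh (key w' u)
      · exact absurd hh (x'.2.2 w.1)
      · exact absurd hh.symm (key w u')
      · rw [Subtype.ext (h.injective hh)]
    · intro x
      by_cases h1 : ∃ u, f u = x
      · obtain ⟨u, rfl⟩ := h1; exact ⟨Sum.inr (Sum.inl u), rfl⟩
      · by_cases h2 : ∃ w, h w = x
        · obtain ⟨w, rfl⟩ := h2
          refine ⟨Sum.inr (Sum.inr ⟨w, ?_⟩), rfl⟩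
          rw [Option.eq_none_iff_forall_not_mem]
          intro u hu
          rw [glued_symm, mem_glued] at hu
          exact h1 ⟨u, hu.symm⟩
        · push Not at h1 h2
          exact ⟨Sum.inl ⟨x, h1, h2⟩, rfl⟩
  have := Nat.card_congr (Equiv.ofBijective φ hφ)
  rw [Nat.card_sum, Nat.card_sum, Nat.card_eq_fintype_card (α := I),
    Nat.card_eq_fintype_card (α := U)] at this
  exact this

open Classical in
theorem structureCoeff_card [CharZero k] [Fintype U] [Fintype V] [Fintype W] [Fintype I]
    (f : U ↪ I) (h : W ↪ I) (C : Recollement U V) (D : Recollement V W) :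
    structureCoeff (Fintype.card I : k) C D (glued f h) =
      (Fintype.card {g : V ↪ I // glued f g = C ∧ glued g h = D} : k) := by
  unfold structureCoeff
  split_ifs with hc
  · rw [Fintype.card_congr (extensionEquiv hc), Fintype.card_embedding_eq,
      ← card_free f h, Nat.cast_add, add_sub_cancel_right, descPochhammer_eval_eq_descFactorial,
      Nat.card_eq_fintype_card, Nat.card_eq_fintype_card]
  · rw [eq_comm, Nat.cast_eq_zero, Fintype.card_eq_zero_iff]
    refine ⟨?_⟩
    rintro ⟨g, rfl, rfl⟩
    exact hc (composable_glued f g h)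

end Recollements

section Composition

variable {k : Type*} [Field k] {U V W X : Type} [Fintype U] [Fintype V] [Fintype W] [Fintype X]

/-- The composition `[U] → [V] → [W]` of linear combinations of recollements (in diagrammatic order).
At `t = n` a recollement `C` stands for the `S_n`-linear map `e_f ↦ ∑_g e_g`, where `f : U → I`,
and `g` runs over the injections `V → I` that have recollement `C` with `f`
(see `comp_glued`). -/
noncomputable def comp (t : k) (Φ : Recollement U V → k) (Ψ : Recollement V W → k) :
    Recollement U W → k :=
  fun E => ∑ C, ∑ D, Φ C * Ψ D * structureCoeff t C D E

open Classical in
/-- The identity of `[U]`. -/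
noncomputable def idCoeff : Recollement U U → k := fun E => if E = PEquiv.refl U then 1 else 0

theorem comp_glued [CharZero k] {I : Type} [Fintype I] {t : k} (ht : t = Fintype.card I)
    (Φ : Recollement U V → k) (Ψ : Recollement V W → k) (f : U ↪ I) (h : W ↪ I) :
    comp t Φ Ψ (glued f h) = ∑ g : V ↪ I, Φ (glued f g) * Ψ (glued g h) := by
  classical
  subst ht
  have : ∀ g : V ↪ I, Φ (glued f g) * Ψ (glued g h) =
      ∑ C, ∑ D, if glued f g = C ∧ glued g h = D then Φ C * Ψ D else 0 := by
    intro g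
    rw [Finset.sum_eq_single (glued f g), Finset.sum_eq_single (glued g h)]
    · simp
    · intro D _ hD; simp [hD.symm]
    · simp
    · intro C _ hC; simp [hC.symm]
    · simp
  simp_rw [this]
  rw [Finset.sum_comm]
  refine Finset.sum_congr rfl fun C _ => ?_
  rw [Finset.sum_comm]
  refine Finset.sum_congr rfl fun D _ => ?_
  rw [structureCoeff_card, ← Finset.sum_filter, Finset.sum_const, nsmul_eq_mul, mul_comm,
    Fintype.card_subtype]

/-- Polynomial functions of the parameter. -/
def IsPoly (F : k → k) : Prop := ∃ p : Polynomial k, ∀ t, F t = p.eval t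

theorem IsPoly.const (c : k) : IsPoly fun _ : k => c := ⟨Polynomial.C c, by simp⟩

theorem IsPoly.add {F G : k → k} (hF : IsPoly F) (hG : IsPoly G) :
    IsPoly fun t => F t + G t := by
  obtain ⟨p, hp⟩ := hF
  obtain ⟨q, hq⟩ := hG
  exact ⟨p + q, by simp [hp, hq]⟩

theorem IsPoly.mul {F G : k → k} (hF : IsPoly F) (hG : IsPoly G) :
    IsPoly fun t => F t * G t := by
  obtain ⟨p, hp⟩ := hF
  obtain ⟨q, hq⟩ := hG
  exact ⟨p * q, by simp [hp, hq]⟩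

theorem IsPoly.sum {ι : Type*} (s : Finset ι) {F : ι → k → k} (hF : ∀ i, IsPoly (F i)) :
    IsPoly fun t => ∑ i ∈ s, F i t := by
  choose p hp using hF
  exact ⟨∑ i ∈ s, p i, by simp [hp, Polynomial.eval_finsetSum]⟩

theorem IsPoly.ite {F : k → k} (P : Prop) {_ : Decidable P} (hF : IsPoly F) :
    IsPoly fun t => if P then F t else 0 := by
  split_ifs
  · exact hF
  · exact .const 0

theorem IsPoly.structureCoeff (C : Recollement U V) (D : Recollement V W) (E : Recollement U W)
    (c : k) : IsPoly fun t : k => structureCoeff (t - c) C D E := by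
  classical
  unfold DeligneWreath.structureCoeff
  refine IsPoly.ite _
    ⟨(descPochhammer k (Nat.card {v : V // C.symm v = none ∧ D v = none})).comp
      (Polynomial.X - Polynomial.C c - Polynomial.C (size E : k)), ?_⟩
  intro t
  simp

theorem IsPoly.comp {Φ : k → Recollement U V → k} {Ψ : k → Recollement V W → k}
    (hΦ : ∀ C, IsPoly (Φ · C)) (hΨ : ∀ D, IsPoly (Ψ · D)) (E : Recollement U W) :
    IsPoly fun t => comp t (Φ t) (Ψ t) E := by
  unfold DeligneWreath.comp
  have := fun C D E => IsPoly.structureCoeff (U := U) (V := V) (W := W) C D E (0 : k)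
  simp only [sub_zero] at this
  exact .sum _ fun C => .sum _ fun D => ((hΦ C).mul (hΨ D)).mul (this C D E)

theorem IsPoly.comp_const (Φ : Recollement U V → k) (Ψ : Recollement V W → k)
    (E : Recollement U W) : IsPoly fun t => DeligneWreath.comp t Φ Ψ E :=
  IsPoly.comp (Φ := fun _ => Φ) (Ψ := fun _ => Ψ) (fun _ => .const _) (fun _ => .const _) E

theorem exists_glued (E : Recollement U V) :
    ∃ (f : U ↪ U ⊕ V) (g : V ↪ U ⊕ V), glued f g = E := by
  have key : ∀ v, (∃ u, E.symm v = some u) ∨ E.symm v = none := fun v => by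
    cases E.symm v <;> simp
  let g : V → U ⊕ V := fun v => match E.symm v with
    | some u => Sum.inl u
    | none => Sum.inr v
  have g1 : ∀ v u, E.symm v = some u → g v = Sum.inl u := fun v u h => by simp [g, h]
  have g2 : ∀ v, E.symm v = none → g v = Sum.inr v := fun v h => by simp [g, h]
  refine ⟨⟨Sum.inl, Sum.inl_injective⟩, ⟨g, ?_⟩, ?_⟩
  · intro v v' h
    rcases key v with ⟨u, hu⟩ | hu <;> rcases key v' with ⟨u', hu'⟩ | hu'
    · rw [g1 v u hu, g1 v' u' hu'] at h
      cases h
      exact E.symm.inj hu hu'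
    · rw [g1 v u hu, g2 v' hu'] at h; cases h
    · rw [g2 v hu, g1 v' u' hu'] at h; cases h
    · rw [g2 v hu, g2 v' hu'] at h; cases h; rfl
  · refine rec_ext fun u v => ?_
    rw [mem_glued, ← PEquiv.mem_iff_mem]
    change Sum.inl u = g v ↔ _
    rcases key v with ⟨u', hu⟩ | hu
    · rw [g1 v u' hu, hu]
      simp [eq_comm]
    · rw [g2 v hu, hu]
      simp

/-- Interpolation: an identity polynomial in `t` holds for all `t` as soon as it holds at all large
integers. -/
theorem ext_of_glued [CharZero k] {Φ Ψ : k → Recollement U V → k}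
    (hΦ : ∀ E, IsPoly (Φ · E)) (hΨ : ∀ E, IsPoly (Ψ · E)) (n₀ : ℕ)
    (h : ∀ n : ℕ, n₀ ≤ n → ∀ (f : U ↪ Fin n) (g : V ↪ Fin n),
      Φ n (glued f g) = Ψ n (glued f g)) (t : k) : Φ t = Ψ t := by
  funext E
  obtain ⟨p, hp⟩ := hΦ E
  obtain ⟨q, hq⟩ := hΨ E
  refine (hp t).trans (Eq.trans ?_ (hq t).symm)
  congr 1
  refine Polynomial.eq_of_infinite_eval_eq p q ?_
  refine Set.Infinite.mono (s := Set.range fun m : ℕ =>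
    ((max n₀ (Fintype.card (U ⊕ V)) + m : ℕ) : k)) ?_ ?_
  · rintro _ ⟨m, rfl⟩
    change p.eval _ = q.eval _
    refine (hp _).symm.trans (Eq.trans ?_ (hq _))
    obtain ⟨f, g, rfl⟩ := exists_glued E
    have e : (U ⊕ V) ↪ Fin (max n₀ (Fintype.card (U ⊕ V)) + m) :=
      (Function.Embedding.nonempty_of_card_le (by simp; omega)).some
    dsimp only
    have hfg : glued f g = glued (f.trans e) (g.trans e) := rec_ext fun u v => by
      rw [mem_glued, mem_glued]
      exact e.injective.eq_iff.symm
    rw [hfg]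
    exact h _ (by omega) _ _
  · refine Set.infinite_range_of_injective fun a b hab => ?_
    have := Nat.cast_injective (R := k) hab
    omega

theorem comp_assoc [CharZero k] (t : k) (Φ : Recollement U V → k) (Ψ : Recollement V W → k)
    (Θ : Recollement W X → k) : comp t (comp t Φ Ψ) Θ = comp t Φ (comp t Ψ Θ) := by
  refine ext_of_glued (Φ := fun t => comp t (comp t Φ Ψ) Θ)
    (Ψ := fun t => comp t Φ (comp t Ψ Θ))
    (IsPoly.comp (IsPoly.comp (fun _ => .const _) fun _ => .const _) fun _ => .const _)
    (IsPoly.comp (fun _ => .const _) (IsPoly.comp (fun _ => .const _) fun _ => .const _)) 0 ?_ t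
  intro n _ f x
  have hn : (n : k) = Fintype.card (Fin n) := by simp
  simp only [comp_glued hn, Finset.sum_mul, Finset.mul_sum]
  rw [Finset.sum_comm]
  simp only [mul_assoc]

theorem glued_eq_refl {I : Type} (f g : U ↪ I) : glued f g = PEquiv.refl U ↔ f = g := by
  constructor
  · intro h
    refine Function.Embedding.ext fun u => ?_
    rw [← mem_glued, h]; rfl
  · rintro rfl
    refine rec_ext fun u v => ?_
    rw [mem_glued]
    simp

theorem id_comp [CharZero k] (t : k) (Φ : Recollement U V → k) : comp t idCoeff Φ = Φ := by
  refine ext_of_glued (Φ := fun t => comp t idCoeff Φ) (Ψ := fun _ => Φ)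
    (IsPoly.comp (fun _ => .const _) fun _ => .const _) (fun _ => .const _) 0 ?_ t
  intro n _ f g
  have hn : (n : k) = Fintype.card (Fin n) := by simp
  simp [comp_glued hn, idCoeff, glued_eq_refl]

theorem comp_id [CharZero k] (t : k) (Φ : Recollement U V → k) : comp t Φ idCoeff = Φ := by
  refine ext_of_glued (Φ := fun t => comp t Φ idCoeff) (Ψ := fun _ => Φ)
    (IsPoly.comp (fun _ => .const _) fun _ => .const _) (fun _ => .const _) 0 ?_ t
  intro n _ f g
  have hn : (n : k) = Fintype.card (Fin n) := by simp
  simp [comp_glued hn, idCoeff, glued_eq_refl]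

theorem add_comp (t : k) (Φ Φ' : Recollement U V → k) (Ψ : Recollement V W → k) :
    comp t (Φ + Φ') Ψ = comp t Φ Ψ + comp t Φ' Ψ := by
  funext E; simp [comp, add_mul, Finset.sum_add_distrib]

theorem comp_add (t : k) (Φ : Recollement U V → k) (Ψ Ψ' : Recollement V W → k) :
    comp t Φ (Ψ + Ψ') = comp t Φ Ψ + comp t Φ Ψ' := by
  funext E; simp [comp, add_mul, mul_add, Finset.sum_add_distrib]

theorem smul_comp (t c : k) (Φ : Recollement U V → k) (Ψ : Recollement V W → k) :
    comp t (c • Φ) Ψ = c • comp t Φ Ψ := by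
  funext E; simp [comp, Finset.mul_sum, mul_assoc]

theorem comp_smul (t c : k) (Φ : Recollement U V → k) (Ψ : Recollement V W → k) :
    comp t Φ (c • Ψ) = c • comp t Φ Ψ := by
  funext E; simp only [comp, Finset.mul_sum, Pi.smul_apply, smul_eq_mul]
  exact Finset.sum_congr rfl fun C _ => Finset.sum_congr rfl fun D _ => by ring

end Composition

/-- The category `Rep'(S_t)`: its objects are the symbols `[U]`, one for each finite set `U`. -/
structure Deligne₀ {k : Type*} (t : k) where
  carrier : Type
  [fintype : Fintype carrier]

attribute [instance] Deligne₀.fintype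

section Category

universe u
variable {k : Type u} [Field k] [CharZero k] {t : k}

/-- The morphisms `[U] → [V]` are the formal linear combinations of recollements of `U` and `V`, and
the composition is given by the polynomials `P^E_{C,D}(t)`. -/
noncomputable instance : Category (Deligne₀ t) where
  Hom U V := Recollement U.carrier V.carrier → k
  id U := idCoeff
  comp Φ Ψ := comp t Φ Ψ
  id_comp Φ := id_comp t Φ
  comp_id Φ := comp_id t Φ
  assoc Φ Ψ Θ := comp_assoc t Φ Ψ Θ

noncomputable instance : Preadditive (Deligne₀ t) where
  homGroup U V := inferInstanceAs (AddCommGroup (Recollement U.carrier V.carrier → k))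
  add_comp _ _ _ Φ Φ' Ψ := add_comp t Φ Φ' Ψ
  comp_add _ _ _ Φ Ψ Ψ' := comp_add t Φ Ψ Ψ'

noncomputable instance : Linear k (Deligne₀ t) where
  homModule U V := inferInstanceAs (Module k (Recollement U.carrier V.carrier → k))
  smul_comp _ _ _ c Φ Ψ := smul_comp t c Φ Ψ
  comp_smul _ _ _ Φ c Ψ := comp_smul t c Φ Ψ

end Category

section Envelope

universe u v w
variable (k : Type u) [Field k] (C : Type v) [Category.{w} C] [Preadditive C] [Linear k C]

instance : Linear k (Mat_ C) where
  homModule M N := inferInstanceAs (Module k (∀ i j, M.X i ⟶ N.X j))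
  smul_comp M N K c f g := by
    ext i j
    change ∑ l, (c • f i l) ≫ g l j = c • ∑ l, f i l ≫ g l j
    simp [Finset.smul_sum]
  comp_smul M N K f c g := by
    ext i j
    change ∑ l, f i l ≫ (c • g l j) = c • ∑ l, f i l ≫ g l j
    simp [Finset.smul_sum]

instance (P Q : Idempotents.Karoubi C) : SMul k (P ⟶ Q) where
  smul c f := ⟨c • f.f, by
    rw [Linear.smul_comp, Linear.comp_smul]; exact congrArg (c • ·) f.comm⟩

instance : Linear k (Idempotents.Karoubi C) where
  homModule P Q := Function.Injective.module k (Idempotents.Karoubi.inclusionHom P Q)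
    (fun _ _ h => Idempotents.Karoubi.hom_ext _ _ h) fun _ _ => rfl
  smul_comp P Q R c f g := Idempotents.Karoubi.hom_ext _ _ (Linear.smul_comp _ _ _ _ _ _)
  comp_smul P Q R f c g := Idempotents.Karoubi.hom_ext _ _ (Linear.comp_smul _ _ _ _ _ _)

end Envelope


section PermutationObject

variable {k : Type*} [Field k] {U V W I : Type}

/-- The regular representation is `𝔥 = [pt]`, and `𝔥 ⊗ [U] = ⨁_c [hSet U c]`, where `c` runs over the
recollements of a point and `U`: either the point is new (`c = none`), and the set is `U ⊔ pt`, or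
it is glued to `u` (`c = some u`), and the set is `U`. -/
def hSet (U : Type) : Option U → Type
  | none => Option U
  | some _ => U

noncomputable instance [Fintype U] (c : Option U) : Fintype (hSet U c) :=
  match c with
  | none => inferInstanceAs (Fintype (Option U))
  | some _ => inferInstanceAs (Fintype U)

/-- The inclusion of `U` in a set glued from a point and `U`. -/
def hInc : (c : Option U) → U ↪ hSet U c
  | none => Function.Embedding.some
  | some _ => Function.Embedding.refl U

/-- The point in a set glued from a point and `U`. -/
def hPt : (c : Option U) → hSet U c
  | none => (none : Option U)
  | some u => u

open Classical in
/-- The linear combination of recollements `E` of `S` and `T` that satisfy `P`, with coefficients given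
by the restriction of `E` to `U ⊆ S` and `V ⊆ T`. -/
noncomputable def ker {S T : Type} (P : Recollement S T → Prop) (a : U ↪ S) (b : V ↪ T)
    (Φ : Recollement U V → k) : Recollement S T → k :=
  fun E => if P E then Φ (E.restrict a b) else 0

theorem ker_sum {S T ι : Type} [Fintype ι] (P : Recollement S T → Prop) (a : U ↪ S) (b : V ↪ T)
    (Φ : ι → Recollement U V → k) : ∑ i, ker P a b (Φ i) = ker P a b (∑ i, Φ i) := by
  funext E
  simp only [ker, Finset.sum_apply]
  split_ifs <;> simp

theorem ker_zero {S T : Type} (P : Recollement S T → Prop) (a : U ↪ S) (b : V ↪ T) :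
    ker P a b (0 : Recollement U V → k) = 0 := by
  funext E
  simp [ker]

theorem IsPoly.ker {S T : Type} (P : Recollement S T → Prop) (a : U ↪ S) (b : V ↪ T)
    {Φ : k → Recollement U V → k} (h : ∀ E, IsPoly (Φ · E)) (E : Recollement S T) :
    IsPoly fun t => ker P a b (Φ t) E := .ite _ (h _)

/-- The matrix entries of `id ⊗ Φ : 𝔥 ⊗ [U] → 𝔥 ⊗ [V]`: the point has to go to the point. At integers,
this is `e_i ⊗ e_f ↦ e_i ⊗ Φ e_f` (see `hKer_glued`). -/
noncomputable def hKer (Φ : Recollement U V → k) (c : Option U) (d : Option V) :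
    Recollement (hSet U c) (hSet V d) → k :=
  ker (fun E => hPt d ∈ E (hPt c)) (hInc c) (hInc d) Φ

/-- The matrix entries of `s ⊗ Φ : 𝔥 ⊗ [U] → [V]`, `e_i ⊗ e_f ↦ Φ e_f`. -/
noncomputable def sKer (Φ : Recollement U V → k) (c : Option U) : Recollement (hSet U c) V → k :=
  ker (fun _ => True) (hInc c) (.refl V) Φ

/-- The inclusion of `U` in a set glued from two points and `U`. -/
def hhInc (c : Option U) (d : Option (hSet U c)) : U ↪ hSet (hSet U c) d :=
  (hInc c).trans (hInc d)

/-- The inner of the two points. -/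
def hhPt (c : Option U) (d : Option (hSet U c)) : hSet (hSet U c) d := hInc d (hPt c)

/-- The matrix entries of `r ⊗ Φ : 𝔥 ⊗ [U] → 𝔥 ⊗ 𝔥 ⊗ [V]`, `e_i ⊗ e_f ↦ e_i ⊗ e_i ⊗ Φ e_f`. -/
noncomputable def rKer (Φ : Recollement U V → k) (c : Option U) (c' : Option V)
    (d' : Option (hSet V c')) : Recollement (hSet U c) (hSet (hSet V c') d') → k :=
  ker (fun E => hPt d' ∈ E (hPt c) ∧ hhPt c' d' ∈ E (hPt c)) (hInc c) (hhInc c' d') Φ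

/-- The matrix entries of `ρ ⊗ Φ : 𝔥 ⊗ 𝔥 ⊗ [U] → 𝔥 ⊗ [V]`, `e_i ⊗ e_j ⊗ e_f ↦ δ_{ij} e_i ⊗ Φ e_f`. -/
noncomputable def rhoKer (Φ : Recollement U V → k) (c : Option U) (d : Option (hSet U c))
    (c' : Option V) : Recollement (hSet (hSet U c) d) (hSet V c') → k :=
  ker (fun E => hPt c' ∈ E (hPt d) ∧ hPt c' ∈ E (hhPt c d)) (hhInc c d) (hInc c') Φ

/-- The matrix entries of `P ⊗ Φ : 𝔥 ⊗ 𝔥 ⊗ [U] → 𝔥 ⊗ 𝔥 ⊗ [V]`,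
`e_i ⊗ e_j ⊗ e_f ↦ e_j ⊗ e_i ⊗ Φ e_f`. -/
noncomputable def swapKer (Φ : Recollement U V → k) (c : Option U) (d : Option (hSet U c))
    (c' : Option V) (d' : Option (hSet V c')) :
    Recollement (hSet (hSet U c) d) (hSet (hSet V c') d') → k :=
  ker (fun E => hhPt c' d' ∈ E (hPt d) ∧ hPt d' ∈ E (hhPt c d)) (hhInc c d) (hhInc c' d') Φ

theorem hKer_glued [DecidableEq I] (Φ : Recollement U V → k) (c : Option U) (d : Option V)
    (p : hSet U c ↪ I) (q : hSet V d ↪ I) : hKer Φ c d (glued p q) =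
      if p (hPt c) = q (hPt d) then Φ (glued ((hInc c).trans p) ((hInc d).trans q)) else 0 := by
  simp only [hKer, ker, mem_glued, restrict_glued]

theorem sKer_glued (Φ : Recollement U V → k) (c : Option U)
    (p : hSet U c ↪ I) (q : V ↪ I) :
    sKer Φ c (glued p q) = Φ (glued ((hInc c).trans p) q) := by
  simp only [sKer, ker, restrict_glued, if_true]
  rfl

theorem rKer_glued [DecidableEq I] (Φ : Recollement U V → k) (c : Option U) (c' : Option V)
    (d' : Option (hSet V c')) (p : hSet U c ↪ I) (q : hSet (hSet V c') d' ↪ I) :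
    rKer Φ c c' d' (glued p q) =
      if p (hPt c) = q (hPt d') ∧ p (hPt c) = ((hInc d').trans q) (hPt c') then
        Φ (glued ((hInc c).trans p) ((hInc c').trans ((hInc d').trans q))) else 0 := by
  simp only [rKer, ker, mem_glued, restrict_glued]
  exact if_congr Iff.rfl rfl rfl

theorem rhoKer_glued [DecidableEq I] (Φ : Recollement U V → k) (c : Option U) (d : Option (hSet U c))
    (c' : Option V) (p : hSet (hSet U c) d ↪ I) (q : hSet V c' ↪ I) :
    rhoKer Φ c d c' (glued p q) =
      if p (hPt d) = q (hPt c') ∧ ((hInc d).trans p) (hPt c) = q (hPt c') then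
        Φ (glued ((hInc c).trans ((hInc d).trans p)) ((hInc c').trans q)) else 0 := by
  simp only [rhoKer, ker, mem_glued, restrict_glued]
  exact if_congr Iff.rfl rfl rfl

theorem swapKer_glued [DecidableEq I] (Φ : Recollement U V → k) (c : Option U) (d : Option (hSet U c))
    (c' : Option V) (d' : Option (hSet V c'))
    (p : hSet (hSet U c) d ↪ I) (q : hSet (hSet V c') d' ↪ I) :
    swapKer Φ c d c' d' (glued p q) =
      if p (hPt d) = ((hInc d').trans q) (hPt c') ∧
          ((hInc d).trans p) (hPt c) = q (hPt d') then
        Φ (glued ((hInc c).trans ((hInc d).trans p)) ((hInc c').trans ((hInc d').trans q)))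
      else 0 := by
  simp only [swapKer, ker, mem_glued, restrict_glued]
  exact if_congr Iff.rfl rfl rfl

noncomputable def hEmbEquiv : (Σ c : Option U, (hSet U c ↪ I)) ≃ I × (U ↪ I) :=
  Equiv.ofBijective (fun p => (p.2 (hPt p.1), (hInc p.1).trans p.2)) <| by
    classical
    constructor
    · rintro ⟨c, p⟩ ⟨d, q⟩ h
      simp only [Prod.mk.injEq] at h
      obtain ⟨h1, h2⟩ := h
      have h3 : ∀ u, p (hInc c u) = q (hInc d u) := fun u => DFunLike.congr_fun h2 u
      rcases c with _ | u <;> rcases d with _ | u'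
      · congr 1
        refine Function.Embedding.ext fun x => ?_
        rcases x with _ | x
        · exact h1
        · exact h3 x
      · exact absurd (p.injective (h1.trans (h3 u').symm)) (by rintro ⟨⟩)
      · exact absurd (q.injective (h1.symm.trans (h3 u))) (by rintro ⟨⟩)
      · have h4 : p = q := Function.Embedding.ext h3
        subst h4
        have : u = u' := p.injective h1
        rw [this]
    · rintro ⟨i, f⟩
      by_cases h : ∃ u, f u = i
      · obtain ⟨u, rfl⟩ := h
        exact ⟨⟨some u, f⟩, rfl⟩
      · exact ⟨⟨none, f.optionElim i (by simpa using h)⟩, rfl⟩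

theorem sum_hSet [Fintype U] [Fintype I] (F : I → (U ↪ I) → k) :
    ∑ c : Option U, ∑ p : hSet U c ↪ I, F (p (hPt c)) ((hInc c).trans p) =
      ∑ i, ∑ f, F i f := by
  rw [← Fintype.sum_prod_type', ← Fintype.sum_equiv hEmbEquiv
    (fun p => F (p.2 (hPt p.1)) ((hInc p.1).trans p.2)) _ (fun _ => rfl),
    ← Finset.univ_sigma_univ, Finset.sum_sigma]

open Classical in
theorem hKer_id [Fintype U] (c d : Option U) (E : Recollement (hSet U c) (hSet U d)) :
    hKer (idCoeff : Recollement U U → k) c d E ≠ 0 → c = d ∧ ∀ h : d = c, (h ▸ E) = PEquiv.refl _ := by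
  intro h
  obtain ⟨p, q, rfl⟩ := exists_glued E
  rw [hKer_glued] at h
  split_ifs at h with h1
  · by_cases h2 : (hInc c).trans p = (hInc d).trans q
    · have := hEmbEquiv.injective (a₁ := ⟨c, p⟩) (a₂ := ⟨d, q⟩) (Prod.ext h1 h2)
      simp only [Sigma.mk.injEq] at this
      obtain ⟨rfl, h3⟩ := this
      refine ⟨rfl, fun _ => ?_⟩
      rw [← eq_of_heq h3]
      exact (glued_eq_refl _ _).2 rfl
    · exact absurd (if_neg fun h3 => h2 ((glued_eq_refl _ _).1 h3)) h
  · exact absurd rfl h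

theorem hKer_id_self [Fintype U] (c : Option U) :
    hKer (idCoeff : Recollement U U → k) c c = idCoeff := by
  classical
  funext E
  by_cases h : E = PEquiv.refl _
  · subst h
    have h1 : glued (.refl (hSet U c)) (.refl (hSet U c)) = PEquiv.refl _ :=
      (glued_eq_refl _ _).2 rfl
    rw [← h1, hKer_glued, idCoeff, idCoeff, if_pos rfl, if_pos ((glued_eq_refl _ _).2 rfl),
      if_pos h1]
  · rw [show idCoeff E = (0 : k) from if_neg h]
    by_contra h2
    exact h ((hKer_id c c E h2).2 rfl)

theorem hKer_id_of_ne [Fintype U] {c d : Option U} (h : c ≠ d) :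
    hKer (idCoeff : Recollement U U → k) c d = 0 := by
  funext E
  by_contra h2
  exact h (hKer_id c d E h2).1

variable [CharZero k] {X : Type} [Fintype U] [Fintype V] [Fintype W] [Fintype X]

theorem hKer_comp (t : k) (Φ : Recollement U V → k) (Ψ : Recollement V W → k)
    (c : Option U) (e : Option W) :
    ∑ d, comp t (hKer Φ c d) (hKer Ψ d e) = hKer (comp t Φ Ψ) c e := by
  refine ext_of_glued (Φ := fun t => ∑ d, comp t (hKer Φ c d) (hKer Ψ d e))
    (Ψ := fun t => hKer (comp t Φ Ψ) c e) ?_ ?_ 0 ?_ t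
  · intro E
    simp only [Finset.sum_apply]
    exact .sum _ fun d => .comp_const _ _ E
  · exact fun E => .ker _ _ _ (.comp_const _ _) _
  · intro n _ p q
    have hn : (n : k) = Fintype.card (Fin n) := by simp
    simp only [Finset.sum_apply, comp_glued hn, hKer_glued]
    refine (sum_hSet (fun j g => (if p (hPt c) = j then Φ (glued ((hInc c).trans p) g) else 0) *
      (if j = q (hPt e) then Ψ (glued g ((hInc e).trans q)) else 0))).trans ?_
    simp [ite_mul, Finset.sum_ite_irrel]

theorem sum_hhSet {I : Type} [Fintype I] (F : I → I → (U ↪ I) → k) :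
    ∑ c : Option U, ∑ d : Option (hSet U c), ∑ p : hSet (hSet U c) d ↪ I,
      F (p (hPt d)) (((hInc d).trans p) (hPt c)) ((hInc c).trans ((hInc d).trans p)) =
      ∑ i, ∑ j, ∑ f, F i j f := by
  refine (Finset.sum_congr rfl fun c _ =>
    sum_hSet (fun i g => F i (g (hPt c)) ((hInc c).trans g))).trans ?_
  rw [Finset.sum_comm]
  exact Finset.sum_congr rfl fun i _ => sum_hSet (fun j g => F i j g)

theorem hKer_comp_sKer (t : k) (Φ : Recollement U V → k) (Ψ : Recollement V W → k)
    (c : Option U) :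
    ∑ d, comp t (hKer Φ c d) (sKer Ψ d) = sKer (comp t Φ Ψ) c := by
  refine ext_of_glued (Φ := fun t => ∑ d, comp t (hKer Φ c d) (sKer Ψ d))
    (Ψ := fun t => sKer (comp t Φ Ψ) c) ?_ ?_ 0 ?_ t
  · intro E
    simp only [Finset.sum_apply]
    exact .sum _ fun d => .comp_const _ _ E
  · exact fun E => .ker _ _ _ (.comp_const _ _) _
  · intro n _ p q
    have hn : (n : k) = Fintype.card (Fin n) := by simp
    simp only [Finset.sum_apply, comp_glued hn, hKer_glued, sKer_glued]
    refine (sum_hSet (fun j g => (if p (hPt c) = j then Φ (glued ((hInc c).trans p) g) else 0) *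
      Ψ (glued g q))).trans ?_
    simp [ite_mul, Finset.sum_ite_irrel]

theorem sKer_comp (t : k) (Φ : Recollement U V → k) (Ψ : Recollement V W → k)
    (c : Option U) : comp t (sKer Φ c) Ψ = sKer (comp t Φ Ψ) c := by
  refine ext_of_glued (Φ := fun t => comp t (sKer Φ c) Ψ)
    (Ψ := fun t => sKer (comp t Φ Ψ) c) (fun E => .comp_const _ _ _)
    (fun E => .ker _ _ _ (.comp_const _ _) _)    0 ?_ t
  intro n _ p q
  have hn : (n : k) = Fintype.card (Fin n) := by simp
  simp only [comp_glued hn, sKer_glued]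

theorem hKer_comp_rKer (t : k) (Φ : Recollement U V → k) (Ψ : Recollement V W → k)
    (c : Option U) (e : Option W) (e' : Option (hSet W e)) :
    ∑ d, comp t (hKer Φ c d) (rKer Ψ d e e') = rKer (comp t Φ Ψ) c e e' := by
  refine ext_of_glued (Φ := fun t => ∑ d, comp t (hKer Φ c d) (rKer Ψ d e e'))
    (Ψ := fun t => rKer (comp t Φ Ψ) c e e') ?_ ?_ 0 ?_ t
  · intro E
    simp only [Finset.sum_apply]
    exact .sum _ fun d => .comp_const _ _ E
  · exact fun E => .ker _ _ _ (.comp_const _ _) _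
  · intro n _ p q
    have hn : (n : k) = Fintype.card (Fin n) := by simp
    simp only [Finset.sum_apply, comp_glued hn, hKer_glued, rKer_glued]
    refine (sum_hSet (fun j g => (if p (hPt c) = j then Φ (glued ((hInc c).trans p) g) else 0) *
      (if j = q (hPt e') ∧ j = ((hInc e').trans q) (hPt e) then
        Ψ (glued g ((hInc e).trans ((hInc e').trans q))) else 0))).trans ?_
    simp [ite_mul, ite_and, Finset.sum_ite_irrel]
    split_ifs <;> simp_all

theorem rKer_comp_hKer (t : k) (Φ : Recollement U V → k) (Ψ : Recollement V W → k)
    (c : Option U) (e : Option W) (e' : Option (hSet W e)) :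
    ∑ d, ∑ d', comp t (rKer Φ c d d') (hKer (hKer Ψ d e) d' e') = rKer (comp t Φ Ψ) c e e' := by
  refine ext_of_glued
    (Φ := fun t => ∑ d, ∑ d', comp t (rKer Φ c d d') (hKer (hKer Ψ d e) d' e'))
    (Ψ := fun t => rKer (comp t Φ Ψ) c e e') ?_ ?_ 0 ?_ t
  · intro E
    simp only [Finset.sum_apply]
    exact .sum _ fun d => .sum _ fun d' => .comp_const _ _ E
  · exact fun E => .ker _ _ _ (.comp_const _ _) _
  · intro n _ p q
    have hn : (n : k) = Fintype.card (Fin n) := by simp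
    simp only [Finset.sum_apply, comp_glued hn, hKer_glued, rKer_glued]
    refine (sum_hhSet (fun i j g => (if p (hPt c) = i ∧ p (hPt c) = j then
      Φ (glued ((hInc c).trans p) g) else 0) *
      (if i = q (hPt e') then (if j = ((hInc e').trans q) (hPt e) then
        Ψ (glued g ((hInc e).trans ((hInc e').trans q))) else 0) else 0))).trans ?_
    simp [ite_mul, ite_and, Finset.sum_ite_irrel]

theorem hKer_comp_rhoKer (t : k) (Φ : Recollement U V → k) (Ψ : Recollement V W → k)
    (c : Option U) (c' : Option (hSet U c)) (e : Option W) :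
    ∑ d, ∑ d', comp t (hKer (hKer Φ c d) c' d') (rhoKer Ψ d d' e) =
      rhoKer (comp t Φ Ψ) c c' e := by
  refine ext_of_glued
    (Φ := fun t => ∑ d, ∑ d', comp t (hKer (hKer Φ c d) c' d') (rhoKer Ψ d d' e))
    (Ψ := fun t => rhoKer (comp t Φ Ψ) c c' e) ?_ ?_ 0 ?_ t
  · intro E
    simp only [Finset.sum_apply]
    exact .sum _ fun d => .sum _ fun d' => .comp_const _ _ E
  · exact fun E => .ker _ _ _ (.comp_const _ _) _
  · intro n _ p q
    have hn : (n : k) = Fintype.card (Fin n) := by simp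
    simp only [Finset.sum_apply, comp_glued hn, hKer_glued, rhoKer_glued]
    refine (sum_hhSet (fun i j g => (if p (hPt c') = i then
      (if ((hInc c').trans p) (hPt c) = j then
        Φ (glued ((hInc c).trans ((hInc c').trans p)) g) else 0) else 0) *
      (if i = q (hPt e) ∧ j = q (hPt e) then Ψ (glued g ((hInc e).trans q)) else 0))).trans ?_
    simp [ite_mul, ite_and, Finset.sum_ite_irrel]

theorem rhoKer_comp_hKer (t : k) (Φ : Recollement U V → k) (Ψ : Recollement V W → k)
    (c : Option U) (c' : Option (hSet U c)) (e : Option W) :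
    ∑ d, comp t (rhoKer Φ c c' d) (hKer Ψ d e) = rhoKer (comp t Φ Ψ) c c' e := by
  refine ext_of_glued (Φ := fun t => ∑ d, comp t (rhoKer Φ c c' d) (hKer Ψ d e))
    (Ψ := fun t => rhoKer (comp t Φ Ψ) c c' e) ?_ ?_ 0 ?_ t
  · intro E
    simp only [Finset.sum_apply]
    exact .sum _ fun d => .comp_const _ _ E
  · exact fun E => .ker _ _ _ (.comp_const _ _) _
  · intro n _ p q
    have hn : (n : k) = Fintype.card (Fin n) := by simp
    simp only [Finset.sum_apply, comp_glued hn, hKer_glued, rhoKer_glued]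
    refine (sum_hSet (fun j g => (if p (hPt c') = j ∧ ((hInc c').trans p) (hPt c) = j then
      Φ (glued ((hInc c).trans ((hInc c').trans p)) g) else 0) *
      (if j = q (hPt e) then Ψ (glued g ((hInc e).trans q)) else 0))).trans ?_
    simp [ite_mul, ite_and, Finset.sum_ite_irrel]

theorem hKer_comp_swapKer (t : k) (Φ : Recollement U V → k) (Ψ : Recollement V W → k)
    (c : Option U) (c' : Option (hSet U c)) (e : Option W) (e' : Option (hSet W e)) :
    ∑ d, ∑ d', comp t (hKer (hKer Φ c d) c' d') (swapKer Ψ d d' e e') =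
      swapKer (comp t Φ Ψ) c c' e e' := by
  refine ext_of_glued
    (Φ := fun t => ∑ d, ∑ d', comp t (hKer (hKer Φ c d) c' d') (swapKer Ψ d d' e e'))
    (Ψ := fun t => swapKer (comp t Φ Ψ) c c' e e') ?_ ?_ 0 ?_ t
  · intro E
    simp only [Finset.sum_apply]
    exact .sum _ fun d => .sum _ fun d' => .comp_const _ _ E
  · exact fun E => .ker _ _ _ (.comp_const _ _) _
  · intro n _ p q
    have hn : (n : k) = Fintype.card (Fin n) := by simp
    simp only [Finset.sum_apply, comp_glued hn, hKer_glued, swapKer_glued]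
    refine (sum_hhSet (fun i j g => (if p (hPt c') = i then
      (if ((hInc c').trans p) (hPt c) = j then
        Φ (glued ((hInc c).trans ((hInc c').trans p)) g) else 0) else 0) *
      (if i = ((hInc e').trans q) (hPt e) ∧ j = q (hPt e') then
        Ψ (glued g ((hInc e).trans ((hInc e').trans q))) else 0))).trans ?_
    simp [ite_mul, ite_and, Finset.sum_ite_irrel]

theorem swapKer_comp_hKer (t : k) (Φ : Recollement U V → k) (Ψ : Recollement V W → k)
    (c : Option U) (c' : Option (hSet U c)) (e : Option W) (e' : Option (hSet W e)) :
    ∑ d, ∑ d', comp t (swapKer Φ c c' d d') (hKer (hKer Ψ d e) d' e') =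
      swapKer (comp t Φ Ψ) c c' e e' := by
  refine ext_of_glued
    (Φ := fun t => ∑ d, ∑ d', comp t (swapKer Φ c c' d d') (hKer (hKer Ψ d e) d' e'))
    (Ψ := fun t => swapKer (comp t Φ Ψ) c c' e e') ?_ ?_ 0 ?_ t
  · intro E
    simp only [Finset.sum_apply]
    exact .sum _ fun d => .sum _ fun d' => .comp_const _ _ E
  · exact fun E => .ker _ _ _ (.comp_const _ _) _
  · intro n _ p q
    have hn : (n : k) = Fintype.card (Fin n) := by simp
    simp only [Finset.sum_apply, comp_glued hn, hKer_glued, swapKer_glued]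
    refine (sum_hhSet (fun i j g => (if p (hPt c') = j ∧ ((hInc c').trans p) (hPt c) = i then
        Φ (glued ((hInc c).trans ((hInc c').trans p)) g) else 0) *
      (if i = q (hPt e') then (if j = ((hInc e').trans q) (hPt e) then
        Ψ (glued g ((hInc e).trans ((hInc e').trans q))) else 0) else 0))).trans ?_
    simp [ite_mul, ite_and, Finset.sum_ite_irrel]

end PermutationObject

section Functor

open Idempotents

universe u
variable {k : Type u} [Field k] [CharZero k] {t : k}

/-- Deligne's category `Rep(S_t)`, the pseudo-abelian envelope of `Rep'(S_t)`: the Karoubi envelope of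
its additive envelope. -/
abbrev RepS (t : k) := Karoubi (Mat_ (Deligne₀ t))

/-- The object `𝔥 ⊗ X` of the additive envelope. -/
noncomputable def hObj (X : Mat_ (Deligne₀ t)) : Mat_ (Deligne₀ t) where
  ι := Σ i, Option (X.X i).carrier
  X p := ⟨hSet (X.X p.1).carrier p.2⟩

variable {X Y Z : Mat_ (Deligne₀ t)}

/-- The morphism `id ⊗ f : 𝔥 ⊗ X → 𝔥 ⊗ Y`. -/
noncomputable def hMap (f : X ⟶ Y) : hObj X ⟶ hObj Y :=
  fun p q => hKer (f p.1 q.1) p.2 q.2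

/-- The morphism `s ⊗ f`. -/
noncomputable def sMap (f : X ⟶ Y) : hObj X ⟶ Y :=
  fun p j => sKer (f p.1 j) p.2

/-- The morphism `r ⊗ f`. -/
noncomputable def rMap (f : X ⟶ Y) : hObj X ⟶ hObj (hObj Y) :=
  fun p q => rKer (f p.1 q.1.1) p.2 q.1.2 q.2

/-- The morphism `ρ ⊗ f`. -/
noncomputable def rhoMap (f : X ⟶ Y) : hObj (hObj X) ⟶ hObj Y :=
  fun p q => rhoKer (f p.1.1 q.1) p.1.2 p.2 q.2

/-- The morphism `P ⊗ f`, where `P` exchanges the two factors `𝔥`. -/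
noncomputable def swapMap (f : X ⟶ Y) : hObj (hObj X) ⟶ hObj (hObj Y) :=
  fun p q => swapKer (f p.1.1 q.1.1) p.1.2 p.2 q.1.2 q.2

theorem comp_eq {X Y Z : Mat_ (Deligne₀ t)} (f : X ⟶ Y) (g : Y ⟶ Z) (i : X.ι) (j : Z.ι) :
    (f ≫ g) i j = ∑ l, comp t (f i l) (g l j) := rfl

theorem sum_hObj {M : Type*} [AddCommMonoid M] (X : Mat_ (Deligne₀ t))
    (F : (hObj X).ι → M) : ∑ p, F p = ∑ i, ∑ c, F ⟨i, c⟩ := by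
  exact Fintype.sum_sigma (ι := X.ι) (α := fun i => Option (X.X i).carrier) F

theorem hMap_comp (f : X ⟶ Y) (g : Y ⟶ Z) : hMap f ≫ hMap g = hMap (f ≫ g) := by
  funext p q
  rw [comp_eq, sum_hObj]
  refine (Finset.sum_congr rfl fun j _ => hKer_comp t (f p.1 j) (g j q.1) p.2 q.2).trans ?_
  exact ker_sum _ _ _ _

theorem hMap_sMap (f : X ⟶ Y) (g : Y ⟶ Z) : hMap f ≫ sMap g = sMap (f ≫ g) := by
  funext p q
  rw [comp_eq, sum_hObj]
  refine (Finset.sum_congr rfl fun j _ => hKer_comp_sKer t (f p.1 j) (g j q) p.2).trans ?_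
  exact ker_sum _ _ _ _

theorem sMap_comp (f : X ⟶ Y) (g : Y ⟶ Z) : sMap f ≫ g = sMap (f ≫ g) := by
  funext p q
  rw [comp_eq]
  refine (Finset.sum_congr rfl fun j _ => sKer_comp t (f p.1 j) (g j q) p.2).trans ?_
  exact ker_sum _ _ _ _

theorem hMap_rMap (f : X ⟶ Y) (g : Y ⟶ Z) : hMap f ≫ rMap g = rMap (f ≫ g) := by
  funext p q
  rw [comp_eq, sum_hObj]
  refine (Finset.sum_congr rfl fun j _ =>
    hKer_comp_rKer t (f p.1 j) (g j q.1.1) p.2 q.1.2 q.2).trans ?_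
  exact ker_sum _ _ _ _

theorem rMap_hMap (f : X ⟶ Y) (g : Y ⟶ Z) : rMap f ≫ hMap (hMap g) = rMap (f ≫ g) := by
  funext p q
  rw [comp_eq, sum_hObj, sum_hObj]
  refine (Finset.sum_congr rfl fun j _ =>
    rKer_comp_hKer t (f p.1 j) (g j q.1.1) p.2 q.1.2 q.2).trans ?_
  exact ker_sum _ _ _ _

theorem hMap_rhoMap (f : X ⟶ Y) (g : Y ⟶ Z) : hMap (hMap f) ≫ rhoMap g = rhoMap (f ≫ g) := by
  funext p q
  rw [comp_eq, sum_hObj, sum_hObj]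
  refine (Finset.sum_congr rfl fun j _ =>
    hKer_comp_rhoKer t (f p.1.1 j) (g j q.1) p.1.2 p.2 q.2).trans ?_
  exact ker_sum _ _ _ _

theorem rhoMap_hMap (f : X ⟶ Y) (g : Y ⟶ Z) : rhoMap f ≫ hMap g = rhoMap (f ≫ g) := by
  funext p q
  rw [comp_eq, sum_hObj]
  refine (Finset.sum_congr rfl fun j _ =>
    rhoKer_comp_hKer t (f p.1.1 j) (g j q.1) p.1.2 p.2 q.2).trans ?_
  exact ker_sum _ _ _ _

theorem hMap_swapMap (f : X ⟶ Y) (g : Y ⟶ Z) :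
    hMap (hMap f) ≫ swapMap g = swapMap (f ≫ g) := by
  funext p q
  rw [comp_eq, sum_hObj, sum_hObj]
  refine (Finset.sum_congr rfl fun j _ =>
    hKer_comp_swapKer t (f p.1.1 j) (g j q.1.1) p.1.2 p.2 q.1.2 q.2).trans ?_
  exact ker_sum _ _ _ _

theorem swapMap_hMap (f : X ⟶ Y) (g : Y ⟶ Z) :
    swapMap f ≫ hMap (hMap g) = swapMap (f ≫ g) := by
  funext p q
  rw [comp_eq, sum_hObj, sum_hObj]
  refine (Finset.sum_congr rfl fun j _ =>
    swapKer_comp_hKer t (f p.1.1 j) (g j q.1.1) p.1.2 p.2 q.1.2 q.2).trans ?_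
  exact ker_sum _ _ _ _

theorem hMap_id (X : Mat_ (Deligne₀ t)) : hMap (𝟙 X) = 𝟙 (hObj X) := by
  classical
  funext ⟨i, c⟩ ⟨j, d⟩
  change hKer ((𝟙 X : X ⟶ X) i j) c d = _
  by_cases h : i = j
  · subst h
    rw [Mat_.id_apply_self]
    by_cases h2 : c = d
    · subst h2
      exact (hKer_id_self c).trans (Mat_.id_apply_self (hObj X) ⟨i, c⟩).symm
    · exact (hKer_id_of_ne h2).trans (Mat_.id_apply_of_ne (hObj X) ⟨i, c⟩ ⟨i, d⟩
        (fun h3 => h2 (by cases h3; rfl))).symm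
  · rw [Mat_.id_apply_of_ne _ _ _ h]
    exact (ker_zero _ _ _).trans (Mat_.id_apply_of_ne (hObj X) ⟨i, c⟩ ⟨j, d⟩
      (fun h2 => h (congrArg Sigma.fst h2))).symm

theorem hMap_zero : hMap (0 : X ⟶ Y) = 0 := by
  funext p q
  exact ker_zero (fun E => hPt q.2 ∈ E (hPt p.2)) (hInc p.2) (hInc q.2)

/-- The functor `𝔥 ⊗ -` on the additive envelope. -/
noncomputable def hFunctorMat (t : k) : Mat_ (Deligne₀ t) ⥤ Mat_ (Deligne₀ t) where
  obj := hObj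
  map := hMap
  map_id := hMap_id
  map_comp f g := (hMap_comp f g).symm

noncomputable def sMat (t : k) : hFunctorMat t ⟶ 𝟭 _ where
  app X := sMap (𝟙 X)
  naturality X Y f := (hMap_sMap f (𝟙 Y)).trans (.trans (by
    rw [Category.comp_id, Category.id_comp]) (sMap_comp (𝟙 X) f).symm)

noncomputable def rMat (t : k) : hFunctorMat t ⟶ hFunctorMat t ⋙ hFunctorMat t where
  app X := rMap (𝟙 X)
  naturality X Y f := (hMap_rMap f (𝟙 Y)).trans (.trans (by
    rw [Category.comp_id, Category.id_comp]) (rMap_hMap (𝟙 X) f).symm)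

noncomputable def rhoMat (t : k) : hFunctorMat t ⋙ hFunctorMat t ⟶ hFunctorMat t where
  app X := rhoMap (𝟙 X)
  naturality X Y f := (hMap_rhoMap f (𝟙 Y)).trans (.trans (by
    rw [Category.comp_id, Category.id_comp]) (rhoMap_hMap (𝟙 X) f).symm)

noncomputable def swapMat (t : k) :
    hFunctorMat t ⋙ hFunctorMat t ⟶ hFunctorMat t ⋙ hFunctorMat t where
  app X := swapMap (𝟙 X)
  naturality X Y f := (hMap_swapMap f (𝟙 Y)).trans (.trans (by
    rw [Category.comp_id, Category.id_comp]) (swapMap_hMap (𝟙 X) f).symm)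

/-- The functor `𝔥 ⊗ -` on `Rep(S_t)`. -/
noncomputable def hFunctor (t : k) : RepS t ⥤ RepS t :=
  (functorExtension₂ _ _).obj (hFunctorMat t)

noncomputable def sTrans (t : k) : hFunctor t ⟶ 𝟭 _ :=
  (functorExtension₂ _ _).map (sMat t)

noncomputable def rTrans (t : k) : hFunctor t ⟶ hFunctor t ⋙ hFunctor t :=
  (functorExtension₂ _ _).map (rMat t)

noncomputable def rhoTrans (t : k) : hFunctor t ⋙ hFunctor t ⟶ hFunctor t :=
  (functorExtension₂ _ _).map (rhoMat t)

noncomputable def swapTrans (t : k) :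
    hFunctor t ⋙ hFunctor t ⟶ hFunctor t ⋙ hFunctor t :=
  (functorExtension₂ _ _).map (swapMat t)

theorem hFunctor_map_zero (M N : RepS t) : (hFunctor t).map (0 : M ⟶ N) = 0 :=
  Karoubi.hom_ext _ _ hMap_zero

/-- The morphism `s ⊗ id : 𝔥 ⊗ M → M`, where `s : 𝔥 → 𝟏` is the standard morphism `e_i ↦ 1`. -/
noncomputable def hCounit (M : RepS t) : (hFunctor t).obj M ⟶ M := (sTrans t).app M

/-- The morphism `r ⊗ id : 𝔥 ⊗ M → 𝔥 ⊗ 𝔥 ⊗ M`, where `r` is `e_i ↦ e_i ⊗ e_i`. -/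
noncomputable def hDiag (M : RepS t) :
    (hFunctor t).obj M ⟶ (hFunctor t).obj ((hFunctor t).obj M) := (rTrans t).app M

/-- The morphism `ρ ⊗ id : 𝔥 ⊗ 𝔥 ⊗ M → 𝔥 ⊗ M`, where `ρ` is the multiplication `e_i ⊗ e_j ↦ δ_{ij} e_i`. -/
noncomputable def hMul (M : RepS t) :
    (hFunctor t).obj ((hFunctor t).obj M) ⟶ (hFunctor t).obj M := (rhoTrans t).app M

/-- The morphism `P ⊗ id` of `𝔥 ⊗ 𝔥 ⊗ M` that exchanges the two factors `𝔥`. -/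
noncomputable def hSwap (M : RepS t) :
    (hFunctor t).obj ((hFunctor t).obj M) ⟶ (hFunctor t).obj ((hFunctor t).obj M) :=
  (swapTrans t).app M

end Functor

section Wreath

universe u v
variable {k : Type u} [Field k] [CharZero k]

/-- The objects of `Rep(S_t ⋉ A^{⊗t})`: an object `M` of `Rep(S_t)` with a morphism
`y : A ⊗ 𝔥 ⊗ M → M`, i.e. a linear family of morphisms `y_a : 𝔥 ⊗ M → M`, such that `y_1 = s ⊗ id`,
`y_a ∘ (id ⊗ y_b) ∘ r = y_{ab}` and
`y_a ∘ (id ⊗ y_b) - y_b ∘ (id ⊗ y_a) ∘ P = y_{[a,b]} ∘ (ρ ⊗ id)`. -/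
structure RepWreath (A : Type v) [Ring A] [Algebra k A] (t : k) where
  obj : RepS t
  y : A →ₗ[k] ((hFunctor t).obj obj ⟶ obj)
  y_one : y 1 = hCounit obj
  y_mul : ∀ a b, hDiag obj ≫ (hFunctor t).map (y b) ≫ y a = y (a * b)
  y_comm : ∀ a b, (hFunctor t).map (y b) ≫ y a - hSwap obj ≫ (hFunctor t).map (y a) ≫ y b =
    hMul obj ≫ y (a * b - b * a)

namespace RepWreath

variable {A : Type v} [Ring A] [Algebra k A] {t : k}

/-- The morphisms of `Rep(S_t)` that commute with the maps `y_a`. -/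
@[ext]
structure Hom (M N : RepWreath A t) where
  hom : M.obj ⟶ N.obj
  comm : ∀ a, (hFunctor t).map hom ≫ N.y a = M.y a ≫ hom

noncomputable instance : Category (RepWreath A t) where
  Hom := Hom
  id M := ⟨𝟙 M.obj, fun a => by simp⟩
  comp f g := ⟨f.hom ≫ g.hom, fun a => by
    rw [Functor.map_comp, Category.assoc, g.comm, ← Category.assoc, f.comm, Category.assoc]⟩

noncomputable instance : Limits.HasZeroMorphisms (RepWreath A t) where
  zero M N := ⟨⟨0, fun a => by rw [hFunctor_map_zero, Limits.zero_comp, Limits.comp_zero]⟩⟩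
  comp_zero f _ := Hom.ext (Limits.comp_zero (f := f.hom))
  zero_comp _ _ _ f := Hom.ext (Limits.zero_comp (f := f.hom))

end RepWreath

end Wreath

section Colour

variable {k : Type*} [Field k] {U V W I : Type}

/-- The point of `U` that an injection `f : U → I` sends to `i`, if there is one. -/
noncomputable def pos (f : U ↪ I) (i : I) : Option U := (ofEmb f).symm i

theorem mem_pos (f : U ↪ I) (i : I) (u : U) : u ∈ pos f i ↔ f u = i := by
  rw [pos, PEquiv.mem_iff_mem, mem_ofEmb]

theorem pos_hPt (c : Option U) (p : hSet U c ↪ I) :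
    pos ((hInc c).trans p) (p (hPt c)) = c := by
  refine Option.ext fun u => (mem_pos _ _ _).trans ?_
  refine (p.injective.eq_iff (a := hInc c u) (b := hPt c)).trans ?_
  rcases c with _ | v
  · exact iff_of_false (by rintro ⟨⟩) (by rintro ⟨⟩)
  · exact ⟨fun h => congrArg some h.symm, fun h => (Option.some.inj h).symm⟩

theorem pos_trans {S : Type} (f : U ↪ S) (p : S ↪ I) (x : S) :
    pos (f.trans p) (p x) = pos f x := by
  refine Option.ext fun u => (mem_pos _ _ _).trans (.trans ?_ (mem_pos _ _ _).symm)
  exact p.injective.eq_iff (a := f u) (b := x)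

/-- `c` and `d` can be the positions in `U` and in `V` of one and the same point, when `U` and `V` are
glued by `E`. -/
def Matches (E : Recollement U V) : Option U → Option V → Prop
  | some u, some v => v ∈ E u
  | some u, none => E u = none
  | none, some v => E.symm v = none
  | none, none => True

theorem matches_glued (f : U ↪ I) (g : V ↪ I) (i : I) :
    Matches (glued f g) (pos f i) (pos g i) := by
  have hf := mem_pos f i
  have hg := mem_pos g i
  rcases hu : pos f i with _ | u <;> rcases hv : pos g i with _ | v
  · trivial
  · refine Option.eq_none_iff_forall_not_mem.2 fun u huv => ?_
    rw [PEquiv.mem_iff_mem, mem_glued, (hg v).1 hv] at huv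
    have := (hf u).2 huv
    rw [hu] at this
    cases this
  · refine Option.eq_none_iff_forall_not_mem.2 fun v huv => ?_
    rw [mem_glued, (hf u).1 hu] at huv
    have := (hg v).2 huv.symm
    rw [hv] at this
    cases this
  · exact (mem_glued _ _ _ _).2 (((hf u).1 hu).trans ((hg v).1 hv).symm)

/-- Every recollement that occurs in `Φ` preserves the colours. A colouring of `U` assigns a colour to
each point of `U` and one to all the points outside of `U`. -/
def Preserves (κ : Option U → k) (Φ : Recollement U V → k) (κ' : Option V → k) : Prop :=
  ∀ E, Φ E ≠ 0 → ∀ c d, Matches E c d → κ c = κ' d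

theorem Preserves.glued {κ : Option U → k} {Φ : Recollement U V → k} {κ' : Option V → k}
    (h : Preserves κ Φ κ') (f : U ↪ I) (g : V ↪ I) (i : I) :
    Φ (DeligneWreath.glued f g) * κ' (pos g i) =
      κ (pos f i) * Φ (DeligneWreath.glued f g) := by
  by_cases h0 : Φ (DeligneWreath.glued f g) = 0
  · simp [h0]
  · rw [h _ h0 _ _ (matches_glued f g i), mul_comm]

/-- The position of the outer point of `𝔥 ⊗ 𝔥 ⊗ [U]` in `U`. -/
noncomputable def flat (c : Option U) (d : Option (hSet U c)) : Option U :=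
  pos (hhInc c d) (hPt d)

theorem flat_eq (c : Option U) (d : Option (hSet U c)) (p : hSet (hSet U c) d ↪ I) :
    pos ((hInc c).trans ((hInc d).trans p)) (p (hPt d)) = flat c d :=
  pos_trans (hhInc c d) p (hPt d)

theorem pos_hhPt (c : Option U) (d : Option (hSet U c)) (p : hSet (hSet U c) d ↪ I) :
    pos ((hInc c).trans ((hInc d).trans p)) (((hInc d).trans p) (hPt c)) = c :=
  pos_hPt c ((hInc d).trans p)

variable [CharZero k] [Fintype U] [Fintype V] [Fintype W]

theorem hKer_comp_colour (t : k) {κ : Option U → k} {Φ : Recollement U V → k}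
    {κ' : Option V → k} (h : Preserves κ Φ κ') (Ψ : Recollement V W → k) (c : Option U) :
    ∑ d, comp t (hKer Φ c d) (κ' d • sKer Ψ d) = κ c • sKer (comp t Φ Ψ) c := by
  refine ext_of_glued (Φ := fun t => ∑ d, comp t (hKer Φ c d) (κ' d • sKer Ψ d))
    (Ψ := fun t => κ c • sKer (comp t Φ Ψ) c) ?_ ?_ 0 ?_ t
  · intro E
    simp only [Finset.sum_apply]
    exact .sum _ fun d => .comp_const _ _ E
  · exact fun E => .mul (.const _) (.ker _ _ _ (.comp_const _ _) _)
  · intro n _ p q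
    have hn : (n : k) = Fintype.card (Fin n) := by simp
    simp only [Finset.sum_apply, comp_glued hn, hKer_glued, sKer_glued, Pi.smul_apply,
      smul_eq_mul]
    have h1 : ∀ (d : Option V) (g : hSet V d ↪ Fin n),
        κ' d = κ' (pos ((hInc d).trans g) (g (hPt d))) := fun d g => by rw [pos_hPt]
    refine (Finset.sum_congr rfl fun d _ => Finset.sum_congr rfl fun g _ => by
      rw [h1 d g]).trans ((sum_hSet (fun j g => (if p (hPt c) = j then
        Φ (glued ((hInc c).trans p) g) else 0) * (κ' (pos g j) * Ψ (glued g q)))).trans ?_)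
    simp only [← mul_assoc, ite_mul, zero_mul]
    rw [Finset.sum_comm]
    simp only [Finset.sum_ite_eq, Finset.mem_univ, if_true, h.glued, pos_hPt, Finset.mul_sum,
      mul_assoc]

theorem hKer_colour_comp_colour (t : k) {κ κ' : Option U → k} {Φ : Recollement U V → k}
    {κ₁ : Option V → k} (h : Preserves κ Φ κ₁) (Ψ : Recollement V W → k) (c : Option U)
    (c' : Option (hSet U c)) :
    ∑ d, comp t (hKer (κ' c • sKer Φ c) c' d) (κ₁ d • sKer Ψ d) =
      (κ (flat c c') * κ' c) • sKer (sKer (comp t Φ Ψ) c) c' := by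
  refine ext_of_glued
    (Φ := fun t => ∑ d, comp t (hKer (κ' c • sKer Φ c) c' d) (κ₁ d • sKer Ψ d))
    (Ψ := fun t => (κ (flat c c') * κ' c) • sKer (sKer (comp t Φ Ψ) c) c') ?_ ?_ 0 ?_ t
  · intro E
    simp only [Finset.sum_apply]
    exact .sum _ fun d => .comp_const _ _ E
  · exact fun E => .mul (.const _) (.ker _ _ _ (.ker _ _ _ (.comp_const _ _)) _)
  · intro n _ p q
    have hn : (n : k) = Fintype.card (Fin n) := by simp
    simp only [Finset.sum_apply, comp_glued hn, hKer_glued, sKer_glued, Pi.smul_apply,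
      smul_eq_mul]
    have h1 : ∀ (d : Option V) (g : hSet V d ↪ Fin n),
        κ₁ d = κ₁ (pos ((hInc d).trans g) (g (hPt d))) := fun d g => by rw [pos_hPt]
    refine (Finset.sum_congr rfl fun d _ => Finset.sum_congr rfl fun g _ => by
      rw [h1 d g]).trans ((sum_hSet (fun j g => (if p (hPt c') = j then
        κ' c * Φ (glued ((hInc c).trans ((hInc c').trans p)) g) else 0) *
          (κ₁ (pos g j) * Ψ (glued g q)))).trans ?_)
    simp only [ite_mul, zero_mul]
    rw [Finset.sum_comm]
    simp only [Finset.sum_ite_eq, Finset.mem_univ, if_true, Finset.mul_sum]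
    refine Finset.sum_congr rfl fun g _ => ?_
    have := h.glued ((hInc c).trans ((hInc c').trans p)) g (p (hPt c'))
    rw [flat_eq] at this
    linear_combination κ' c * Ψ (glued g q) * this

theorem rKer_comp_colour (t : k) (κ κ' : Option U → k) (Ψ : Recollement U W → k)
    (c : Option U) :
    ∑ d, ∑ d', comp t (rKer idCoeff c d d') ((κ (flat d d') * κ' d) • sKer (sKer Ψ d) d') =
      (κ c * κ' c) • sKer Ψ c := by
  refine ext_of_glued (Φ := fun t => ∑ d, ∑ d', comp t (rKer idCoeff c d d')
      ((κ (flat d d') * κ' d) • sKer (sKer Ψ d) d'))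
    (Ψ := fun _ => (κ c * κ' c) • sKer Ψ c) ?_ (fun E => .const _) 0 ?_ t
  · intro E
    simp only [Finset.sum_apply]
    exact .sum _ fun d => .sum _ fun d' => .comp_const _ _ E
  · intro n _ p q
    have hn : (n : k) = Fintype.card (Fin n) := by simp
    simp only [Finset.sum_apply, comp_glued hn, rKer_glued, sKer_glued, Pi.smul_apply,
      smul_eq_mul]
    have h1 : ∀ (d : Option U) (d' : Option (hSet U d)) (g : hSet (hSet U d) d' ↪ Fin n),
        κ (flat d d') * κ' d = κ (pos ((hInc d).trans ((hInc d').trans g)) (g (hPt d'))) *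
          κ' (pos ((hInc d).trans ((hInc d').trans g)) (((hInc d').trans g) (hPt d))) :=
      fun d d' g => by rw [flat_eq, pos_hhPt]
    refine (Finset.sum_congr rfl fun d _ => Finset.sum_congr rfl fun d' _ =>
      Finset.sum_congr rfl fun g _ => by rw [h1 d d' g]).trans
      ((sum_hhSet (fun i j g => (if p (hPt c) = i ∧ p (hPt c) = j then
        idCoeff (glued ((hInc c).trans p) g) else 0) *
          (κ (pos g i) * κ' (pos g j) * Ψ (glued g q)))).trans ?_)
    simp [ite_and, ite_mul, idCoeff, glued_eq_refl, pos_hPt]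

theorem swapKer_comp_colour (t : k) (κ κ' : Option U → k) (Ψ : Recollement U W → k)
    (c : Option U) (c' : Option (hSet U c)) :
    ∑ d, ∑ d', comp t (swapKer idCoeff c c' d d')
      ((κ (flat d d') * κ' d) • sKer (sKer Ψ d) d') =
      (κ' (flat c c') * κ c) • sKer (sKer Ψ c) c' := by
  refine ext_of_glued (Φ := fun t => ∑ d, ∑ d', comp t (swapKer idCoeff c c' d d')
      ((κ (flat d d') * κ' d) • sKer (sKer Ψ d) d'))
    (Ψ := fun _ => (κ' (flat c c') * κ c) • sKer (sKer Ψ c) c') ?_ (fun E => .const _) 0 ?_ t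
  · intro E
    simp only [Finset.sum_apply]
    exact .sum _ fun d => .sum _ fun d' => .comp_const _ _ E
  · intro n _ p q
    have hn : (n : k) = Fintype.card (Fin n) := by simp
    simp only [Finset.sum_apply, comp_glued hn, swapKer_glued, sKer_glued, Pi.smul_apply,
      smul_eq_mul]
    have h1 : ∀ (d : Option U) (d' : Option (hSet U d)) (g : hSet (hSet U d) d' ↪ Fin n),
        κ (flat d d') * κ' d = κ (pos ((hInc d).trans ((hInc d').trans g)) (g (hPt d'))) *
          κ' (pos ((hInc d).trans ((hInc d').trans g)) (((hInc d').trans g) (hPt d))) :=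
      fun d d' g => by rw [flat_eq, pos_hhPt]
    refine (Finset.sum_congr rfl fun d _ => Finset.sum_congr rfl fun d' _ =>
      Finset.sum_congr rfl fun g _ => by rw [h1 d d' g]).trans
      ((sum_hhSet (fun i j g => (if p (hPt c') = j ∧ ((hInc c').trans p) (hPt c) = i then
        idCoeff (glued ((hInc c).trans ((hInc c').trans p)) g) else 0) *
          (κ (pos g i) * κ' (pos g j) * Ψ (glued g q)))).trans ?_)
    have h2 := flat_eq c c' p
    have h3 := pos_hhPt c c' p
    simp only [Function.Embedding.trans_apply] at h3
    simp [ite_and, idCoeff, glued_eq_refl, h2, h3, mul_comm]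

end Colour

section ColourMat

universe u
variable {k : Type u} [Field k] [CharZero k] {t : k} {X Y Z : Mat_ (Deligne₀ t)}

/-- A colouring of the points of `X`; `none` stands for all points that are not in the carrier. -/
abbrev Colouring (X : Mat_ (Deligne₀ t)) := ∀ i, Option (X.X i).carrier → k

/-- The morphism `𝔥 ⊗ X → Y`, `e_i ⊗ e_f ↦ κ(i) f(e_f)`, where `κ(i)` is the colour of the point `i`. -/
noncomputable def colourMap (κ : Colouring X) (f : X ⟶ Y) : hObj X ⟶ Y :=
  fun p j => κ p.1 p.2 • sKer (f p.1 j) p.2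

/-- The morphism `𝔥 ⊗ 𝔥 ⊗ X → Y`, `e_i ⊗ e_j ⊗ e_f ↦ κ(i) κ'(j) f(e_f)`. -/
noncomputable def colourMap₂ (κ κ' : Colouring X) (f : X ⟶ Y) : hObj (hObj X) ⟶ Y :=
  fun p j => (κ p.1.1 (flat p.1.2 p.2) * κ' p.1.1 p.1.2) • sKer (sKer (f p.1.1 j) p.1.2) p.2

/-- A morphism all of whose matrix entries preserve the colours. -/
def PreservesMat (κ : Colouring X) (f : X ⟶ Y) (κ' : Colouring Y) : Prop :=
  ∀ i j, Preserves (κ i) (f i j) (κ' j)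

theorem hMap_colourMap {κ : Colouring X} {f : X ⟶ Y} {κ' : Colouring Y}
    (h : PreservesMat κ f κ') (g : Y ⟶ Z) : hMap f ≫ colourMap κ' g = colourMap κ (f ≫ g) := by
  funext p q
  rw [comp_eq, sum_hObj]
  refine (Finset.sum_congr rfl fun j _ =>
    hKer_comp_colour t (h p.1 j) (g j q) p.2).trans ?_
  refine (Finset.smul_sum (s := Finset.univ) (r := κ p.1 p.2)
    (f := fun j => sKer (comp t (f p.1 j) (g j q)) p.2)).symm.trans ?_
  exact congrArg (fun Ψ => κ p.1 p.2 • Ψ) (ker_sum _ _ _ _)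

theorem colourMap_comp (κ : Colouring X) (f : X ⟶ Y) (g : Y ⟶ Z) :
    colourMap κ f ≫ g = colourMap κ (f ≫ g) := by
  funext p q
  rw [comp_eq]
  refine (Finset.sum_congr rfl fun j _ => (smul_comp t _ _ _).trans
    (congrArg _ (sKer_comp t (f p.1 j) (g j q) p.2))).trans ?_
  refine (Finset.smul_sum (s := Finset.univ) (r := κ p.1 p.2)
    (f := fun j => sKer (comp t (f p.1 j) (g j q)) p.2)).symm.trans ?_
  exact congrArg (fun Ψ => κ p.1 p.2 • Ψ) (ker_sum _ _ _ _)

theorem hMap_colourMap_colourMap {κ : Colouring X} (κ' : Colouring X) {f : X ⟶ Y}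
    {κ₁ : Colouring Y} (h : PreservesMat κ f κ₁) (g : Y ⟶ Z) :
    hMap (colourMap κ' f) ≫ colourMap κ₁ g = colourMap₂ κ κ' (f ≫ g) := by
  funext p q
  rw [comp_eq, sum_hObj]
  refine (Finset.sum_congr rfl fun j _ =>
    hKer_colour_comp_colour t (h p.1.1 j) (g j q) p.1.2 p.2).trans ?_
  refine (Finset.smul_sum (s := Finset.univ)
    (r := κ p.1.1 (flat p.1.2 p.2) * κ' p.1.1 p.1.2)
    (f := fun j => sKer (sKer (comp t (f p.1.1 j) (g j q)) p.1.2) p.2)).symm.trans ?_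
  refine congrArg _ ((ker_sum _ _ _ _).trans ?_)
  exact congrArg (fun Φ => sKer Φ p.2) (ker_sum _ _ _ _)

theorem rMap_colourMap₂ (κ κ' : Colouring X) (f : X ⟶ Y) :
    rMap (𝟙 X) ≫ colourMap₂ κ κ' f = colourMap (fun i c => κ i c * κ' i c) f := by
  funext p q
  rw [comp_eq, sum_hObj, sum_hObj, Finset.sum_eq_single p.1]
  · have h : (𝟙 X : X ⟶ X) p.1 p.1 = (idCoeff : Recollement _ _ → k) := Mat_.id_apply_self X p.1
    refine Eq.trans ?_ (rKer_comp_colour t (κ p.1) (κ' p.1) (f p.1 q) p.2)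
    refine Finset.sum_congr rfl fun d _ => Finset.sum_congr rfl fun d' _ => ?_
    rw [← h]
    rfl
  · intro j _ hj
    refine Finset.sum_eq_zero fun d _ => Finset.sum_eq_zero fun d' _ => ?_
    have h : (𝟙 X : X ⟶ X) p.1 j = (0 : Recollement _ _ → k) :=
      Mat_.id_apply_of_ne X p.1 j hj.symm
    have h' : rKer ((𝟙 X : X ⟶ X) p.1 j) p.2 d d' = 0 := by
      rw [h]
      exact ker_zero _ _ _
    exact (congrArg (fun Φ : (hObj X).X p ⟶ (hObj (hObj X)).X ⟨⟨j, d⟩, d'⟩ =>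
      Φ ≫ colourMap₂ κ κ' f ⟨⟨j, d⟩, d'⟩ q) h').trans Limits.zero_comp
  · intro h
    exact absurd (Finset.mem_univ _) h

theorem swapMap_colourMap₂ (κ κ' : Colouring X) (f : X ⟶ Y) :
    swapMap (𝟙 X) ≫ colourMap₂ κ κ' f = colourMap₂ κ' κ f := by
  funext p q
  rw [comp_eq, sum_hObj, sum_hObj, Finset.sum_eq_single p.1.1]
  · have h : (𝟙 X : X ⟶ X) p.1.1 p.1.1 = (idCoeff : Recollement _ _ → k) :=
      Mat_.id_apply_self X p.1.1
    refine Eq.trans ?_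
      (swapKer_comp_colour t (κ p.1.1) (κ' p.1.1) (f p.1.1 q) p.1.2 p.2)
    refine Finset.sum_congr rfl fun d _ => Finset.sum_congr rfl fun d' _ => ?_
    rw [← h]
    rfl
  · intro j _ hj
    refine Finset.sum_eq_zero fun d _ => Finset.sum_eq_zero fun d' _ => ?_
    have h : (𝟙 X : X ⟶ X) p.1.1 j = (0 : Recollement _ _ → k) :=
      Mat_.id_apply_of_ne X p.1.1 j hj.symm
    have h' : swapKer ((𝟙 X : X ⟶ X) p.1.1 j) p.1.2 p.2 d d' = 0 := by
      rw [h]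
      exact ker_zero _ _ _
    exact (congrArg (fun Φ : (hObj (hObj X)).X p ⟶ (hObj (hObj X)).X ⟨⟨j, d⟩, d'⟩ =>
      Φ ≫ colourMap₂ κ κ' f ⟨⟨j, d⟩, d'⟩ q) h').trans Limits.zero_comp
  · intro h
    exact absurd (Finset.mem_univ _) h

theorem colourMap_one (f : X ⟶ Y) : colourMap (fun _ _ => 1) f = sMap f := by
  funext p q
  exact one_smul _ _

end ColourMat

section InductionKernel

variable {k : Type*} [Field k] [CharZero k] {U V W J : Type}
  [Fintype U] [Fintype V] [Fintype W] [Fintype J]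

/-- For a permutation `σ` of `J` and a morphism `Φ : [U] → [V]` of `Rep(S_{t-|J|})`, the morphism
`[U ⊔ J] → [V ⊔ J]` of `Rep(S_t)` that is induced from `Φ ⊗ σ`, i.e.
`e_{(f, g)} ↦ Φ(e_f) ⊗ e_{g ∘ σ⁻¹}`, where `Φ` acts on the complement of the image of `g : J → I`. -/
noncomputable def indKer (σ : Equiv.Perm J) (Φ : Recollement U V → k) :
    Recollement (U ⊕ J) (V ⊕ J) → k :=
  ker (fun E => ∀ w, Sum.inr (σ w) ∈ E (Sum.inr w)) .inl .inl Φ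

theorem indKer_glued {I : Type} [DecidableEq I] (σ : Equiv.Perm J) (Φ : Recollement U V → k)
    (f : U ⊕ J ↪ I) (g : V ⊕ J ↪ I) :
    indKer σ Φ (glued f g) =
      if ∀ w, f (Sum.inr w) = g (Sum.inr (σ w)) then
        Φ (glued (Function.Embedding.inl.trans f) (Function.Embedding.inl.trans g)) else 0 := by
  simp only [indKer, ker, mem_glued, restrict_glued]

theorem indKer_comp (t : k) (σ τ : Equiv.Perm J) (Φ : Recollement U V → k)
    (Ψ : Recollement V W → k) :
    comp t (indKer σ Φ) (indKer τ Ψ) =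
      indKer (τ * σ) (comp (t - Fintype.card J) Φ Ψ) := by
  refine ext_of_glued (Φ := fun t => comp t (indKer σ Φ) (indKer τ Ψ))
    (Ψ := fun t => indKer (τ * σ) (comp (t - Fintype.card J) Φ Ψ))
    (fun E => .comp_const _ _ E) (fun E => .ker _ _ _ (fun E => ?_) _) (Fintype.card J) ?_ t
  · exact .sum _ fun C => .sum _ fun D => .mul (.const _) (.structureCoeff _ _ _ _)
  · intro n hn f h
    have hn' : (n : k) = Fintype.card (Fin n) := by simp
    simp only [comp_glued hn', indKer_glued]
    split_ifs with hC
    · let I' := {x : Fin n // ∀ w, f (Sum.inr w) ≠ x}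
      have hI' : (n : k) - Fintype.card J = Fintype.card I' := by
        have h1 : Fintype.card I' + Fintype.card J = n := by
          have e : I' ⊕ J ≃ Fin n := Equiv.ofBijective
            (Sum.elim Subtype.val fun w => f (Sum.inr w)) <| by
              constructor
              · rintro (x | w) (x' | w') hh <;> simp only [Sum.elim_inl, Sum.elim_inr] at hh
                · rw [Subtype.ext hh]
                · exact absurd hh.symm (x.2 w')
                · exact absurd hh (x'.2 w)
                · have := f.injective hh
                  cases this; rfl
              · intro x
                by_cases hx : ∃ w, f (Sum.inr w) = x
                · obtain ⟨w, rfl⟩ := hx; exact ⟨Sum.inr w, rfl⟩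
                · push Not at hx; exact ⟨Sum.inl ⟨x, hx⟩, rfl⟩
          simpa using Fintype.card_congr e
        have h2 := congrArg (Nat.cast (R := k)) h1
        push_cast at h2
        rw [← h2]
        ring
      let f' : U ↪ I' := ⟨fun u => ⟨f (Sum.inl u), fun w hw => by
        have := f.injective hw; cases this⟩, fun u u' huu => by
        have := f.injective (congrArg Subtype.val huu); cases this; rfl⟩
      let h' : W ↪ I' := ⟨fun u => ⟨h (Sum.inl u), fun w hw => by
        rw [hC w] at hw
        have := h.injective hw; cases this⟩, fun u u' huu => by
        have := h.injective (congrArg Subtype.val huu); cases this; rfl⟩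
      let e : (V ↪ I') → (V ⊕ J ↪ Fin n) := fun g =>
        ⟨Sum.elim (fun v => (g v).1) (fun w => f (Sum.inr (σ⁻¹ w))), by
          rintro (x | w) (x' | w') hh <;> simp only [Sum.elim_inl, Sum.elim_inr] at hh
          · rw [g.injective (Subtype.ext hh)]
          · exact absurd hh.symm ((g x).2 _)
          · exact absurd hh ((g x').2 _)
          · have := f.injective hh
            simpa using this⟩
      have hfh : glued (Function.Embedding.inl.trans f) (Function.Embedding.inl.trans h) =
          glued f' h' := rec_ext fun u v => by
        rw [mem_glued, mem_glued]; exact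
          ⟨fun h => Subtype.ext h, fun h => congrArg Subtype.val h⟩
      have hfe : ∀ g, glued (Function.Embedding.inl.trans f) (Function.Embedding.inl.trans (e g))
          = glued f' g := fun g => rec_ext fun u v => by
        rw [mem_glued, mem_glued]; exact
          ⟨fun h => Subtype.ext h, fun h => congrArg Subtype.val h⟩
      have heh : ∀ g, glued (Function.Embedding.inl.trans (e g)) (Function.Embedding.inl.trans h)
          = glued g h' := fun g => rec_ext fun u v => by
        rw [mem_glued, mem_glued]; exact
          ⟨fun h => Subtype.ext h, fun h => congrArg Subtype.val h⟩
      have he : Function.Injective e := fun g g' hg => Function.Embedding.ext fun v =>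
        Subtype.ext (DFunLike.congr_fun hg (Sum.inl v))
      have her : ∀ (g : V ↪ I') w, e g (Sum.inr w) = f (Sum.inr (σ⁻¹ w)) := fun _ _ => rfl
      rw [hfh, comp_glued hI']
      refine (Fintype.sum_of_injective e he _ _ ?_ ?_).symm
      · intro g hg
        by_cases hc : ∀ w, f (Sum.inr w) = g (Sum.inr (σ w))
        · exfalso
          refine hg ⟨⟨fun v => ⟨g (Sum.inl v), fun w hw => ?_⟩, fun v v' hv => ?_⟩, ?_⟩
          · rw [hc w] at hw
            have := g.injective hw; cases this
          · have := g.injective (congrArg Subtype.val hv); cases this; rfl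
          · refine Function.Embedding.ext ?_
            rintro (v | w)
            · rfl
            · rw [her, hc]; simp
        · rw [if_neg hc, zero_mul]
      · intro g
        rw [hfe, heh, if_pos, if_pos]
        · intro w
          rw [her, hC]; simp
        · intro w
          rw [her]; simp
    · refine Finset.sum_eq_zero fun g _ => ?_
      by_cases h1 : ∀ w, f (Sum.inr w) = g (Sum.inr (σ w))
      · rw [if_neg (c := ∀ w, g (Sum.inr w) = _), mul_zero]
        exact fun h2 => hC fun w => (h1 w).trans (h2 (σ w))
      · rw [if_neg h1, zero_mul]

end InductionKernel

section Coloured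

open Idempotents

universe u v
variable {k : Type u} [Field k] [CharZero k] {t : k} {A : Type v} [CommRing A] [Algebra k A]

theorem hCounit_f (N : RepS t) : (hCounit N).f = sMap N.p := by
  change hMap N.p ≫ sMap (𝟙 N.X) = _
  rw [hMap_sMap, Category.comp_id]

theorem hDiag_f (N : RepS t) : (hDiag N).f = hMap N.p ≫ rMap (𝟙 N.X) := rfl

theorem hSwap_f (N : RepS t) : (hSwap N).f = hMap (hMap N.p) ≫ swapMap (𝟙 N.X) := rfl

/-- The object `N` of `Rep(S_t)` on which the `i`-th copy of `A` acts through the character that is the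
colour of the point `i`, for a colouring by characters that `N` preserves:
`y_a (e_i ⊗ e_f) = χ(i)(a) e_f`. -/
noncomputable def colouredRep (N : RepS t)
    (χ : ∀ i, Option (N.X.X i).carrier → (A →ₐ[k] k))
    (h : ∀ a, PreservesMat (fun i c => χ i c a) N.p (fun i c => χ i c a)) :
    RepWreath A t where
  obj := N
  y :=
    { toFun a :=
        { f := colourMap (fun i c => χ i c a) N.p
          comm := by
            change hMap N.p ≫ colourMap _ N.p ≫ N.p = _
            rw [colourMap_comp, N.idem, hMap_colourMap (h a), N.idem] }
      map_add' a b := Karoubi.hom_ext _ _ (by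
        funext p j
        refine Eq.trans ?_ (add_smul (χ p.1 p.2 a) (χ p.1 p.2 b) (sKer (N.p p.1 j) p.2))
        exact congrArg (fun c => c • sKer (N.p p.1 j) p.2) (map_add (χ p.1 p.2) a b))
      map_smul' c a := Karoubi.hom_ext _ _ (by
        funext p j
        refine Eq.trans ?_ (mul_smul c (χ p.1 p.2 a) (sKer (N.p p.1 j) p.2))
        exact congrArg (fun c => c • sKer (N.p p.1 j) p.2) (map_smul (χ p.1 p.2) c a)) }
  y_one := Karoubi.hom_ext _ _ (by
    rw [hCounit_f, ← colourMap_one]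
    exact congrArg (fun κ => colourMap κ N.p) (funext fun i => funext fun c => map_one (χ i c)))
  y_mul a b := Karoubi.hom_ext _ _ (by
    change (hMap N.p ≫ rMap (𝟙 N.X)) ≫ hMap (colourMap (fun i c => χ i c b) N.p) ≫
      colourMap (fun i c => χ i c a) N.p = colourMap (fun i c => χ i c (a * b)) N.p
    rw [hMap_colourMap_colourMap _ (h a), Category.assoc, rMap_colourMap₂]
    have h2 : (fun i c => χ i c a * χ i c b) = fun i c => χ i c (a * b) := by
      funext i c
      rw [map_mul]
    rw [h2, hMap_colourMap (h _), N.idem, N.idem])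
  y_comm a b := by
    rw [mul_comm b a, sub_self, map_zero, Limits.comp_zero, sub_eq_zero]
    refine Karoubi.hom_ext _ _ ?_
    change hMap (colourMap (fun i c => χ i c b) N.p) ≫ colourMap (fun i c => χ i c a) N.p =
      (hMap (hMap N.p) ≫ swapMap (𝟙 N.X)) ≫
        hMap (colourMap (fun i c => χ i c a) N.p) ≫ colourMap (fun i c => χ i c b) N.p
    rw [hMap_colourMap_colourMap _ (h b), Category.assoc, swapMap_colourMap₂,
      ← hMap_colourMap_colourMap _ (h a), ← Category.assoc, hMap_comp, hMap_colourMap (h b),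
      N.idem]

end Coloured

section Induction

open Idempotents

universe u v
variable {k : Type u} [Field k] [CharZero k] {s t : k} {G J β : Type} [Group G] [Fintype G]
  [Fintype J] [Fintype β] [DecidableEq β]

/-- The sum `⨁_{i, x} [U_i ⊔ J]`, if `X = ⨁_i [U_i]`; `x` runs over a basis `β`. This is induced from
`X ⊗ (k[G] ⊗ k^β)`. -/
def indMat (t : k) (X : Mat_ (Deligne₀ s)) (J β : Type) [Fintype J] [Fintype β] :
    Mat_ (Deligne₀ t) where
  ι := X.ι × β
  X p := ⟨(X.X p.1).carrier ⊕ J⟩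

/-- The action of `σ : G` on the sum `⨁_{i, x} [U_i ⊔ J]`, by `θ` on `J` and by `R` on `k^β`, followed by
the projection of `X` to `M`: `e_{(f, g)} ⊗ b_x ↦ p(e_f) ⊗ e_{g ∘ θ(σ)⁻¹} ⊗ R(σ) b_x`. -/
noncomputable def indTerm (t : k) (θ : G →* Equiv.Perm J) (R : G →* Matrix β β k)
    (M : RepS s) (σ : G) : indMat t M.X J β ⟶ indMat t M.X J β :=
  fun p q => R σ q.2 p.2 • indKer (θ σ) (M.p p.1 q.1)

theorem indKer_sum {U V ι : Type} [Fintype ι] (σ : Equiv.Perm J) (Φ : ι → Recollement U V → k) :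
    ∑ i, indKer σ (Φ i) = indKer σ (∑ i, Φ i) := ker_sum _ _ _ _

theorem indKer_comp' {U V W : Type} [Fintype U] [Fintype V] [Fintype W]
    (hs : s = t - Fintype.card J) (σ τ : Equiv.Perm J) (Φ : Recollement U V → k)
    (Ψ : Recollement V W → k) :
    comp t (indKer σ Φ) (indKer τ Ψ) = indKer (τ * σ) (comp s Φ Ψ) := by
  rw [hs, indKer_comp]

theorem indTerm_comp (hs : s = t - Fintype.card J) (θ : G →* Equiv.Perm J)
    (R : G →* Matrix β β k) (M : RepS s) (σ τ : G) :
    indTerm t θ R M σ ≫ indTerm t θ R M τ = indTerm t θ R M (τ * σ) := by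
  funext p q
  rw [comp_eq]
  refine (Fintype.sum_prod_type (f := fun r : M.X.ι × β =>
    comp t (indTerm t θ R M σ p r) (indTerm t θ R M τ r q))).trans ?_
  have h1 : ∀ (i : M.X.ι) (y : β),
      comp t (indTerm t θ R M σ p (i, y)) (indTerm t θ R M τ (i, y) q) =
        (R τ q.2 y * R σ y p.2) •
          indKer (θ (τ * σ)) (comp s (M.p p.1 i) (M.p i q.1)) := by
    intro i y
    refine (smul_comp t _ _ _).trans ?_
    rw [mul_comm, mul_smul, map_mul, ← indKer_comp' hs]
    exact congrArg (fun Φ => R σ y p.2 • Φ) (comp_smul t _ _ _)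
  refine (Finset.sum_congr rfl fun i _ => Finset.sum_congr rfl fun y _ => h1 i y).trans ?_
  have h2 : ∑ i, comp s (M.p p.1 i) (M.p i q.1) = M.p p.1 q.1 :=
    congrFun (congrFun M.idem p.1) q.1
  change _ = R (τ * σ) q.2 p.2 • indKer (θ (τ * σ)) (M.p p.1 q.1)
  rw [← h2, ← indKer_sum, Finset.smul_sum]
  refine Finset.sum_congr rfl fun i _ => ?_
  rw [map_mul R, Matrix.mul_apply]
  exact (Finset.sum_smul (s := Finset.univ) (f := fun y => R τ q.2 y * R σ y p.2)
    (x := indKer (θ (τ * σ)) (comp s (M.p p.1 i) (M.p i q.1)))).symm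

/-- The projection to the `G`-invariants in `⨁_{i, x} [U_i ⊔ J]` and to `M` in `X`. -/
noncomputable def indIdem (t : k) (θ : G →* Equiv.Perm J) (R : G →* Matrix β β k)
    (M : RepS s) : indMat t M.X J β ⟶ indMat t M.X J β :=
  (Fintype.card G : k)⁻¹ • ∑ σ, indTerm t θ R M σ

theorem indIdem_comp (hs : s = t - Fintype.card J) (θ : G →* Equiv.Perm J)
    (R : G →* Matrix β β k) (M : RepS s) :
    indIdem t θ R M ≫ indIdem t θ R M = indIdem t θ R M := by
  have hG : (Fintype.card G : k) ≠ 0 := Nat.cast_ne_zero.2 Fintype.card_ne_zero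
  have h : ∀ σ : G, ∑ τ, indTerm t θ R M (τ * σ) = ∑ τ, indTerm t θ R M τ := fun σ =>
    Fintype.sum_equiv (Equiv.mulRight σ) _ _ fun _ => rfl
  simp only [indIdem, Linear.smul_comp, Linear.comp_smul, Preadditive.sum_comp,
    Preadditive.comp_sum, indTerm_comp hs]
  rw [← Finset.smul_sum, Finset.sum_comm]
  simp only [h, Finset.sum_const, Finset.card_univ]
  rw [← Nat.cast_smul_eq_nsmul k, smul_smul (Fintype.card G : k)⁻¹ (Fintype.card G : k),
    inv_mul_cancel₀ hG, one_smul]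

/-- The points of `J` have the colours `χ`, all the others the colour `χ₁`. -/
def blockColour {U X : Type*} (χ₁ : X) (χ : J → X) : Option (U ⊕ J) → X
  | some (.inr w) => χ w
  | _ => χ₁

theorem indKer_preserves {X : Type*} {U V : Type} (χ₁ : X) (χ : J → X) (ev : X → k)
    {σ : Equiv.Perm J} (h : ∀ w, χ (σ w) = χ w) (Φ : Recollement U V → k) :
    Preserves (fun c => ev (blockColour χ₁ χ c)) (indKer σ Φ)
      (fun c => ev (blockColour χ₁ χ c)) := by
  intro E hE c d hcd
  have hP : ∀ w, Sum.inr (σ w) ∈ E (Sum.inr w) := by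
    by_contra hP
    exact hE (if_neg hP)
  have hsymm : ∀ w, E.symm (Sum.inr (σ w)) = some (Sum.inr w) := fun w =>
    (PEquiv.mem_iff_mem E).2 (hP w)
  refine congrArg ev ?_
  rcases c with _ | u | w
  · rcases d with _ | v | w'
    · rfl
    · rfl
    · obtain ⟨w, rfl⟩ := σ.surjective w'
      have : E.symm (Sum.inr (σ w)) = none := hcd
      rw [hsymm] at this
      cases this
  · rcases d with _ | v | w'
    · rfl
    · rfl
    · obtain ⟨w, rfl⟩ := σ.surjective w'
      have h1 : Sum.inl u ∈ E.symm (Sum.inr (σ w)) := (PEquiv.mem_iff_mem E).2 hcd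
      rw [hsymm] at h1
      cases h1
  · rcases d with _ | v | w'
    · have h1 : E (Sum.inr w) = none := hcd
      have h2 := hP w
      rw [h1] at h2
      cases h2
    · have h1 : Sum.inl v ∈ E (Sum.inr w) := hcd
      have h2 := Option.mem_unique h1 (hP w)
      cases h2
    · have h1 : Sum.inr w' ∈ E (Sum.inr w) := hcd
      have h2 := Option.mem_unique h1 (hP w)
      cases h2
      exact (h w).symm

/-- The same colouring of all the summands `[U_i ⊔ J]`. -/
def indColour {X : Type*} (χ₁ : X) (χ : J → X) {Y : Mat_ (Deligne₀ s)}
    (i : (indMat t Y J β).ι) : Option ((indMat t Y J β).X i).carrier → X :=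
  blockColour (U := (Y.X i.1).carrier) χ₁ χ

theorem indIdem_preserves {X : Type*} (χ₁ : X) (χ : J → X) (ev : X → k)
    {θ : G →* Equiv.Perm J} (h : ∀ σ w, χ (θ σ w) = χ w) (R : G →* Matrix β β k) (M : RepS s) :
    PreservesMat (X := indMat t M.X J β) (fun i c => ev (indColour χ₁ χ i c))
      (indIdem t θ R M) (fun i c => ev (indColour χ₁ χ i c)) := by
  intro p q E hE c d hcd
  by_contra hne
  apply hE
  have h1 : ∀ σ, (indTerm t θ R M σ p q : Recollement _ _ → k) E = 0 := by
    intro σ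
    by_contra h0
    refine hne (indKer_preserves χ₁ χ ev (h σ) (M.p p.1 q.1) E (fun h2 => h0 ?_) c d hcd)
    change R σ q.2 p.2 * indKer (θ σ) (M.p p.1 q.1) E = 0
    rw [h2, mul_zero]
  have h2 : (indIdem t θ R M p q : Recollement _ _ → k) E =
      (Fintype.card G : k)⁻¹ * ∑ σ, (indTerm t θ R M σ p q : Recollement _ _ → k) E := by
    refine congrArg (fun c => (Fintype.card G : k)⁻¹ * c) ?_
    classical
    induction (Finset.univ : Finset G) using Finset.induction_on with
    | empty => rfl
    | insert a S ha ih =>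
      rw [Finset.sum_insert ha, Finset.sum_insert ha, ← ih]
      rfl
  rw [h2, Finset.sum_eq_zero fun σ _ => h1 σ, mul_zero]

end Induction

/-- Two members of a family of categories are isomorphic: their indices are equal, and the objects are
isomorphic. -/
def IsoOver {ι : Type*} (F : ι → Type*) [∀ i, Category (F i)] {i j : ι} (X : F i) (Y : F j) :
    Prop :=
  ∃ h : i = j, Nonempty ((h ▸ X : F j) ≅ Y)

section InducedObject

open Idempotents

universe u v
variable {k : Type u} [Field k] [CharZero k]

/-- The tensor product of the representations `M j`, of the product of the symmetric groups, in terms of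
bases of the `M j`. -/
noncomputable def tensorMatrix {l : ℕ} {n : Fin l → ℕ}
    (M : ∀ j, FDRep k (Equiv.Perm (Fin (n j)))) :
    (∀ j, Equiv.Perm (Fin (n j))) →*
      Matrix (∀ j, Fin (Module.finrank k (M j))) (∀ j, Fin (Module.finrank k (M j))) k where
  toFun σ := Matrix.of fun x y =>
    ∏ j, LinearMap.toMatrix (Module.finBasis k (M j)) (Module.finBasis k (M j))
      ((M j).ρ (σ j)) (x j) (y j)
  map_one' := by
    ext x y
    simp only [Pi.one_apply, map_one, LinearMap.toMatrix_one, Matrix.of_apply, Matrix.one_apply]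
    by_cases h : x = y
    · subst h; simp
    · rw [if_neg h]
      obtain ⟨j, hj⟩ := Function.ne_iff.1 h
      exact Finset.prod_eq_zero (Finset.mem_univ j) (if_neg hj)
  map_mul' σ τ := by
    ext x y
    simp only [Pi.mul_apply, map_mul, LinearMap.toMatrix_mul, Matrix.of_apply, Matrix.mul_apply,
      Finset.prod_univ_sum, ← Finset.prod_mul_distrib, Fintype.piFinset_univ]

/-- The data of a parabolic induction: besides `χ₁` and `M₁`, which belong to the first block, of rank
`t - N`, there are `l` blocks of integral sizes `n j`, with characters `χ j` and representations `M j`.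
Here `N = ∑ j, n j`. -/
structure InductionDatum (A : Type v) [CommRing A] [Algebra k A] (t : k) where
  l : ℕ
  n : Fin l → ℕ
  χ₁ : A →ₐ[k] k
  M₁ : RepS (t - ((∑ j, n j : ℕ) : k))
  χ : Fin l → (A →ₐ[k] k)
  M : ∀ j, FDRep k (Equiv.Perm (Fin (n j)))

namespace InductionDatum

variable {A : Type v} [CommRing A] [Algebra k A] {t : k}

/-- The union of the blocks of integral sizes. -/
abbrev J (d : InductionDatum A t) : Type := Σ j, Fin (d.n j)

theorem card_J (d : InductionDatum A t) :
    t - ((∑ j, d.n j : ℕ) : k) = t - (Fintype.card d.J : k) := by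
  simp

/-- The object of `Rep(S_t)` that is induced from the object `M₁ ⊗ ⨂ M j` for the subgroup
`S_{t-N} × ∏ S_{n j}`, i.e. the interpolation of
`k[Inj(J, I)] ⊗ M₁ ⊗ ⨂ M j` modulo the diagonal action of `∏ S_{n j}`, where, for an injection `J → I`,
`M₁` is a representation of the permutations of the complement of its image. -/
noncomputable def indS (d : InductionDatum A t) : RepS t where
  X := indMat t d.M₁.X d.J (∀ j, Fin (Module.finrank k (d.M j)))
  p := indIdem t (Equiv.Perm.sigmaCongrRightHom fun j => Fin (d.n j)) (tensorMatrix d.M) d.M₁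
  idem := indIdem_comp d.card_J _ _ _

/-- The interpolated parabolic induction `ind(V_{χ₁}(M₁), V_{χ 0}(M 0), …, V_{χ (l-1)}(M (l-1)))`.
In `V_χ(M)`, each of the copies of `A` acts on `M` through `χ`. So in the induced object the copy of `A`
with the number `i` acts by `χ j` if `i` is in the image of the block `j` under the injection
`J → I`, and by `χ₁` if `i` is not in the image of `J`. -/
noncomputable def ind (d : InductionDatum A t) : RepWreath A t :=
  colouredRep d.indS (fun i => indColour d.χ₁ (fun w : d.J => d.χ w.1) i) fun a =>
    indIdem_preserves d.χ₁ (fun w : d.J => d.χ w.1) (fun χ => χ a) (fun _ _ => rfl) _ _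

/-- The `M`'s are simple, the blocks `n j` are nonempty and in decreasing order of their sizes, and to
distinct blocks belong distinct characters. -/
structure Admissible (d : InductionDatum A t) : Prop where
  simple_M₁ : Simple d.M₁
  simple_M : ∀ j, Simple (d.M j)
  pos : ∀ j, 0 < d.n j
  antitone : Antitone d.n
  injective : Function.Injective d.χ
  ne : ∀ j, d.χ j ≠ d.χ₁

/-- The data agree up to isomorphisms of the `M`'s and the order of the blocks of integral sizes. -/
structure Equivalent (d d' : InductionDatum A t) : Prop where
  χ₁_eq : d.χ₁ = d'.χ₁
  iso₁ : IsoOver (RepS (k := k)) d.M₁ d'.M₁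
  exists_perm : ∃ π : Fin d.l ≃ Fin d'.l, ∀ j, d.χ j = d'.χ (π j) ∧
    IsoOver (fun m => FDRep k (Equiv.Perm (Fin m))) (d.M j) (d'.M (π j))

end InductionDatum

end InducedObject

end DeligneWreath

/-!
The proof passes from the transcendental parameter `t` to natural numbers. An embedding of `k` into its
ultrapower along a nonprincipal ultrafilter can be chosen to send `t` to the class of the sequence
`n ↦ n` (`exists_specialisation`). So every morphism of the additive envelope of Deligne's category has a
matrix at almost every `n`, namely the matrix of an `S_n`-linear map between sums of
spaces of functions on injections; the matrices are compatible with the composition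
(`real_comp`), and they determine the morphism (`eq_of_real`). Likewise a morphism `𝔥 ⊗ X → Y` has one
matrix for each of the points `1, …, n` (`slice`), and the axioms of `Rep(S_t ⋉ A^{⊗t})` become the
statement that `n` commuting copies of `A` act.

At `n`, the trace of `u` times the transpose of its entrywise inverse counts the nonzero entries of `u`. Hence
the endomorphism rings are semisimple, and every morphism `f` satisfies `f g f = f` for some `g`
(`exists_regular`). Therefore the simple objects of `Rep(S_t)` are the indecomposable ones, those of
`Rep(S_t ⋉ A^{⊗t})` are the objects without nontrivial stable idempotents
(`RepWreath.simple_iff`), and a nonzero morphism between simple objects is an isomorphism.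

If the points act through characters, a morphism commutes with the action if and only if every
recollement that occurs in it matches points of equal colours (`comm_iff_preservesMat`), and an object is simple if
its only colour-preserving endomorphisms are scalars (`simple_colouredRep`). For the induced objects, such
recollements are disjoint unions of a recollement in rank `t - N` with a bijection `J ≃ J'` that respects the
blocks. This describes the morphisms between induced objects by intertwiners between the
inducing ones (`exists_intertwiner`, `exists_hom_of_intertwiner`). With Schur's lemma, this yields both
the simplicity of the induced objects (`InductionDatum.Admissible.simple`) and the criterion for
isomorphisms (`InductionDatum.Admissible.nonempty_iso_iff`).

Conversely, let `X` be simple. The algebra `A` acts through a finite-dimensional quotient, which is reduced,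
since the image of a nilpotent element would be a subobject (`RepWreath.y_eq_zero_of_sq`). So it
acts through finitely many characters (`RepWreath.exists_spectral`). Decomposing a nonzero morphism `[V] → X`
into weight vectors, and adding points to `V` as long as there is a choice, one comes to a nonzero morphism
`[V] → X` for which each point of `V` acts through a character and all other points through one
character `χ₁` (`RepWreath.exists_total`). The process ends, because a morphism out of `[V]` with
many points of one colour and many of others is killed at `n` by a product of antisymmetrisers
of disjoint transpositions (`weight_bound`). Now `V = U ⊔ J`, where `U` consists of the points of colour `χ₁`. A
suitable primitive idempotent of `[U]` in `Rep(S_{t-N})`, and suitable matrix coefficients of simple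
representations of the symmetric groups of the blocks, turn the morphism into a nonzero morphism from an induced
object to `X`. Both are simple, so it is an isomorphism (`RepWreath.exists_iso_ind`).
-/

namespace DeligneWreath

open CategoryTheory

set_option linter.unusedSectionVars false

/-! ### Specialisation of the parameter to natural numbers -/

section Ultrapower

open Filter Polynomial

universe u
variable {k : Type u} [Field k]

/-- The ultrapower of `k` along a nonprincipal ultrafilter on `ℕ`. -/
abbrev Ultrapower (k : Type u) : Type u := Germ (hyperfilter ℕ : Filter ℕ) k

/-- The diagonal embedding of a field into its ultrapower. -/
noncomputable def diagonal (k : Type u) [Field k] : k →+* Ultrapower k where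
  toFun c := ((fun _ => c : ℕ → k) : Ultrapower k)
  map_one' := rfl
  map_mul' _ _ := rfl
  map_zero' := rfl
  map_add' _ _ := rfl

theorem eval_germ (p : k[X]) (a : ℕ → k) :
    (p.map (diagonal k)).eval ((a : ℕ → k) : Ultrapower k) =
      ((fun n => p.eval (a n) : ℕ → k) : Ultrapower k) := by
  induction p using Polynomial.induction_on' with
  | add p q hp hq => simp only [Polynomial.map_add, eval_add, hp, hq]; rfl
  | monomial m c => simp only [map_monomial, eval_monomial]; rfl

noncomputable instance [IsAlgClosed k] : IsAlgClosed (Ultrapower k) := by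
  refine IsAlgClosed.of_exists_root _ fun p hp hirr => ?_
  have hsur : ∀ c : Ultrapower k, ∃ a : ℕ → k, (a : Ultrapower k) = c := fun c =>
    Germ.inductionOn c fun a => ⟨a, rfl⟩
  choose rep hrep using hsur
  let q : ℕ → k[X] := fun n => X ^ p.natDegree +
    ∑ i ∈ Finset.range p.natDegree, C (rep (p.coeff i) n) * X ^ i
  have hdeg : 0 < p.natDegree := hirr.natDegree_pos
  have hlow : ∀ n, (∑ i ∈ Finset.range p.natDegree, C (rep (p.coeff i) n) * X ^ i : k[X]).degree <
      ((p.natDegree : ℕ) : WithBot ℕ) := fun n => by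
    refine (degree_sum_le _ _).trans_lt ((Finset.sup_lt_iff (WithBot.bot_lt_coe _)).2 ?_)
    intro i hi
    exact (degree_C_mul_X_pow_le _ _).trans_lt
      (WithBot.coe_lt_coe.2 (Nat.cast_lt.2 (Finset.mem_range.1 hi)))
  have hroot : ∀ n, ∃ z, (q n).eval z = 0 := fun n => by
    refine IsAlgClosed.exists_root _ ?_
    rw [show q n = X ^ p.natDegree + _ from rfl, degree_add_eq_left_of_degree_lt
      (by rw [degree_X_pow]; exact hlow n), degree_X_pow]
    exact_mod_cast hdeg.ne'
  choose z hz using hroot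
  refine ⟨((z : ℕ → k) : Ultrapower k), ?_⟩
  have h0 : ((fun n => (q n).eval (z n) : ℕ → k) : Ultrapower k) = 0 := by
    simp only [hz]; rfl
  rw [hp.as_sum, ← h0]
  simp only [q, eval_add, eval_pow, eval_X, eval_finsetSum, eval_mul, eval_C]
  have hs : ∀ s : Finset ℕ, ((fun n => ∑ i ∈ s, rep (p.coeff i) n * z n ^ i : ℕ → k) :
      Ultrapower k) = ∑ i ∈ s, p.coeff i * (z : Ultrapower k) ^ i := by
    intro s
    classical
    induction s using Finset.induction_on with
    | empty => rfl
    | insert a s ha ih =>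
      simp only [Finset.sum_insert ha]
      rw [← ih]
      conv_rhs => rw [← hrep (p.coeff a)]
      rfl
  rw [← hs]
  rfl

variable [CharZero k]

instance : CharZero (Ultrapower k) := charZero_of_injective_ringHom (diagonal k).injective

/-- The nonstandard number `[n]`. -/
noncomputable def omega (k : Type u) [Field k] : Ultrapower k := ((fun n => (n : k) : ℕ → k) : Ultrapower k)

theorem eventually_hyperfilter_of_ge {p : ℕ → Prop} (m : ℕ) (h : ∀ n, m ≤ n → p n) :
    ∀ᶠ n in (hyperfilter ℕ : Filter ℕ), p n :=
  Nat.hyperfilter_le_atTop (eventually_atTop.2 ⟨m, h⟩)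

/-- The nonstandard number `[n]` is transcendental over `k`: a polynomial has finitely many roots. -/
theorem omega_not_root {p : k[X]} (hp : p ≠ 0) :
    (p.map (diagonal k)).eval (omega k) ≠ 0 := by
  classical
  rw [omega, eval_germ]
  intro h
  have h1 : ∀ᶠ n : ℕ in (hyperfilter ℕ : Filter ℕ), p.eval (n : k) = 0 := Germ.coe_eq.1 h
  have h2 : {n : ℕ | p.eval (n : k) = 0}.Finite :=
    Set.Finite.preimage (f := fun n : ℕ => (n : k)) Nat.cast_injective.injOn
      (s := {x : k | p.eval x = 0}) ((p.roots.toFinset.finite_toSet).subset fun x (hx : p.eval x = 0) => by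
        simpa [hp] using hx)
  exact (Filter.hyperfilter ℕ).empty_notMem (by
    have := Filter.inter_mem h1 (Filter.compl_mem_hyperfilter_of_finite h2)
    simp at this)

/-- Embeddings into algebraically closed fields extend to algebraic extensions, here from a domain `R` over
whose fraction field `K` is algebraic. -/
theorem exists_extension {R K M : Type*} [CommRing R] [IsDomain R] [Field K] [Algebra R K]
    [FaithfulSMul R K] [Algebra.IsAlgebraic R K] [Field M] [IsAlgClosed M] (φ : R →+* M)
    (hφ : Function.Injective φ) : ∃ ψ : K →+* M, ∀ r, ψ (algebraMap R K r) = φ r := by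
  let _ := φ.toAlgebra
  have : FaithfulSMul R M := (faithfulSMul_iff_algebraMap_injective _ _).2 hφ
  exact ⟨(IsAlgClosed.lift (R := R) (S := K) (M := M) : K →ₐ[R] M), fun r =>
    (IsAlgClosed.lift (R := R) (S := K) (M := M)).commutes r⟩

/-- If `t` is transcendental, then there is an embedding of `k` into its ultrapower that sends `t` to
`[n]`: the nonstandard number `[n]` is transcendental over `k`, so a transcendence basis of `k` that
contains `t` is sent to an algebraically independent family by fixing its other members. -/
theorem exists_specialisation [IsAlgClosed k] {t : k} (ht : Transcendental ℚ t) :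
    ∃ ψ : k →+* Ultrapower k, ψ t = omega k := by
  classical
  have h1 : AlgebraicIndepOn ℚ id ({t} : Set k) :=
    (algebraicIndependent_singleton_iff (⟨t, rfl⟩ : ({t} : Set k))).2 ht
  obtain ⟨T, hT, hb⟩ := exists_isTranscendenceBasis_superset h1
  let t' : T := ⟨t, hT rfl⟩
  let e := Equiv.optionSubtypeNe t'
  let δ : k →ₐ[ℚ] Ultrapower k := (diagonal k).toRatAlgHom
  let y : T → Ultrapower k := fun s => if s = t' then omega k else δ s
  have hy : AlgebraicIndependent ℚ y := by
    rw [← algebraicIndependent_equiv e]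
    have : y ∘ e = fun o => o.elim (omega k) fun s : {s : T // s ≠ t'} => δ s.1 := by
      funext o
      rcases o with _ | s
      · simp [y, e]
      · simp [y, e, s.2]
    rw [this, AlgebraicIndependent.option_iff]
    refine ⟨(hb.1.comp (Subtype.val : {s : T // s ≠ t'} → T) Subtype.val_injective).map'
      (f := δ) δ.toRingHom.injective, ?_⟩
    set S := Algebra.adjoin ℚ (Set.range fun s : {s : T // s ≠ t'} => δ s.1)
    have hS : S ≤ δ.range := Algebra.adjoin_le (by
      rintro _ ⟨s, rfl⟩
      exact ⟨_, rfl⟩)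
    refine transcendental_iff.2 fun p hp => ?_
    by_contra hp0
    have hinj : Function.Injective δ := δ.toRingHom.injective
    let g : S →+* k := ((AlgEquiv.ofInjective δ hinj).symm : δ.range →+* k).comp
      (Subalgebra.inclusion hS : S →+* δ.range)
    have hg : (diagonal k).comp g = algebraMap S (Ultrapower k) := by
      ext x
      exact congrArg Subtype.val
        ((AlgEquiv.ofInjective δ hinj).apply_symm_apply (Subalgebra.inclusion hS x))
    refine omega_not_root (p := p.map g) ?_ ?_
    · rwa [Ne, Polynomial.map_eq_zero_iff]
      exact RingHom.injective_iff_ker_eq_bot _ |>.2 (by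
        refine (RingHom.injective_iff_ker_eq_bot g).1 fun a b hab => Subtype.ext ?_
        have := congrArg (diagonal k) hab
        rwa [← RingHom.comp_apply, ← RingHom.comp_apply, hg] at this)
    · rw [Polynomial.map_map, hg, eval_map_algebraMap]
      exact hp
  let R := Algebra.adjoin ℚ (Set.range (Subtype.val : T → k))
  have : Algebra.IsAlgebraic R k := hb.isAlgebraic
  let φ : R →+* Ultrapower k := ((MvPolynomial.aeval y).comp
    (hb.1.aevalEquiv.symm : R →ₐ[ℚ] MvPolynomial T ℚ) : R →ₐ[ℚ] Ultrapower k)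
  have hφ : Function.Injective φ :=
    Function.Injective.comp (g := MvPolynomial.aeval y) hy hb.1.aevalEquiv.symm.injective
  obtain ⟨ψ, hψ⟩ := exists_extension (K := k) φ hφ
  have hm : t ∈ R := Algebra.subset_adjoin ⟨t', rfl⟩
  refine ⟨ψ, (hψ ⟨t, hm⟩).trans ?_⟩
  have h2 : hb.1.aevalEquiv.symm ⟨t, hm⟩ = MvPolynomial.X t' := by
    rw [AlgEquiv.symm_apply_eq]
    refine Subtype.ext ?_
    rw [hb.1.aevalEquiv_apply_coe]
    simp [t']
  change (MvPolynomial.aeval y) (hb.1.aevalEquiv.symm ⟨t, hm⟩) = _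
  rw [h2]
  simp [y]

end Ultrapower

section Spec

open Filter

universe u
variable {k : Type u} [Field k] [IsAlgClosed k] [CharZero k] {t : k} (ht : Transcendental ℚ t)

open Classical in
/-- The values at the natural numbers of the element `c` of `k`, regarded as a function of `t`. They are
well defined up to equality for almost all numbers. The values of `0` and `1` are `0` and `1`
everywhere. -/
noncomputable def spec (c : k) (n : ℕ) : k :=
  if c = 0 then 0 else if c = 1 then 1 else
    (Quotient.exists_rep ((exists_specialisation ht).choose c)).choose n

/-- `p` holds at almost all natural numbers. -/
abbrev Almost (p : ℕ → Prop) : Prop := ∀ᶠ n in (hyperfilter ℕ : Filter ℕ), p n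

theorem spec_zero (n : ℕ) : spec ht 0 n = 0 := if_pos rfl

theorem spec_one (n : ℕ) : spec ht 1 n = 1 := by simp [spec]

theorem spec_coe (c : k) :
    ((spec ht c : ℕ → k) : Ultrapower k) = (exists_specialisation ht).choose c := by
  by_cases h0 : c = 0
  · subst h0
    rw [map_zero]
    exact congrArg _ (funext fun n => spec_zero ht n)
  · by_cases h1 : c = 1
    · subst h1
      rw [map_one]
      exact congrArg _ (funext fun n => spec_one ht n)
    · rw [← (Quotient.exists_rep ((exists_specialisation ht).choose c)).choose_spec]
      exact congrArg _ (funext fun n => by rw [spec, if_neg h0, if_neg h1])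

theorem spec_add (a b : k) : Almost fun n => spec ht (a + b) n = spec ht a n + spec ht b n :=
  Germ.coe_eq.1 ((spec_coe ht _).trans ((map_add _ a b).trans
    (congrArg₂ (· + ·) (spec_coe ht a).symm (spec_coe ht b).symm)))

theorem spec_mul (a b : k) : Almost fun n => spec ht (a * b) n = spec ht a n * spec ht b n :=
  Germ.coe_eq.1 ((spec_coe ht _).trans ((map_mul _ a b).trans
    (congrArg₂ (· * ·) (spec_coe ht a).symm (spec_coe ht b).symm)))

theorem spec_self : Almost fun n => spec ht t n = n :=
  Germ.coe_eq.1 ((spec_coe ht _).trans (exists_specialisation ht).choose_spec)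

theorem eq_of_spec {a b : k} (h : Almost fun n => spec ht a n = spec ht b n) : a = b :=
  (exists_specialisation ht).choose.injective
    ((spec_coe ht a).symm.trans ((Germ.coe_eq.2 h).trans (spec_coe ht b)))

theorem spec_ne {a b : k} (h : a ≠ b) : Almost fun n => spec ht a n ≠ spec ht b n :=
  Ultrafilter.eventually_not.2 fun h2 => h (eq_of_spec ht h2)

theorem spec_sum {ι : Type*} (s : Finset ι) (a : ι → k) :
    Almost fun n => spec ht (∑ i ∈ s, a i) n = ∑ i ∈ s, spec ht (a i) n := by
  classical
  induction s using Finset.induction_on with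
  | empty => exact Eventually.of_forall fun n => by simp [spec_zero]
  | insert i s hi ih =>
    filter_upwards [ih, spec_add ht (a i) (∑ i ∈ s, a i)] with n h1 h2
    rw [Finset.sum_insert hi, h2, h1, Finset.sum_insert hi]

theorem spec_natCast (m : ℕ) : Almost fun n => spec ht (m : k) n = m := by
  induction m with
  | zero => exact Eventually.of_forall fun n => by simp [spec_zero]
  | succ m ih =>
    filter_upwards [ih, spec_add ht (m : k) 1] with n h1 h2
    rw [Nat.cast_succ, h2, h1, spec_one]

theorem spec_neg (a : k) : Almost fun n => spec ht (-a) n = -spec ht a n := by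
  filter_upwards [spec_add ht a (-a)] with n h
  rw [add_neg_cancel, spec_zero] at h
  exact (neg_eq_of_add_eq_zero_right h.symm).symm

theorem spec_descPochhammer (c m : ℕ) : Almost fun n =>
    spec ht ((descPochhammer k m).eval (t - c)) n = (descPochhammer k m).eval ((n : k) - c) := by
  induction m with
  | zero => exact Eventually.of_forall fun n => by simp [spec_one]
  | succ m ih =>
    filter_upwards [ih, spec_self ht, spec_natCast ht (c + m), spec_neg ht ((c + m : ℕ) : k),
      spec_add ht t (-((c + m : ℕ) : k)),
      spec_mul ht ((descPochhammer k m).eval (t - c)) (t + -((c + m : ℕ) : k))]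
      with n h1 h2 h3 h4 h5 h6
    have h7 : t - c - m = t + -((c + m : ℕ) : k) := by push_cast; ring
    rw [descPochhammer_succ_eval, descPochhammer_succ_eval, h7, h6, h5, h4, h3, h2, h1]
    push_cast
    ring

variable {U V W : Type} [Fintype U] [Fintype V] [Fintype W]

/-- The structure constants of the category at `t` become those at `n`. -/
theorem spec_structureCoeff (C : Recollement U V) (D : Recollement V W) (E : Recollement U W) :
    Almost fun n => spec ht (structureCoeff t C D E) n = structureCoeff (n : k) C D E := by
  unfold structureCoeff
  split_ifs
  · exact spec_descPochhammer ht _ _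
  · exact Eventually.of_forall fun n => spec_zero ht n

theorem spec_comp (Φ : Recollement U V → k) (Ψ : Recollement V W → k) : Almost fun n => ∀ E,
    spec ht (comp t Φ Ψ E) n =
      comp (n : k) (fun C => spec ht (Φ C) n) (fun D => spec ht (Ψ D) n) E := by
  refine eventually_all.2 fun E => ?_
  unfold comp
  have h1 : Almost fun n => ∀ C D, spec ht (Φ C * Ψ D * structureCoeff t C D E) n =
      spec ht (Φ C) n * spec ht (Ψ D) n * structureCoeff (n : k) C D E := by
    refine eventually_all.2 fun C => eventually_all.2 fun D => ?_
    filter_upwards [spec_mul ht (Φ C) (Ψ D), spec_mul ht (Φ C * Ψ D) (structureCoeff t C D E),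
      spec_structureCoeff ht C D E] with n h1 h2 h3
    rw [h2, h1, h3]
  have h2 : Almost fun n => ∀ C, spec ht (∑ D, Φ C * Ψ D * structureCoeff t C D E) n =
      ∑ D, spec ht (Φ C * Ψ D * structureCoeff t C D E) n :=
    eventually_all.2 fun C => spec_sum ht _ _
  filter_upwards [h1, h2, spec_sum ht Finset.univ fun C =>
    ∑ D, Φ C * Ψ D * structureCoeff t C D E] with n h1 h2 h3
  rw [h3]
  exact Finset.sum_congr rfl fun C _ => (h2 C).trans (Finset.sum_congr rfl fun D _ => h1 C D)

end Spec

section Realisation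

open Filter

universe u
variable {k : Type u} [Field k] [IsAlgClosed k] [CharZero k] {t : k}

/-- The basis of the representation of `S_n` that belongs to the object `X = ⨁ [U_i]`: the injections
`U_i → {1, …, n}`. -/
abbrev Pts (n : ℕ) (X : Mat_ (Deligne₀ t)) : Type := Σ i : X.ι, ((X.X i).carrier ↪ Fin n)

noncomputable instance (n : ℕ) (X : Mat_ (Deligne₀ t)) : DecidableEq (Pts n X) := Classical.decEq _

variable (ht : Transcendental ℚ t) {X Y Z : Mat_ (Deligne₀ t)}

/-- The matrix over `k` that belongs to a morphism at the natural number `n`. -/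
noncomputable def real (n : ℕ) (f : X ⟶ Y) : Matrix (Pts n X) (Pts n Y) k :=
  fun p q => spec ht ((f p.1 q.1 : Recollement _ _ → k) (glued p.2 q.2)) n

theorem glued_glued {U V I I' : Type} (f : U ↪ I) (g : V ↪ I) (e : I ↪ I') :
    glued (f.trans e) (g.trans e) = glued f g := rec_ext fun u v => by
  rw [mem_glued, mem_glued]
  exact e.injective.eq_iff

/-- Every recollement occurs among the injections into `{1, …, n}`, if `n` is large. -/
theorem exists_glued_fin {U V : Type} [Fintype U] [Fintype V] (E : Recollement U V) {n : ℕ}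
    (hn : Fintype.card (U ⊕ V) ≤ n) : ∃ (f : U ↪ Fin n) (g : V ↪ Fin n), glued f g = E := by
  obtain ⟨f, g, rfl⟩ := exists_glued E
  have e : (U ⊕ V) ↪ Fin n := (Function.Embedding.nonempty_of_card_le (by simpa using hn)).some
  exact ⟨f.trans e, g.trans e, glued_glued f g e⟩

theorem real_comp (f : X ⟶ Y) (g : Y ⟶ Z) :
    Almost fun n => real ht n (f ≫ g) = real ht n f * real ht n g := by
  have h1 : Almost fun n => ∀ i j l E, spec ht (comp t (f i l) (g l j) E) n =
      comp (n : k) (fun C => spec ht ((f i l : Recollement _ _ → k) C) n)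
        (fun D => spec ht ((g l j : Recollement _ _ → k) D) n) E :=
    eventually_all.2 fun i => eventually_all.2 fun j => eventually_all.2 fun l =>
      spec_comp ht _ _
  have h2 : Almost fun n => ∀ i j E, spec ht (∑ l, comp t (f i l) (g l j) E) n =
      ∑ l, spec ht (comp t (f i l) (g l j) E) n :=
    eventually_all.2 fun i => eventually_all.2 fun j => eventually_all.2 fun E => spec_sum ht _ _
  filter_upwards [h1, h2] with n h1 h2
  funext p q
  have hn : (n : k) = Fintype.card (Fin n) := by simp
  have h3 : ((f ≫ g) p.1 q.1 : Recollement _ _ → k) (glued p.2 q.2) =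
      ∑ l, comp t (f p.1 l) (g l q.1) (glued p.2 q.2) :=
    (congrFun (comp_eq f g p.1 q.1) _).trans (Finset.sum_apply _ _ _)
  rw [Matrix.mul_apply, real, h3, h2, Fintype.sum_sigma]
  refine Finset.sum_congr rfl fun l _ => ?_
  rw [h1, comp_glued hn]
  rfl

theorem real_zero (n : ℕ) : real ht n (0 : X ⟶ Y) = 0 := by
  funext p q
  exact spec_zero ht n

theorem real_id (n : ℕ) : real ht n (𝟙 X) = 1 := by
  classical
  funext ⟨i, p⟩ ⟨j, q⟩
  rw [Matrix.one_apply]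
  by_cases h : i = j
  · subst h
    have h1 : (𝟙 X : X ⟶ X) i i = (idCoeff : Recollement _ _ → k) := Mat_.id_apply_self X i
    change spec ht (((𝟙 X : X ⟶ X) i i : Recollement _ _ → k) (glued p q)) n = _
    rw [h1, idCoeff]
    by_cases h2 : p = q
    · subst h2
      rw [if_pos ((glued_eq_refl _ _).2 rfl), if_pos rfl, spec_one]
    · rw [if_neg (mt (glued_eq_refl _ _).1 h2), if_neg (by simpa using h2), spec_zero]
  · have h1 : (𝟙 X : X ⟶ X) i j = (0 : Recollement _ _ → k) := Mat_.id_apply_of_ne X i j h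
    change spec ht (((𝟙 X : X ⟶ X) i j : Recollement _ _ → k) (glued p q)) n = _
    rw [h1, if_neg (by simp [h])]
    exact spec_zero ht n

/-- Two morphisms are equal if they agree at almost all natural numbers. -/
theorem eq_of_real {f g : X ⟶ Y} (h : Almost fun n => real ht n f = real ht n g) : f = g := by
  funext i j
  funext E
  refine eq_of_spec ht ?_
  filter_upwards [h, eventually_hyperfilter_of_ge
    (Fintype.card ((X.X i).carrier ⊕ (Y.X j).carrier)) fun _ h => h] with n h hn
  obtain ⟨p, q, rfl⟩ := exists_glued_fin E hn
  exact congrFun (congrFun h ⟨i, p⟩) ⟨j, q⟩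

theorem real_ne {f g : X ⟶ Y} (h : f ≠ g) : Almost fun n => real ht n f ≠ real ht n g :=
  Ultrafilter.eventually_not.2 fun h2 => h (eq_of_real ht h2)

theorem real_ne_zero {f : X ⟶ Y} (h : f ≠ 0) : Almost fun n => real ht n f ≠ 0 := by
  filter_upwards [real_ne ht h] with n h
  rwa [real_zero] at h

/-- The action of the permutations of `{1, …, n}`. -/
def permPts {n : ℕ} (σ : Equiv.Perm (Fin n)) (p : Pts n X) : Pts n X :=
  ⟨p.1, p.2.trans σ.toEmbedding⟩

theorem real_perm (n : ℕ) (f : X ⟶ Y) (σ : Equiv.Perm (Fin n)) (p : Pts n X) (q : Pts n Y) :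
    real ht n f (permPts σ p) (permPts σ q) = real ht n f p q :=
  congrArg (fun E => spec ht ((f p.1 q.1 : Recollement _ _ → k) E) n) (glued_glued p.2 q.2 _)

/-- At the natural number `n`, the basis of `𝔥 ⊗ X` is `{1, …, n}` times the basis of `X`. -/
noncomputable def hPts (n : ℕ) (X : Mat_ (Deligne₀ t)) : Pts n (hObj X) ≃ Fin n × Pts n X :=
  Equiv.ofBijective (fun P => (P.2 (hPt P.1.2), ⟨P.1.1, (hInc P.1.2).trans P.2⟩)) <| by
    constructor
    · rintro ⟨⟨i, c⟩, p⟩ ⟨⟨j, d⟩, q⟩ h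
      have h1 := congrArg Prod.fst h
      obtain ⟨rfl, h2⟩ := Sigma.mk.inj_iff.1 (congrArg Prod.snd h)
      have := hEmbEquiv.injective (a₁ := ⟨c, p⟩) (a₂ := ⟨d, q⟩) (Prod.ext h1 (eq_of_heq h2))
      obtain ⟨rfl, h3⟩ := Sigma.mk.inj_iff.1 this
      rw [eq_of_heq h3]
    · rintro ⟨j, ⟨i, f⟩⟩
      obtain ⟨⟨c, p⟩, hp⟩ := (hEmbEquiv (U := (X.X i).carrier) (I := Fin n)).surjective (j, f)
      refine ⟨⟨⟨i, c⟩, p⟩, ?_⟩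
      have h1 : p (hPt c) = j := congrArg Prod.fst hp
      have h2 : (hInc c).trans p = f := congrArg Prod.snd hp
      exact Prod.ext h1 (Sigma.ext rfl (heq_of_eq h2))

/-- The matrix of `m ↦ F(e_j ⊗ m)` at `n`, if `F : 𝔥 ⊗ X → Y`. -/
noncomputable def slice (n : ℕ) (F : hObj X ⟶ Y) (j : Fin n) : Matrix (Pts n X) (Pts n Y) k :=
  fun p q => real ht n F ((hPts n X).symm (j, p)) q

/-- The matrix of `m ↦ F(e_i ⊗ e_j ⊗ m)` at `n`, if `F : 𝔥 ⊗ 𝔥 ⊗ X → Y`. -/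
noncomputable def slice₂ (n : ℕ) (F : hObj (hObj X) ⟶ Y) (i j : Fin n) :
    Matrix (Pts n X) (Pts n Y) k :=
  fun p q => slice ht n F i ((hPts n X).symm (j, p)) q

theorem eq_of_slice {f g : hObj X ⟶ Y} (h : Almost fun n => ∀ j, slice ht n f j = slice ht n g j) :
    f = g := by
  refine eq_of_real ht ?_
  filter_upwards [h] with n h
  funext P q
  have := congrFun (congrFun (h (hPts n X P).1) (hPts n X P).2) q
  simpa [slice] using this

theorem sum_hPts (n : ℕ) (F : Pts n (hObj X) → k) :
    ∑ P, F P = ∑ j, ∑ p, F ((hPts n X).symm (j, p)) := by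
  rw [← Fintype.sum_prod_type', ← Equiv.sum_comp (hPts n X).symm]

theorem real_hMap (n : ℕ) (f : X ⟶ Y) (P : Pts n (hObj X)) (Q : Pts n (hObj Y)) :
    real ht n (hMap f) P Q = if (hPts n X P).1 = (hPts n Y Q).1 then
      real ht n f (hPts n X P).2 (hPts n Y Q).2 else 0 := by
  refine (congrArg (fun c => spec ht c n) (hKer_glued _ _ _ P.2 Q.2)).trans ?_
  rw [apply_ite (fun c => spec ht c n), spec_zero]
  rfl

theorem slice_hMap_comp (f : X ⟶ Y) (g : hObj Y ⟶ Z) : Almost fun n => ∀ j,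
    slice ht n (hMap f ≫ g) j = real ht n f * slice ht n g j := by
  filter_upwards [real_comp ht (hMap f) g] with n h j
  funext p q
  refine (congrFun (congrFun h _) q).trans ?_
  rw [Matrix.mul_apply, sum_hPts]
  simp only [real_hMap, Equiv.apply_symm_apply, ite_mul, zero_mul]
  rw [Finset.sum_comm]
  simp only [Finset.sum_ite_eq, Finset.mem_univ, if_true]
  rfl

theorem slice₂_hMap_comp (F : hObj X ⟶ Y) (g : hObj Y ⟶ Z) : Almost fun n => ∀ i j,
    slice₂ ht n (hMap F ≫ g) i j = slice ht n F j * slice ht n g i := by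
  filter_upwards [slice_hMap_comp ht F g] with n h i j
  funext p q
  exact congrFun (congrFun (h i) _) q

theorem slice_sMap (n : ℕ) (f : X ⟶ Y) (j : Fin n) : slice ht n (sMap f) j = real ht n f := by
  have h : ∀ P q, real ht n (sMap f) P q = real ht n f (hPts n X P).2 q := fun P q =>
    congrArg (fun c => spec ht c n) (sKer_glued _ _ P.2 q.2)
  funext p q
  rw [slice, h, Equiv.apply_symm_apply]

theorem slice_rMap_comp (f : X ⟶ Y) (F : hObj (hObj Y) ⟶ Z) : Almost fun n => ∀ j,
    slice ht n (rMap f ≫ F) j = real ht n f * slice₂ ht n F j j := by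
  have h : ∀ n P Q, real ht n (rMap f) P Q =
      if (hPts n X P).1 = (hPts n _ Q).1 ∧ (hPts n X P).1 = (hPts n Y (hPts n _ Q).2).1 then
        real ht n f (hPts n X P).2 (hPts n Y (hPts n _ Q).2).2 else 0 := by
    intro n P Q
    refine (congrArg (fun c => spec ht c n) (rKer_glued _ _ _ _ P.2 Q.2)).trans ?_
    rw [apply_ite (fun c => spec ht c n), spec_zero]
    rfl
  filter_upwards [real_comp ht (rMap f) F] with n h1 j
  funext p q
  refine (congrFun (congrFun h1 _) q).trans ?_
  rw [Matrix.mul_apply, sum_hPts, Finset.sum_eq_single j, sum_hPts, Finset.sum_eq_single j]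
  · simp [h, Matrix.mul_apply, slice, slice₂]
  · intro i _ hi
    simp [h, hi.symm]
  · simp
  · intro i _ hi
    simp [h, hi.symm]
  · simp

theorem slice₂_swapMap_comp (f : X ⟶ Y) (F : hObj (hObj Y) ⟶ Z) : Almost fun n => ∀ i j,
    slice₂ ht n (swapMap f ≫ F) i j = real ht n f * slice₂ ht n F j i := by
  have h : ∀ n P Q, real ht n (swapMap f) P Q =
      if (hPts n _ P).1 = (hPts n Y (hPts n _ Q).2).1 ∧ (hPts n X (hPts n _ P).2).1 =
          (hPts n _ Q).1 then
        real ht n f (hPts n X (hPts n _ P).2).2 (hPts n Y (hPts n _ Q).2).2 else 0 := by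
    intro n P Q
    refine (congrArg (fun c => spec ht c n) (swapKer_glued _ _ _ _ _ P.2 Q.2)).trans ?_
    rw [apply_ite (fun c => spec ht c n), spec_zero]
    rfl
  filter_upwards [real_comp ht (swapMap f) F] with n h1 i j
  funext p q
  refine (congrFun (congrFun h1 _) q).trans ?_
  rw [Matrix.mul_apply, sum_hPts, Finset.sum_eq_single j, sum_hPts, Finset.sum_eq_single i]
  · simp [h, Matrix.mul_apply, slice, slice₂]
  · intro i' _ hi
    simp [h, hi.symm]
  · simp
  · intro i' _ hi
    simp [h, hi.symm]
  · simp

theorem hPts_permPts {n : ℕ} (σ : Equiv.Perm (Fin n)) (j : Fin n) (p : Pts n X) :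
    (hPts n X).symm (σ j, permPts σ p) = permPts σ ((hPts n X).symm (j, p)) := by
  rw [Equiv.symm_apply_eq]
  obtain ⟨P, hP⟩ := (hPts n X).symm.surjective ((hPts n X).symm (j, p))
  have h := (hPts n X).apply_symm_apply (j, p)
  refine Prod.ext ?_ ?_
  · exact congrArg σ (congrArg Prod.fst h).symm
  · exact congrArg (permPts σ) (congrArg Prod.snd h).symm

theorem slice_perm (n : ℕ) (F : hObj X ⟶ Y) (σ : Equiv.Perm (Fin n)) (j : Fin n) (p : Pts n X)
    (q : Pts n Y) : slice ht n F (σ j) (permPts σ p) (permPts σ q) = slice ht n F j p q := by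
  rw [slice, hPts_permPts, real_perm]
  rfl

end Realisation

/-! ### Semisimplicity of `Rep(S_t)` -/

section Summand

open Idempotents

universe u
variable {k : Type u} [Field k] [CharZero k] {t : k}

/-- The summand of `M` that is cut out by an idempotent. -/
def summand (M : RepS t) (e : M ⟶ M) (he : e ≫ e = e) : RepS t :=
  ⟨M.X, e.f, congrArg Karoubi.Hom.f he⟩

def summandι (M : RepS t) (e : M ⟶ M) (he : e ≫ e = e) : summand M e he ⟶ M :=
  ⟨e.f, by
    have h1 : e.f ≫ e.f = e.f := congrArg Karoubi.Hom.f he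
    change e.f ≫ e.f ≫ M.p = e.f
    rw [Karoubi.comp_p, h1]⟩

def summandπ (M : RepS t) (e : M ⟶ M) (he : e ≫ e = e) : M ⟶ summand M e he :=
  ⟨e.f, by
    have h1 : e.f ≫ e.f = e.f := congrArg Karoubi.Hom.f he
    change M.p ≫ e.f ≫ e.f = e.f
    rw [h1, Karoubi.p_comp]⟩

theorem summandπ_ι (M : RepS t) (e : M ⟶ M) (he : e ≫ e = e) :
    summandπ M e he ≫ summandι M e he = e := Karoubi.hom_ext _ _ (congrArg Karoubi.Hom.f he)

theorem summandι_comp (M : RepS t) (e : M ⟶ M) (he : e ≫ e = e) :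
    summandι M e he ≫ e = summandι M e he :=
  Karoubi.hom_ext _ _ (congrArg Karoubi.Hom.f he : e.f ≫ e.f = e.f)

theorem summandι_π (M : RepS t) (e : M ⟶ M) (he : e ≫ e = e) :
    summandι M e he ≫ summandπ M e he = 𝟙 _ :=
  Karoubi.hom_ext _ _ (congrArg Karoubi.Hom.f he : e.f ≫ e.f = e.f)

end Summand

section Semisimple

open Filter Idempotents

universe u
variable {k : Type u} [Field k] [IsAlgClosed k] [CharZero k] {t : k} (ht : Transcendental ℚ t)
  {X Y Z : Mat_ (Deligne₀ t)}

theorem real_pow (x : End X) (m : ℕ) :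
    Almost fun n => real ht n (x ^ m : End X) = real ht n x ^ m := by
  induction m with
  | zero =>
    refine Eventually.of_forall fun n => ?_
    rw [pow_zero, pow_zero]
    exact real_id ht n
  | succ m ih =>
    filter_upwards [ih, real_comp ht (X := X) (Y := X) (Z := X) x (x ^ m : End X)] with n h1 h2
    rw [pow_succ, pow_succ', ← h1, ← h2]
    rfl

/-- The transpose of the morphism whose coefficients are inverse to those of `u`. -/
noncomputable def invTranspose (u : X ⟶ Y) : Y ⟶ X :=
  fun j i => (fun E => ((u i j : Recollement _ _ → k) E.symm)⁻¹ : Recollement _ _ → k)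

include ht in
/-- At almost all natural numbers, the trace of `u ≫ invTranspose u` is the number of nonzero entries of
the matrix of `u`. -/
theorem not_isNilpotent_comp_invTranspose {u : X ⟶ Y} (hu : u ≠ 0) :
    ¬ IsNilpotent (End.of (u ≫ invTranspose u)) := by
  classical
  rintro ⟨m, hm⟩
  have h1 : Almost fun n => ∀ i j E, spec ht ((u i j : Recollement _ _ → k) E) n *
      spec ht ((u i j : Recollement _ _ → k) E)⁻¹ n =
      if (u i j : Recollement _ _ → k) E = 0 then 0 else 1 := by
    refine eventually_all.2 fun i => eventually_all.2 fun j => eventually_all.2 fun E => ?_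
    filter_upwards [spec_mul ht ((u i j : Recollement _ _ → k) E)
      ((u i j : Recollement _ _ → k) E)⁻¹] with n h
    rw [← h]
    split_ifs with h0
    · rw [h0, zero_mul, spec_zero]
    · rw [mul_inv_cancel₀ h0, spec_one]
  have hF : ∀ᶠ n in (hyperfilter ℕ : Filter ℕ), False := by
    filter_upwards [h1, real_pow ht (End.of (u ≫ invTranspose u)) m, real_ne_zero ht hu,
      real_comp ht u (invTranspose u)] with n h1 h2 h3 h4
    rw [hm] at h2
    have h5 : IsNilpotent (real ht n u * real ht n (invTranspose u)) := ⟨m, by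
      rw [← h4, ← h2]
      exact real_zero ht n⟩
    have h6 := (Matrix.isNilpotent_trace_of_isNilpotent h5).eq_zero
    have h7 : ∀ p q, real ht n u p q * real ht n (invTranspose u) q p =
        if (u p.1 q.1 : Recollement _ _ → k) (glued p.2 q.2) = 0 then 0 else 1 := fun p q => by
      rw [← h1]
      change _ * spec ht ((u p.1 q.1 : Recollement _ _ → k) (glued q.2 p.2).symm)⁻¹ n = _
      rw [glued_symm]
      rfl
    simp only [Matrix.trace, Matrix.diag_apply, Matrix.mul_apply, h7] at h6
    obtain ⟨p, q, hpq⟩ : ∃ p q, real ht n u p q ≠ 0 := by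
      by_contra hcon
      push Not at hcon
      exact h3 (funext fun p => funext fun q => hcon p q)
    have h8 : ((∑ p : Pts n X, ∑ q : Pts n Y,
        if (u p.1 q.1 : Recollement _ _ → k) (glued p.2 q.2) = 0 then 0 else 1 : ℕ) : k) = 0 := by
      push_cast
      exact h6
    rw [Nat.cast_eq_zero, Finset.sum_eq_zero_iff] at h8
    have h9 := Finset.sum_eq_zero_iff.1 (h8 p (Finset.mem_univ _)) q (Finset.mem_univ _)
    have h10 : (u p.1 q.1 : Recollement _ _ → k) (glued p.2 q.2) = 0 := by
      by_contra h0
      rw [if_neg h0] at h9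
      exact one_ne_zero h9
    exact hpq ((congrArg (fun c => spec ht c n) h10).trans (spec_zero ht n))
  exact hF.exists.choose_spec

instance (X Y : Mat_ (Deligne₀ t)) : Module.Finite k (X ⟶ Y) :=
  inferInstanceAs (Module.Finite k (∀ (i : X.ι) (j : Y.ι),
    Recollement (X.X i).carrier (Y.X j).carrier → k))

include ht in
/-- The Jacobson radical is a nilpotent ideal, so it contains no `u ≫ invTranspose u` with `u ≠ 0`. -/
theorem isSemisimpleRing_end (X : Mat_ (Deligne₀ t)) : IsSemisimpleRing (End X) := by
  have : Module.Finite k (End X) := inferInstanceAs (Module.Finite k (X ⟶ X))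
  have : IsArtinianRing (End X) := IsArtinianRing.of_finite k (End X)
  rw [IsArtinianRing.isSemisimpleRing_iff_jacobson, eq_bot_iff]
  intro u hu
  by_contra h0
  obtain ⟨m, hm⟩ := IsSemiprimaryRing.isNilpotent (R := End X)
  refine not_isNilpotent_comp_invTranspose ht (X := X) (Y := X) (u := u) h0 ⟨m, ?_⟩
  have h1 : End.of ((u : X ⟶ X) ≫ invTranspose (X := X) (Y := X) u) ∈ Ring.jacobson (End X) :=
    Ideal.mul_mem_left _ (End.of (invTranspose (X := X) (Y := X) u)) hu
  have h2 := Ideal.pow_mem_pow h1 m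
  rw [hm] at h2
  exact h2

include ht in
/-- The category is von Neumann regular: the left ideal of the endomorphisms of `X` that factor
through `f` is generated by an idempotent. -/
theorem exists_regular_mat (f : X ⟶ Y) : ∃ g : Y ⟶ X, f ≫ g ≫ f = f := by
  have := isSemisimpleRing_end ht X
  let I : Ideal (End X) :=
    { carrier := {x | ∃ g : Y ⟶ X, x = f ≫ g}
      add_mem' := by
        rintro _ _ ⟨g, rfl⟩ ⟨g', rfl⟩
        exact ⟨g + g', (Preadditive.comp_add _ _ _ _ _ _).symm⟩
      zero_mem' := ⟨0, Limits.comp_zero.symm⟩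
      smul_mem' := by
        rintro c _ ⟨g, rfl⟩
        exact ⟨g ≫ (c : X ⟶ X), Category.assoc _ _ _⟩ }
  obtain ⟨e, he, hI⟩ := IsSemisimpleRing.ideal_eq_span_idempotent I
  obtain ⟨g, hg⟩ : e ∈ I := hI ▸ Ideal.mem_span_singleton_self e
  have h1 : ∀ g' : Y ⟶ X, (f ≫ g) ≫ f ≫ g' = f ≫ g' := by
    intro g'
    have h2 : End.of (f ≫ g') ∈ Ideal.span {e} := hI ▸ ⟨g', rfl⟩
    obtain ⟨a, ha⟩ := Ideal.mem_span_singleton'.1 h2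
    have h3 : End.of (f ≫ g') * e = End.of (f ≫ g') := by
      rw [← ha, mul_assoc, he.eq]
    rw [hg] at h3
    exact h3
  refine ⟨g, ?_⟩
  by_contra hne
  refine not_isNilpotent_comp_invTranspose ht (sub_ne_zero.2 hne) ⟨1, ?_⟩
  rw [pow_one, Preadditive.sub_comp]
  refine sub_eq_zero.2 (Eq.trans ?_ (h1 _))
  simp only [Category.assoc]

include ht in
theorem exists_regular {M N : RepS t} (f : M ⟶ N) : ∃ g : N ⟶ M, f ≫ g ≫ f = f := by
  obtain ⟨g, hg⟩ := exists_regular_mat ht f.f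
  refine ⟨⟨N.p ≫ g ≫ M.p, by simp [M.idem, N.idem_assoc]⟩, Karoubi.hom_ext _ _ ?_⟩
  simpa using hg

include ht in
/-- An object of `Rep(S_t)` is simple if and only if it is indecomposable. -/
theorem simple_iff_idempotents (M : RepS t) :
    Simple M ↔ 𝟙 M ≠ 0 ∧ ∀ e : M ⟶ M, e ≫ e = e → e = 0 ∨ e = 𝟙 M := by
  constructor
  · intro hM
    refine ⟨(Simple.mono_isIso_iff_nonzero (𝟙 M)).1 inferInstance, fun e he => ?_⟩
    have hmono : Mono (summandι M e he) := mono_of_mono_fac (summandι_π M e he)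
    by_cases h0 : summandι M e he = 0
    · left
      rw [← summandπ_ι M e he, h0, Limits.comp_zero]
    · right
      have := (Simple.mono_isIso_iff_nonzero (summandι M e he)).2 h0
      rw [← summandπ_ι M e he, ← cancel_epi (summandι M e he), ← Category.assoc, summandι_π,
        Category.id_comp, Category.comp_id]
  · rintro ⟨h1, h2⟩
    refine ⟨fun {N} f _ => ⟨?_, fun hf => ?_⟩⟩
    · rintro hf rfl
      refine h1 ?_
      rw [← IsIso.inv_hom_id (0 : N ⟶ M), Limits.comp_zero]
    · obtain ⟨g, hg⟩ := exists_regular ht f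
      rcases h2 (g ≫ f) (by simp [hg]) with h | h
      · rw [h, Limits.comp_zero] at hg
        exact absurd hg.symm hf
      · refine ⟨g, ?_, h⟩
        rw [← cancel_mono f, Category.assoc, hg, Category.id_comp]

include ht in
theorem isIso_of_simple {M N : RepS t} [hM : Simple M] [hN : Simple N] {f : M ⟶ N} (hf : f ≠ 0) :
    IsIso f := by
  obtain ⟨g, hg⟩ := exists_regular ht f
  refine ⟨g, ?_, ?_⟩
  · refine (((simple_iff_idempotents ht M).1 hM).2 (f ≫ g) ?_).resolve_left fun h => hf ?_
    · rw [← Category.assoc, Category.assoc f g f, hg]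
    · rw [← hg, ← Category.assoc, h, Limits.zero_comp]
  · refine (((simple_iff_idempotents ht N).1 hN).2 (g ≫ f) ?_).resolve_left fun h => hf ?_
    · rw [Category.assoc, hg]
    · rw [← hg, h, Limits.comp_zero]

instance (M N : RepS t) : Module.Finite k (M ⟶ N) :=
  Module.Finite.of_injective
    ({ toFun := fun f => f.f, map_add' := fun _ _ => rfl, map_smul' := fun _ _ => rfl } :
      (M ⟶ N) →ₗ[k] (M.X ⟶ N.X)) fun _ _ h => Karoubi.hom_ext _ _ h

include ht in
/-- Schur's lemma in `Rep(S_t)`. -/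
theorem end_eq_smul {M : RepS t} [hM : Simple M] (f : M ⟶ M) : ∃ c : k, f = c • 𝟙 M := by
  have : Nontrivial (M ⟶ M) := ⟨𝟙 M, 0, ((simple_iff_idempotents ht M).1 hM).1⟩
  obtain ⟨c, hc⟩ := Module.End.exists_eigenvalue (Linear.rightComp k M f : (M ⟶ M) →ₗ[k] (M ⟶ M))
  obtain ⟨x, hx⟩ := hc.exists_hasEigenvector
  refine ⟨c, ?_⟩
  by_contra hne
  have := isIso_of_simple ht (sub_ne_zero.2 hne)
  refine hx.2 ((cancel_mono (f - c • 𝟙 M)).1 ?_)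
  have h1 : x ≫ f = c • x := hx.apply_eq_smul
  rw [Preadditive.comp_sub, h1, Linear.comp_smul, Category.comp_id, sub_self, Limits.zero_comp]

include ht in
theorem hom_eq_smul {M N : RepS t} [hM : Simple M] (i : M ≅ N) (f : M ⟶ N) :
    ∃ c : k, f = c • i.hom := by
  obtain ⟨c, hc⟩ := end_eq_smul ht (f ≫ i.inv)
  refine ⟨c, ?_⟩
  rw [← cancel_mono i.inv, hc, Linear.smul_comp, i.hom_inv_id]

end Semisimple

/-! ### Simple objects of `Rep(S_t ⋉ A^{⊗t})` -/

section WreathSimple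

open Idempotents

universe u v
variable {k : Type u} [Field k] [CharZero k] {t : k} {A : Type v} [CommRing A] [Algebra k A]

namespace RepWreath

theorem hDiag_naturality {M N : RepS t} (f : M ⟶ N) :
    (hFunctor t).map f ≫ hDiag N = hDiag M ≫ (hFunctor t).map ((hFunctor t).map f) :=
  (rTrans t).naturality f

theorem hCounit_naturality {M N : RepS t} (f : M ⟶ N) :
    (hFunctor t).map f ≫ hCounit N = hCounit M ≫ f :=
  (sTrans t).naturality f

theorem hSwap_naturality {M N : RepS t} (f : M ⟶ N) :
    (hFunctor t).map ((hFunctor t).map f) ≫ hSwap N =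
      hSwap M ≫ (hFunctor t).map ((hFunctor t).map f) :=
  (swapTrans t).naturality f

theorem y_comm_eq (X : RepWreath A t) (a b : A) :
    (hFunctor t).map (X.y b) ≫ X.y a = hSwap X.obj ≫ (hFunctor t).map (X.y a) ≫ X.y b := by
  have h := X.y_comm a b
  rwa [mul_comm b a, sub_self, map_zero, Limits.comp_zero, sub_eq_zero] at h

/-- A direct summand in `Rep(S_t)` that is preserved by the maps `y_a` is a subobject. -/
noncomputable def retract (X : RepWreath A t) {N : RepS t} (ι : N ⟶ X.obj) (π : X.obj ⟶ N)
    (h1 : ι ≫ π = 𝟙 N)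
    (h2 : ∀ a, (hFunctor t).map ι ≫ X.y a ≫ π ≫ ι = (hFunctor t).map ι ≫ X.y a) :
    RepWreath A t where
  obj := N
  y := (Linear.leftComp k N ((hFunctor t).map ι)).comp
    ((Linear.rightComp k ((hFunctor t).obj X.obj) π).comp X.y)
  y_one := by
    change (hFunctor t).map ι ≫ X.y 1 ≫ π = _
    rw [X.y_one, ← Category.assoc, hCounit_naturality, Category.assoc, h1, Category.comp_id]
  y_mul a b := by
    change hDiag N ≫ (hFunctor t).map ((hFunctor t).map ι ≫ X.y b ≫ π) ≫
      (hFunctor t).map ι ≫ X.y a ≫ π = (hFunctor t).map ι ≫ X.y (a * b) ≫ π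
    rw [← Functor.map_comp_assoc, Category.assoc, Category.assoc, h2, Functor.map_comp,
      Category.assoc, ← Category.assoc (hDiag N), ← hDiag_naturality, Category.assoc,
      ← X.y_mul]
    simp only [Category.assoc]
  y_comm a b := by
    have key : ∀ a b, (hFunctor t).map ((hFunctor t).map ι ≫ X.y b ≫ π) ≫
        (hFunctor t).map ι ≫ X.y a ≫ π =
        (hFunctor t).map ((hFunctor t).map ι) ≫ (hFunctor t).map (X.y b) ≫ X.y a ≫ π := by
      intro a b
      rw [← Functor.map_comp_assoc, Category.assoc, Category.assoc, h2, Functor.map_comp,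
        Category.assoc]
    rw [mul_comm b a, sub_self, map_zero, Limits.comp_zero, sub_eq_zero]
    change (hFunctor t).map ((hFunctor t).map ι ≫ X.y b ≫ π) ≫
        (hFunctor t).map ι ≫ X.y a ≫ π = hSwap N ≫
      (hFunctor t).map ((hFunctor t).map ι ≫ X.y a ≫ π) ≫ (hFunctor t).map ι ≫ X.y b ≫ π
    rw [key, key, ← Category.assoc (hSwap N), ← hSwap_naturality, Category.assoc,
      ← Category.assoc ((hFunctor t).map (X.y b)), y_comm_eq]
    simp only [Category.assoc]

noncomputable def retractι (X : RepWreath A t) {N : RepS t} (ι : N ⟶ X.obj) (π : X.obj ⟶ N)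
    (h1 : ι ≫ π = 𝟙 N)
    (h2 : ∀ a, (hFunctor t).map ι ≫ X.y a ≫ π ≫ ι = (hFunctor t).map ι ≫ X.y a) :
    X.retract ι π h1 h2 ⟶ X :=
  Hom.mk ι fun a => by
    change _ = ((hFunctor t).map ι ≫ X.y a ≫ π) ≫ ι
    rw [Category.assoc, Category.assoc]
    exact (h2 a).symm

theorem id_hom (X : RepWreath A t) : Hom.hom (𝟙 X) = 𝟙 X.obj := rfl

theorem hom_ext {X Y : RepWreath A t} {f g : X ⟶ Y} (h : Hom.hom f = Hom.hom g) : f = g :=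
  Hom.ext h

theorem isIso_of_hom {X Y : RepWreath A t} (f : X ⟶ Y) (g : Y.obj ⟶ X.obj)
    (h1 : Hom.hom f ≫ g = 𝟙 _) (h2 : g ≫ Hom.hom f = 𝟙 _) : IsIso f := by
  refine ⟨Hom.mk g fun a => ?_, hom_ext h1, hom_ext h2⟩
  calc (hFunctor t).map g ≫ X.y a = (hFunctor t).map g ≫ (X.y a ≫ Hom.hom f) ≫ g := by
        rw [Category.assoc, h1, Category.comp_id]
    _ = (hFunctor t).map g ≫ ((hFunctor t).map (Hom.hom f) ≫ Y.y a) ≫ g := by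
        rw [Hom.comm f a]
    _ = Y.y a ≫ g := by
        rw [Category.assoc, ← Functor.map_comp_assoc, h2, CategoryTheory.Functor.map_id,
          Category.id_comp]

/-- The image of `e` is preserved by all the maps `y_a`. -/
def Stable (X : RepWreath A t) (e : X.obj ⟶ X.obj) : Prop :=
  ∀ a, (hFunctor t).map e ≫ X.y a ≫ e = (hFunctor t).map e ≫ X.y a

variable {X Y : RepWreath A t}

theorem Stable.map_summandι {e : X.obj ⟶ X.obj} (h : X.Stable e) (he : e ≫ e = e) (a : A) :
    (hFunctor t).map (summandι X.obj e he) ≫ X.y a ≫ summandπ X.obj e he ≫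
        summandι X.obj e he =
      (hFunctor t).map (summandι X.obj e he) ≫ X.y a := by
  rw [summandπ_ι, ← summandι_comp X.obj e he, Functor.map_comp, Category.assoc, Category.assoc, h a]

/-- The image of a morphism is a subobject. -/
theorem stable_image (f : X ⟶ Y) {g : Y.obj ⟶ X.obj} (hg : Hom.hom f ≫ g ≫ Hom.hom f = Hom.hom f) :
    Y.Stable (g ≫ Hom.hom f) := by
  intro a
  rw [Functor.map_comp, Category.assoc, ← Category.assoc ((hFunctor t).map (Hom.hom f)),
    Hom.comm f a]
  simp only [Category.assoc, hg]
  rw [← Hom.comm f a]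

/-- The kernel of a morphism is a subobject. -/
theorem stable_kernel (f : X ⟶ Y) {g : Y.obj ⟶ X.obj}
    (hg : Hom.hom f ≫ g ≫ Hom.hom f = Hom.hom f) : X.Stable (𝟙 _ - Hom.hom f ≫ g) := by
  intro a
  have h1 : (𝟙 _ - Hom.hom f ≫ g) ≫ Hom.hom f = 0 := by
    rw [Preadditive.sub_comp, Category.assoc, hg, Category.id_comp, sub_self]
  have h2 : (hFunctor t).map (𝟙 _ - Hom.hom f ≫ g) ≫ X.y a ≫ Hom.hom f = 0 := by
    rw [← Hom.comm f a, ← Functor.map_comp_assoc, h1, hFunctor_map_zero, Limits.zero_comp]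
  rw [Preadditive.comp_sub, Preadditive.comp_sub, ← Category.assoc (X.y a), ← Category.assoc _ _ g,
    h2, Limits.zero_comp, sub_zero, Category.comp_id]

theorem idem_image (f : X ⟶ Y) {g : Y.obj ⟶ X.obj} (hg : Hom.hom f ≫ g ≫ Hom.hom f = Hom.hom f) :
    (g ≫ Hom.hom f) ≫ g ≫ Hom.hom f = g ≫ Hom.hom f := by
  rw [Category.assoc, hg]

theorem idem_kernel (f : X ⟶ Y) {g : Y.obj ⟶ X.obj} (hg : Hom.hom f ≫ g ≫ Hom.hom f = Hom.hom f) :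
    (𝟙 _ - Hom.hom f ≫ g) ≫ (𝟙 _ - Hom.hom f ≫ g) = 𝟙 _ - Hom.hom f ≫ g := by
  have h : (Hom.hom f ≫ g) ≫ Hom.hom f ≫ g = Hom.hom f ≫ g := by
    rw [Category.assoc, ← Category.assoc g, ← Category.assoc (Hom.hom f), hg]
  rw [Preadditive.sub_comp, Preadditive.comp_sub, Preadditive.comp_sub, h]
  simp

variable [IsAlgClosed k] (ht : Transcendental ℚ t)

include ht in
/-- The subobjects correspond to stable idempotents, since every morphism of `Rep(S_t)` has an image that is
a direct summand. -/
theorem simple_iff (X : RepWreath A t) :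
    Simple X ↔ 𝟙 X.obj ≠ 0 ∧ ∀ e : X.obj ⟶ X.obj, e ≫ e = e → X.Stable e → e = 0 ∨ e = 𝟙 _ := by
  constructor
  · intro hX
    refine ⟨fun h => (Simple.mono_isIso_iff_nonzero (𝟙 X)).1 inferInstance (hom_ext h),
      fun e he hs => ?_⟩
    let i := X.retractι (summandι X.obj e he) (summandπ X.obj e he) (summandι_π _ _ _)
      (hs.map_summandι he)
    have hmono : Mono i := ⟨fun f g hfg => hom_ext (by
      have h1 : Hom.hom f ≫ summandι X.obj e he = Hom.hom g ≫ summandι X.obj e he :=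
        congrArg Hom.hom hfg
      have h2 : Mono (summandι X.obj e he) := mono_of_mono_fac (summandι_π X.obj e he)
      exact h2.right_cancellation _ _ h1)⟩
    by_cases h0 : i = 0
    · left
      have h1 : summandι X.obj e he = 0 := congrArg Hom.hom h0
      rw [← summandπ_ι X.obj e he, h1, Limits.comp_zero]
    · right
      have := (Simple.mono_isIso_iff_nonzero i).2 h0
      have h1 : Hom.hom (inv i) ≫ summandι X.obj e he = 𝟙 _ := congrArg Hom.hom (IsIso.inv_hom_id i)
      have h2 := congrArg (fun f => Hom.hom (inv i) ≫ f) (summandι_comp X.obj e he)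
      rw [← Category.id_comp e, ← h1]
      exact (Category.assoc _ _ _).trans h2
  · rintro ⟨h1, h2⟩
    refine ⟨fun {N} f _ => ⟨?_, fun hf => ?_⟩⟩
    · rintro hf rfl
      refine h1 ?_
      have h3 := congrArg Hom.hom (IsIso.inv_hom_id (0 : N ⟶ X))
      rw [← id_hom, ← h3, Limits.comp_zero]
      rfl
    · obtain ⟨g, hg⟩ := exists_regular ht (Hom.hom f)
      rcases h2 _ (idem_image f hg) (stable_image f hg) with h | h
      · rw [h, Limits.comp_zero] at hg
        exact absurd (hom_ext hg.symm) hf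
      · refine isIso_of_hom f g ?_ h
        let i := N.retractι (summandι _ _ (idem_kernel f hg)) (summandπ _ _ (idem_kernel f hg))
          (summandι_π _ _ _) ((stable_kernel f hg).map_summandι (idem_kernel f hg))
        have h3 : i ≫ f = 0 ≫ f := hom_ext (by
          rw [Limits.zero_comp]
          change summandι _ _ (idem_kernel f hg) ≫ Hom.hom f = 0
          have h4 := summandι_π _ _ (idem_kernel f hg)
          rw [← Category.id_comp (summandι _ _ _ ≫ _), ← h4, Category.assoc,
            ← Category.assoc (summandπ _ _ _), summandπ_ι, Preadditive.sub_comp, Category.assoc, hg,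
            Category.id_comp, sub_self, Limits.comp_zero])
        have h5 : summandι _ _ (idem_kernel f hg) = 0 := congrArg Hom.hom ((cancel_mono f).1 h3)
        have h6 := summandπ_ι _ _ (idem_kernel f hg)
        rw [h5, Limits.comp_zero] at h6
        exact (sub_eq_zero.1 h6.symm).symm

include ht in
theorem isIso_of_simple [hX : Simple X] [hY : Simple Y] {f : X ⟶ Y} (hf : f ≠ 0) : IsIso f := by
  obtain ⟨g, hg⟩ := exists_regular ht (Hom.hom f)
  refine isIso_of_hom f g ?_ ?_
  · rcases ((simple_iff ht X).1 hX).2 _ (idem_kernel f hg) (stable_kernel f hg) with h | h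
    · exact (sub_eq_zero.1 h).symm
    · rw [sub_eq_self] at h
      rw [← Category.assoc, h, Limits.zero_comp] at hg
      exact absurd (hom_ext hg.symm) hf
  · refine (((simple_iff ht Y).1 hY).2 _ (idem_image f hg) (stable_image f hg)).resolve_left
      fun h => hf (hom_ext ?_)
    rw [← hg, h, Limits.comp_zero]
    rfl

end RepWreath

end WreathSimple

/-! ### The action of `A` at natural numbers -/

section Action

open Filter Idempotents

universe u v
variable {k : Type u} [Field k] [IsAlgClosed k] [CharZero k] {t : k} (ht : Transcendental ℚ t)
  {A : Type v} [CommRing A] [Algebra k A] (X : RepWreath A t)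

namespace RepWreath

/-- The map `y_a` in the additive envelope. -/
noncomputable def act (a : A) : hObj X.obj.X ⟶ X.obj.X := (X.y a).f

theorem act_comp_p (a : A) : X.act a ≫ X.obj.p = X.act a := Karoubi.comp_p (X.y a)

theorem hMap_p_act (a : A) : hMap X.obj.p ≫ X.act a = X.act a := Karoubi.p_comp (X.y a)

theorem act_one : X.act 1 = sMap X.obj.p := by
  rw [act, X.y_one, hCounit_f]

theorem act_mul (a b : A) : rMap X.obj.p ≫ hMap (X.act b) ≫ X.act a = X.act (a * b) := by
  have h := congrArg Karoubi.Hom.f (X.y_mul a b)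
  change (hDiag X.obj).f ≫ hMap (X.act b) ≫ X.act a = _ at h
  rwa [hDiag_f, hMap_rMap, Category.comp_id] at h

theorem act_comm (a b : A) :
    hMap (X.act b) ≫ X.act a = swapMap X.obj.p ≫ hMap (X.act a) ≫ X.act b := by
  have h := congrArg Karoubi.Hom.f (X.y_comm_eq a b)
  change hMap (X.act b) ≫ X.act a = (hSwap X.obj).f ≫ hMap (X.act a) ≫ X.act b at h
  rwa [hSwap_f, hMap_swapMap, Category.comp_id] at h

theorem real_p_mul_slice (a : A) : Almost fun n => ∀ j,
    real ht n X.obj.p * slice ht n (X.act a) j = slice ht n (X.act a) j := by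
  filter_upwards [slice_hMap_comp ht X.obj.p (X.act a)] with n h j
  rw [← h, hMap_p_act]

theorem slice_mul_slice (a b : A) : Almost fun n => ∀ j,
    slice ht n (X.act b) j * slice ht n (X.act a) j = slice ht n (X.act (a * b)) j := by
  filter_upwards [slice_rMap_comp ht X.obj.p (hMap (X.act b) ≫ X.act a),
    slice₂_hMap_comp ht (X.act b) (X.act a), X.real_p_mul_slice ht b] with n h1 h2 h3 j
  rw [← act_mul, h1, h2, ← mul_assoc, h3]

theorem slice_comm (a b : A) : Almost fun n => ∀ i j,
    slice ht n (X.act b) j * slice ht n (X.act a) i =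
      slice ht n (X.act a) i * slice ht n (X.act b) j := by
  filter_upwards [slice₂_swapMap_comp ht X.obj.p (hMap (X.act a) ≫ X.act b),
    slice₂_hMap_comp ht (X.act b) (X.act a), slice₂_hMap_comp ht (X.act a) (X.act b),
    X.real_p_mul_slice ht a] with n h1 h2 h3 h4 i j
  rw [← h2, act_comm, h1, h3, ← mul_assoc, h4]

/-- If commuting elements `S j` of square zero generate a left ideal that contains a left unit `p`
of all the `S j`, then `p = 0`. -/
theorem eq_zero_of_square_zero {R ι : Type*} [Ring R] [Fintype ι] (S G : ι → R) {p : R}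
    (hS : ∀ i j, S i * S j = S j * S i) (h2 : ∀ i, S i * S i = 0) (hp : ∀ i, p * S i = S i)
    (hG : p = ∑ i, G i * S i) : p = 0 := by
  classical
  have key : ∀ T : Finset ι, ∀ m : R, (∀ i ∉ T, S i * m = 0) → p * m = 0 := by
    intro T
    induction T using Finset.induction_on with
    | empty =>
      intro m hm
      rw [hG, Finset.sum_mul]
      exact Finset.sum_eq_zero fun i _ => by rw [mul_assoc, hm i (Finset.notMem_empty i), mul_zero]
    | insert a T ha ih =>
      intro m hm
      refine ih m fun i hi => ?_
      by_cases hia : i = a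
      · subst hia
        have h3 := ih (S i * m) fun j hj => by
          by_cases hji : j = i
          · rw [hji, ← mul_assoc, h2, zero_mul]
          · rw [← mul_assoc, hS j i, mul_assoc, hm j (by simp [hji, hj]), mul_zero]
        rwa [← mul_assoc, hp] at h3
      · exact hm i (by simp [hia, hi])
  simpa using key Finset.univ 1 fun i hi => absurd (Finset.mem_univ i) hi

variable {X}

include ht in
/-- The algebra `A` acts on a simple object through a reduced quotient: the image of a nilpotent
element would be a proper subobject. -/
theorem y_eq_zero_of_sq [hX : Simple X] {a : A} (ha : X.y (a * a) = 0) : X.y a = 0 := by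
  by_contra hne
  obtain ⟨g, hg⟩ := exists_regular ht (X.y a)
  have hs : X.Stable (g ≫ X.y a) := by
    intro b
    rw [Functor.map_comp, Category.assoc, ← Category.assoc ((hFunctor t).map (X.y a)),
      y_comm_eq X b a]
    simp only [Category.assoc, hg]
    rw [y_comm_eq X b a]
  have h1 : g ≫ X.y a = 𝟙 _ :=
    (((simple_iff ht X).1 hX).2 _ (by rw [Category.assoc, hg]) hs).resolve_left fun h => hne (by
      rw [← hg, h, Limits.comp_zero])
  have h2 : g.f ≫ X.act a = X.obj.p := congrArg Karoubi.Hom.f h1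
  have hp : X.obj.p ≠ 0 := fun h => ((simple_iff ht X).1 hX).1 (Karoubi.hom_ext _ _ h)
  refine Eventually.exists (f := (hyperfilter ℕ : Filter ℕ)) (p := fun _ => False) ?_ |>.choose_spec
  filter_upwards [real_comp ht g.f (X.act a), X.slice_comm ht a a, X.slice_mul_slice ht a a,
    X.real_p_mul_slice ht a, real_ne_zero ht hp] with n h3 h4 h5 h6 h7
  refine h7 (eq_zero_of_square_zero (fun j => slice ht n (X.act a) j)
    (fun j p q => real ht n g.f p ((hPts n _).symm (j, q))) (fun i j => h4 j i) (fun i => ?_)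
    h6 ?_)
  · rw [h5]
    have : X.act (a * a) = 0 := congrArg Karoubi.Hom.f ha
    rw [this]
    funext p q
    exact congrFun (congrFun (real_zero ht n) _) q
  · rw [← h2, h3]
    funext p q
    rw [Matrix.sum_apply]
    exact (sum_hPts n fun P => real ht n g.f p P * real ht n (X.act a) P q).trans
      (Finset.sum_congr rfl fun j _ => rfl)

end RepWreath

/-- Distinct characters are dual to elements of the algebra. -/
theorem exists_dual {k A ι : Type*} [Field k] [CommRing A] [Algebra k A] [Fintype ι]
    [DecidableEq ι] {χ : ι → (A →ₐ[k] k)} (hχ : Function.Injective χ) :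
    ∃ a : ι → A, ∀ i j, χ j (a i) = if i = j then 1 else 0 := by
  have h1 : ∀ i j, ∃ b, i ≠ j → χ i b ≠ χ j b := by
    intro i j
    by_cases h : i = j
    · exact ⟨0, fun h' => absurd h h'⟩
    · by_contra hcon
      push Not at hcon
      exact h (hχ (AlgHom.ext fun b => (hcon b).2))
  choose b hb using h1
  refine ⟨fun i => ∏ j ∈ Finset.univ.erase i,
    (χ i (b i j) - χ j (b i j))⁻¹ • (b i j - algebraMap k A (χ j (b i j))), fun i j => ?_⟩
  rw [map_prod]
  split_ifs with h
  · subst h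
    refine Finset.prod_eq_one fun j hj => ?_
    have h2 := hb i j (Finset.ne_of_mem_erase hj).symm
    rw [map_smul, map_sub, AlgHom.commutes, smul_eq_mul]
    exact inv_mul_cancel₀ (sub_ne_zero.2 h2)
  · refine Finset.prod_eq_zero (Finset.mem_erase.2 ⟨Ne.symm h, Finset.mem_univ j⟩) ?_
    rw [map_smul, map_sub, AlgHom.commutes]
    simp

namespace RepWreath

/-- The algebra `A` acts on `X` through its quotient `k^ι`, whose points are the characters `χ i`; the `a i`
are elements of `A` that lift the primitive idempotents of `k^ι`. -/
structure Spectral {ι : Type*} [Fintype ι] [DecidableEq ι] (χ : ι → (A →ₐ[k] k)) (a : ι → A) :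
    Prop where
  injective : Function.Injective χ
  dual : ∀ i j, χ j (a i) = if i = j then 1 else 0
  y_eq : ∀ b, X.y b = ∑ i, χ i b • X.y (a i)

variable {X}

include ht in
/-- On a simple object, `A` acts through a finite-dimensional reduced quotient, which is a product of copies
of `k`. -/
theorem exists_spectral [hX : Simple X] : ∃ (ι : Type v) (_ : Fintype ι) (_ : DecidableEq ι)
    (χ : ι → (A →ₐ[k] k)) (a : ι → A), X.Spectral χ a := by
  classical
  let K : Ideal A :=
    { carrier := {a | X.y a = 0}
      add_mem' := fun {a b} ha hb => by
        change X.y (a + b) = 0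
        rw [map_add, show X.y a = 0 from ha, show X.y b = 0 from hb, add_zero]
      zero_mem' := map_zero _
      smul_mem' := fun c a ha => by
        change X.y (c * a) = 0
        rw [← X.y_mul, show X.y a = 0 from ha, hFunctor_map_zero, Limits.zero_comp,
          Limits.comp_zero] }
  have hfin : Module.Finite k (A ⧸ K) := by
    let e : (A ⧸ K) →ₗ[k] ((hFunctor t).obj X.obj ⟶ X.obj) :=
      (K.restrictScalars k).liftQ X.y fun a ha => ha
    refine Module.Finite.of_injective e ?_
    exact LinearMap.ker_eq_bot.1 (Submodule.ker_liftQ_eq_bot _ _ _ fun a ha => ha)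
  have hart : IsArtinianRing (A ⧸ K) := IsArtinianRing.of_finite k _
  have hred : IsReduced (A ⧸ K) := by
    rw [isReduced_iff_pow_one_lt 2 one_lt_two]
    intro x hx
    obtain ⟨a, rfl⟩ := Ideal.Quotient.mk_surjective x
    rw [← map_pow, Ideal.Quotient.eq_zero_iff_mem] at hx
    rw [Ideal.Quotient.eq_zero_iff_mem]
    exact y_eq_zero_of_sq ht (by rw [← pow_two]; exact hx)
  let ι := MaximalSpectrum (A ⧸ K)
  have : Fintype ι := Fintype.ofFinite _
  have hbij : ∀ I : ι, Function.Bijective (algebraMap k ((A ⧸ K) ⧸ I.asIdeal)) := fun I => by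
    have := I.isMaximal
    let _ := Ideal.Quotient.field I.asIdeal
    have : Module.Finite k ((A ⧸ K) ⧸ I.asIdeal) :=
      Module.Finite.of_surjective (Ideal.Quotient.mkₐ k I.asIdeal).toLinearMap
        (Ideal.Quotient.mkₐ_surjective k I.asIdeal)
    have : Algebra.IsIntegral k ((A ⧸ K) ⧸ I.asIdeal) := Algebra.IsIntegral.of_finite _ _
    exact IsAlgClosed.algebraMap_bijective_of_isIntegral
  let χ' : ι → ((A ⧸ K) →ₐ[k] k) := fun I =>
    ((AlgEquiv.ofBijective (Algebra.ofId k _) (hbij I)).symm : _ →ₐ[k] k).comp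
      (Ideal.Quotient.mkₐ k I.asIdeal)
  have hker : ∀ I x, χ' I x = 0 ↔ x ∈ I.asIdeal := fun I x => by
    change (AlgEquiv.ofBijective (Algebra.ofId k _) (hbij I)).symm _ = 0 ↔ _
    rw [EmbeddingLike.map_eq_zero_iff]
    exact Ideal.Quotient.eq_zero_iff_mem
  let χ : ι → (A →ₐ[k] k) := fun I => (χ' I).comp (Ideal.Quotient.mkₐ k K)
  have hinj : Function.Injective χ := by
    intro I I' h
    refine MaximalSpectrum.ext (Ideal.ext fun x => ?_)
    obtain ⟨a, rfl⟩ := Ideal.Quotient.mk_surjective x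
    rw [← hker, ← hker]
    have := DFunLike.congr_fun h a
    change χ' I _ = χ' I' _ at this
    exact iff_of_eq (congrArg (· = 0) this)
  obtain ⟨a, ha⟩ := exists_dual hinj
  refine ⟨ι, inferInstance, inferInstance, χ, a, hinj, ha, fun b => ?_⟩
  have h0 : Ideal.Quotient.mk K (b - ∑ i, χ i b • a i) = 0 := by
    rw [← Ideal.mem_bot, ← Ideal.zero_eq_bot, ← nilradical_eq_zero (A ⧸ K),
      IsArtinianRing.nilradical_eq_iInf, Ideal.mem_iInf]
    intro I
    rw [← hker]
    change χ I _ = 0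
    simp [ha]
  have h1 : X.y (b - ∑ i, χ i b • a i) = 0 := Ideal.Quotient.eq_zero_iff_mem.1 h0
  rw [map_sub, sub_eq_zero] at h1
  rw [h1, map_sum]
  simp only [map_smul]

end RepWreath
end Action

/-! ### Coloured vectors -/

section WeightBound

universe u
variable {k : Type u} [Field k] {t : k} {O : Mat_ (Deligne₀ t)}

open Matrix

/-- A vector of the representation of `S_n` that is made of injections of sets with at most `d` points
cannot be a weight vector for which an operator, attached to the points of `{1, …, n}`, is `1` at `d + 1` points
and `0` at `d + 1` points: the product of the `1 - τ` for `d + 1` disjoint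
transpositions `τ` is zero on the representation, but not on such a vector, all of whose images under
products of the `τ` have different weights. -/
theorem weight_bound {n d : ℕ} (hd : ∀ i, Fintype.card (O.X i).carrier ≤ d)
    (E : Fin n → Matrix (Pts n O) (Pts n O) k)
    (hE : ∀ (σ : Equiv.Perm (Fin n)) j p q, E (σ j) (permPts σ p) (permPts σ q) = E j p q)
    {v : Pts n O → k} (hv : v ≠ 0) {b c : Fin (d + 1) → Fin n} (hbc : ∀ r s, b r ≠ c s)
    (hbi : Function.Injective b) (hci : Function.Injective c)
    (hb : ∀ s, v ᵥ* E (b s) = v) (hc : ∀ s, v ᵥ* E (c s) = 0) : False := by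
  have hinv : ∀ (i j : Fin n) (p : Pts n O),
      permPts (Equiv.swap i j) (permPts (Equiv.swap i j) p) = p := fun i j p =>
    Sigma.ext rfl (heq_of_eq (Function.Embedding.ext fun x => (Equiv.swap i j).symm_apply_apply (p.2 x)))
  let e : ∀ i j : Fin n, Pts n O ≃ Pts n O := fun i j =>
    ⟨permPts (Equiv.swap i j), permPts (Equiv.swap i j), hinv i j, hinv i j⟩
  have hequi : ∀ (i j x : Fin n) (w : Pts n O → k),
      (w ∘ e i j) ᵥ* E x = (w ᵥ* E (Equiv.swap i j x)) ∘ e i j := by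
    intro i j x w
    funext q
    refine (Fintype.sum_equiv (e i j) _ _ fun p => ?_)
    have := hE (Equiv.swap i j) x p q
    exact congrArg (fun z => w (e i j p) * z) this.symm
  -- `w` is the image of `v` under the first `r` factors `1 - τ`; it is recovered from the next image by
  -- the operator at `b r`, so it is not zero
  have key : ∀ r : ℕ, r ≤ d + 1 → ∃ w : Pts n O → k, w ≠ 0 ∧
      (∀ s : Fin (d + 1), r ≤ s → w ᵥ* E (b s) = w ∧ w ᵥ* E (c s) = 0) ∧
      ∀ s : Fin (d + 1), (s : ℕ) < r → ∀ p : Pts n O,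
        (∀ x, p.2 x ≠ b s ∧ p.2 x ≠ c s) → w p = 0 := by
    intro r
    induction r with
    | zero => exact fun _ => ⟨v, hv, fun s _ => ⟨hb s, hc s⟩, fun s hs => absurd hs (by omega)⟩
    | succ r ih =>
      intro hr
      obtain ⟨w, hw0, hw1, hw2⟩ := ih (by omega)
      let r' : Fin (d + 1) := ⟨r, hr⟩
      have h1 : (w - w ∘ e (b r') (c r')) ᵥ* E (b r') = w := by
        rw [Matrix.sub_vecMul, hequi, Equiv.swap_apply_left, (hw1 r' le_rfl).1, (hw1 r' le_rfl).2]
        funext p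
        simp
      refine ⟨w - w ∘ e (b r') (c r'), ?_, ?_, ?_⟩
      · intro h0
        rw [h0, Matrix.zero_vecMul] at h1
        exact hw0 h1.symm
      · intro s hs
        have hsr : s ≠ r' := fun h => by
          have : (s : ℕ) = r := congrArg Fin.val h
          omega
        have hsw := hw1 s (by omega)
        constructor
        · rw [Matrix.sub_vecMul, hequi, Equiv.swap_apply_of_ne_of_ne
            (fun h => hsr (hbi h)) (hbc _ _), hsw.1]
        · rw [Matrix.sub_vecMul, hequi, Equiv.swap_apply_of_ne_of_ne
            (hbc _ _).symm (fun h => hsr (hci h)), hsw.2]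
          funext p
          simp
      · intro s hs p hp
        by_cases hsr : s = r'
        · subst hsr
          have h2 : e (b r') (c r') p = p := Sigma.ext rfl (heq_of_eq
            (Function.Embedding.ext fun x =>
              Equiv.swap_apply_of_ne_of_ne (hp x).1 (hp x).2))
          simp [h2]
        · have hs' : (s : ℕ) < r := by
            have : (s : ℕ) ≠ r := fun h => hsr (Fin.ext h)
            omega
          have h2 : w (e (b r') (c r') p) = 0 := by
            refine hw2 s hs' _ fun x => ⟨fun h => ?_, fun h => ?_⟩
            · have h3 : Equiv.swap (b r') (c r') (p.2 x) = b s := h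
              rw [Equiv.swap_apply_eq_iff, Equiv.swap_apply_of_ne_of_ne
                (fun h => hsr (hbi h)) (hbc _ _)] at h3
              exact (hp x).1 h3
            · have h3 : Equiv.swap (b r') (c r') (p.2 x) = c s := h
              rw [Equiv.swap_apply_eq_iff, Equiv.swap_apply_of_ne_of_ne
                (hbc _ _).symm (fun h => hsr (hci h))] at h3
              exact (hp x).2 h3
          simp [h2, hw2 s hs' p hp]
  obtain ⟨w, hw0, -, hw2⟩ := key (d + 1) le_rfl
  refine hw0 (funext fun p => ?_)
  by_contra hp
  have h1 : ∀ s : Fin (d + 1), ∃ x, p.2 x = b s ∨ p.2 x = c s := by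
    intro s
    by_contra hcon
    push Not at hcon
    exact hp (hw2 s s.2 p hcon)
  choose x hx using h1
  have hxi : Function.Injective x := by
    intro s s' h
    have h2 := hx s
    rw [h] at h2
    rcases h2 with h2 | h2 <;> rcases hx s' with h3 | h3
    · exact hbi (h2.symm.trans h3)
    · exact absurd (h2.symm.trans h3) (hbc _ _)
    · exact absurd (h3.symm.trans h2) (hbc _ _)
    · exact hci (h2.symm.trans h3)
  have h4 := Fintype.card_le_of_injective x hxi
  rw [Fintype.card_fin] at h4
  exact absurd (h4.trans (hd p.1)) (by omega)

end WeightBound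

section Vectors

open Filter Idempotents Matrix

universe u v
variable {k : Type u} [Field k] [CharZero k] {t : k}

/-- The object `[V]` of the additive envelope. -/
@[reducible] def single (t : k) (V : Type) [Fintype V] : Mat_ (Deligne₀ t) where
  ι := Unit
  X _ := ⟨V⟩

/-- The component of a morphism at the summand `[hSet V c]` of `𝔥 ⊗ [V]`. -/
def compAt {V : Type} [Fintype V] {O : Mat_ (Deligne₀ t)} (F : hObj (single t V) ⟶ O)
    (c : Option V) : single t (hSet V c) ⟶ O :=
  fun _ j => F ⟨(), c⟩ j

variable [IsAlgClosed k] (ht : Transcendental ℚ t)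
  {A : Type v} [CommRing A] [Algebra k A] (X : RepWreath A t) {V : Type} [Fintype V]
  {O : Mat_ (Deligne₀ t)}

/-- The image of the basis vector `e` under a morphism out of `[V]`, at the number `n`. -/
noncomputable def row (n : ℕ) (f : single t V ⟶ O) (e : V ↪ Fin n) : Pts n O → k :=
  real ht n f ⟨(), e⟩

theorem eq_of_row {f g : single t V ⟶ O}
    (h : Almost fun n => ∀ e, row ht n f e = row ht n g e) : f = g := by
  refine eq_of_real ht ?_
  filter_upwards [h] with n h
  funext ⟨_, e⟩
  exact h e

theorem row_comp {O' : Mat_ (Deligne₀ t)} (f : single t V ⟶ O) (g : O ⟶ O') : Almost fun n =>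
    ∀ e, row ht n (f ≫ g) e = row ht n f e ᵥ* real ht n g := by
  filter_upwards [real_comp ht f g] with n h e
  exact congrFun h _

theorem row_compAt (f : single t V ⟶ O) (c : Option V) (F : hObj O ⟶ O) : Almost fun n =>
    ∀ e : hSet V c ↪ Fin n, row ht n (compAt (hMap f ≫ F) c) e =
      row ht n f ((hInc c).trans e) ᵥ* slice ht n F (e (hPt c)) := by
  filter_upwards [slice_hMap_comp ht f F] with n h e
  refine Eq.trans ?_ (congrFun (h (e (hPt c))) ⟨(), (hInc c).trans e⟩)
  funext q
  have h1 : (hPts n (single t V)).symm (e (hPt c), ⟨(), (hInc c).trans e⟩) = ⟨⟨(), c⟩, e⟩ :=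
    (hPts n (single t V)).symm_apply_apply ⟨⟨(), c⟩, e⟩
  rw [slice, h1]
  rfl

theorem eq_of_compAt {F G : hObj (single t V) ⟶ O} (h : ∀ c, compAt F c = compAt G c) : F = G := by
  funext ⟨_, c⟩ j
  exact congrFun (congrFun (h c) ()) j

theorem compAt_sum {ι : Type*} (s : Finset ι) (F : ι → (hObj (single t V) ⟶ O)) (c : Option V) :
    compAt (∑ i ∈ s, F i) c = ∑ i ∈ s, compAt (F i) c := by
  classical
  induction s using Finset.induction_on with
  | empty => rfl
  | insert a s ha ih =>
    rw [Finset.sum_insert ha, Finset.sum_insert ha, ← ih]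
    rfl

theorem sKer_some {U W : Type} (Φ : Recollement U W → k) (u : U) :
    sKer Φ (some u) = Φ := by
  funext E
  refine (if_pos trivial).trans (congrArg Φ (rec_ext fun u v => ?_))
  exact mem_restrict E (hInc (some u)) (.refl W) u v

theorem compAt_sMap_some (f : single t V ⟶ O) (v : V) : compAt (sMap f) (some v) = f := by
  funext _ j
  exact sKer_some _ v

namespace RepWreath

/-- The morphism `e_i ⊗ e_f ↦ b_i f(e_f)`, restricted to the summand of `𝔥 ⊗ [V]` that belongs to `c`: the
point `i` is a point of `V`, or it is a new point. -/
noncomputable def move (f : single t V ⟶ X.obj.X) (c : Option V) (b : A) :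
    single t (hSet V c) ⟶ X.obj.X :=
  compAt (hMap f ≫ X.act b) c

/-- The case of a point of `V`. -/
noncomputable def moveSome (f : single t V ⟶ X.obj.X) (v : V) (b : A) : single t V ⟶ X.obj.X :=
  X.move f (some v) b

/-- The case of a new point. -/
noncomputable def moveNone (f : single t V ⟶ X.obj.X) (b : A) : single t (Option V) ⟶ X.obj.X :=
  X.move f none b

theorem row_move (f : single t V ⟶ X.obj.X) (c : Option V) (b : A) : Almost fun n =>
    ∀ e : hSet V c ↪ Fin n, row ht n (X.move f c b) e =
      row ht n f ((hInc c).trans e) ᵥ* slice ht n (X.act b) (e (hPt c)) :=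
  row_compAt ht f c _

theorem move_comp_p (f : single t V ⟶ X.obj.X) (c : Option V) (b : A) :
    X.move f c b ≫ X.obj.p = X.move f c b := by
  have h : hMap f ≫ X.act b ≫ X.obj.p = hMap f ≫ X.act b := by rw [act_comp_p]
  rw [← Category.assoc] at h
  funext _ j
  exact congrFun (congrFun h ⟨(), c⟩) j

theorem move_one {f : single t V ⟶ X.obj.X} (hf : f ≫ X.obj.p = f) (c : Option V) :
    X.move f c 1 = compAt (sMap f) c := by
  rw [move, act_one, hMap_sMap, hf]

variable {X} {ι : Type*} [Fintype ι] [DecidableEq ι] {χ : ι → (A →ₐ[k] k)} {a : ι → A}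

theorem Spectral.act_eq (h : X.Spectral χ a) (b : A) : X.act b = ∑ i, χ i b • X.act (a i) := by
  have h1 := congrArg Karoubi.Hom.f (h.y_eq b)
  exact h1.trans (Karoubi.sum_hom _ _)

theorem Spectral.act_one (h : X.Spectral χ a) : X.act 1 = ∑ i, X.act (a i) := by
  rw [h.act_eq]
  simp

theorem Spectral.act_mul (h : X.Spectral χ a) (i j : ι) :
    X.act (a i * a j) = if i = j then X.act (a i) else 0 := by
  rw [h.act_eq]
  simp only [map_mul, h.dual]
  split_ifs with hij
  · subst hij
    simp
  · refine Finset.sum_eq_zero fun m _ => ?_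
    by_cases him : i = m
    · subst him
      rw [if_neg (Ne.symm hij), mul_zero, zero_smul]
    · rw [if_neg him, zero_mul, zero_smul]

/-- At almost all `n`, the operators of the elements `a i` are commuting projections. -/
theorem Spectral.slices (h : X.Spectral χ a) : Almost fun n =>
    (∀ i j x, slice ht n (X.act (a i)) x * slice ht n (X.act (a j)) x =
      if i = j then slice ht n (X.act (a i)) x else 0) ∧
    (∀ i j x y, slice ht n (X.act (a i)) x * slice ht n (X.act (a j)) y =
      slice ht n (X.act (a j)) y * slice ht n (X.act (a i)) x) := by
  have h1 : Almost fun n => ∀ i j x, slice ht n (X.act (a i)) x * slice ht n (X.act (a j)) x =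
      slice ht n (X.act (a j * a i)) x :=
    eventually_all.2 fun i => eventually_all.2 fun j => X.slice_mul_slice ht _ _
  have h2 : Almost fun n => ∀ i j x y, slice ht n (X.act (a i)) y * slice ht n (X.act (a j)) x =
      slice ht n (X.act (a j)) x * slice ht n (X.act (a i)) y :=
    eventually_all.2 fun i => eventually_all.2 fun j => X.slice_comm ht _ _
  filter_upwards [h1, h2] with n h1 h2
  refine ⟨fun i j x => ?_, fun i j x y => h2 i j y x⟩
  rw [h1, h.act_mul]
  by_cases hij : i = j
  · subst hij
    simp
  · rw [if_neg (Ne.symm hij), if_neg hij]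
    funext p q
    exact congrFun (congrFun (real_zero ht n) _) q

/-- A nonzero morphism `f : [V] → X` such that, for all injections `e`, the copy of `A` with the number `e v`
acts on `f(e)` through the character with the number `κ v`. -/
structure IsColoured (X : RepWreath A t) (a : ι → A) (f : single t V ⟶ X.obj.X) (κ : V → ι) :
    Prop where
  ne_zero : f ≠ 0
  comp_p : f ≫ X.obj.p = f
  move_eq : ∀ v i, X.moveSome f v (a i) = if κ v = i then f else 0

theorem row_zero (n : ℕ) (e : V ↪ Fin n) : row ht n (0 : single t V ⟶ O) e = 0 :=
  congrFun (real_zero ht n) _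

theorem row_move_some (f : single t V ⟶ X.obj.X) (v : V) (b : A) : Almost fun n =>
    ∀ e : V ↪ Fin n, row ht n (X.moveSome f v b) e =
      row ht n f e ᵥ* slice ht n (X.act b) (e v) :=
  X.row_move ht f (some v) b

theorem row_move_none (f : single t V ⟶ X.obj.X) (b : A) : Almost fun n =>
    ∀ e : Option V ↪ Fin n, row ht n (X.moveNone f b) e =
      row ht n f (Function.Embedding.some.trans e) ᵥ* slice ht n (X.act b) (e none) :=
  X.row_move ht f none b

theorem IsColoured.row_eq {f : single t V ⟶ X.obj.X} {κ : V → ι} (hf : X.IsColoured a f κ) :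
    Almost fun n => ∀ v i (e : V ↪ Fin n), row ht n f e ᵥ* slice ht n (X.act (a i)) (e v) =
      if κ v = i then row ht n f e else 0 := by
  refine eventually_all.2 fun v => eventually_all.2 fun i => ?_
  filter_upwards [row_move_some ht f v (a i)] with n h e
  rw [← h]
  have h1 : (X.moveSome f v (a i)) = if κ v = i then f else 0 :=
    hf.move_eq v i
  rw [h1]
  split_ifs
  · rfl
  · exact row_zero ht n e

theorem isColoured_of_row {f : single t V ⟶ X.obj.X} {κ : V → ι} (h0 : f ≠ 0)
    (hp : f ≫ X.obj.p = f)
    (h : ∀ v i, Almost fun n => ∀ (e : V ↪ Fin n),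
      row ht n f e ᵥ* slice ht n (X.act (a i)) (e v) = if κ v = i then row ht n f e else 0) :
    X.IsColoured a f κ := by
  refine ⟨h0, hp, fun v i => ?_⟩
  refine eq_of_row (V := V) ht ?_
  filter_upwards [row_move_some ht f v (a i), h v i] with n h1 h2 e
  refine (h1 e).trans ((h2 e).trans ?_)
  split_ifs
  · rfl
  · exact (row_zero ht n e).symm

include ht in
/-- Every nonzero morphism `[V] → X` has a component whose points have colours. -/
theorem exists_isColoured (h : X.Spectral χ a) {f : single t V ⟶ X.obj.X} (h0 : f ≠ 0)
    (hp : f ≫ X.obj.p = f) : ∃ (g : single t V ⟶ X.obj.X) (κ : V → ι), X.IsColoured a g κ := by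
  classical
  have key : ∀ S : Finset V, ∃ (g : single t V ⟶ X.obj.X) (κ : V → ι), g ≠ 0 ∧ g ≫ X.obj.p = g ∧
      ∀ v ∈ S, ∀ i, Almost fun n => ∀ (e : V ↪ Fin n),
        row ht n g e ᵥ* slice ht n (X.act (a i)) (e v) = if κ v = i then row ht n g e else 0 := by
    intro S
    induction S using Finset.induction_on with
    | empty =>
      have : Nonempty ι := by
        by_contra hemp
        rw [not_nonempty_iff] at hemp
        have h1 := h.act_one
        rw [Finset.univ_eq_empty, Finset.sum_empty] at h1
        -- `1` acts as `0` and as the identity, at a point of `V` or, for empty `V`, at a point of `1, …, n`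
        by_cases hV : IsEmpty V
        · refine h0 (eq_of_row ht ?_)
          filter_upwards [row_comp ht f X.obj.p, eventually_hyperfilter_of_ge 1 fun _ h => h]
            with n h2 hn e
          rw [hp] at h2
          have h3 := slice_sMap ht n X.obj.p ⟨0, hn⟩
          rw [← X.act_one, h1] at h3
          rw [h2, ← h3, row_zero]
          have h4 : slice ht n (0 : hObj X.obj.X ⟶ X.obj.X) ⟨0, hn⟩ = 0 := by
            funext p q
            exact congrFun (congrFun (real_zero ht n) _) q
          rw [h4, Matrix.vecMul_zero]
        · rw [not_isEmpty_iff] at hV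
          obtain ⟨v⟩ := hV
          refine h0 ((compAt_sMap_some f v).symm.trans ?_)
          rw [← X.move_one hp, move, h1, Limits.comp_zero]
          rfl
      exact ⟨f, fun _ => this.some, h0, hp, fun v hv => absurd hv (Finset.notMem_empty v)⟩
    | insert v S hv ih =>
      obtain ⟨g, κ, hg0, hgp, hg⟩ := ih
      have h1 : g = ∑ i, (X.moveSome g v (a i)) := by
        refine (compAt_sMap_some g v).symm.trans ?_
        rw [← X.move_one hgp, move, h.act_one, Preadditive.comp_sum]
        exact compAt_sum _ _ _
      obtain ⟨i₀, hi₀⟩ : ∃ i, (X.moveSome g v (a i)) ≠ 0 := by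
        by_contra hcon
        push Not at hcon
        exact hg0 (h1.trans (Finset.sum_eq_zero fun i _ => hcon i))
      refine ⟨X.moveSome g v (a i₀), Function.update κ v i₀, hi₀,
        X.move_comp_p g (some v) (a i₀), fun w hw i => ?_⟩
      by_cases hwv : w = v
      · subst hwv
        rw [Function.update_self]
        filter_upwards [row_move_some ht g w (a i₀), h.slices ht] with n h2 h3 e
        rw [h2, Matrix.vecMul_vecMul, h3.1]
        split_ifs
        · rfl
        · rw [Matrix.vecMul_zero]
      · rw [Function.update_of_ne hwv]
        filter_upwards [row_move_some ht g v (a i₀), h.slices ht,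
          hg w ((Finset.mem_insert.1 hw).resolve_left hwv) i] with n h2 h3 h4 e
        rw [h2, Matrix.vecMul_vecMul, h3.2, ← Matrix.vecMul_vecMul, h4]
        split_ifs
        · rfl
        · rw [Matrix.zero_vecMul]
  obtain ⟨g, κ, hg0, hgp, hg⟩ := key Finset.univ
  exact ⟨g, κ, isColoured_of_row ht hg0 hgp fun v i => hg v (Finset.mem_univ v) i⟩

include ht in
/-- A new point gets a colour. -/
theorem IsColoured.grow (h : X.Spectral χ a) {f : single t V ⟶ X.obj.X} {κ : V → ι}
    (hf : X.IsColoured a f κ) {i₀ : ι}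
    (h0 : (X.moveNone f (a i₀)) ≠ 0) :
    X.IsColoured a (X.moveNone f (a i₀))
      (fun c => c.elim i₀ κ) := by
  refine isColoured_of_row ht h0 (X.move_comp_p f none (a i₀)) fun c i => ?_
  rcases c with _ | v
  · filter_upwards [row_move_none ht f (a i₀), h.slices ht] with n h2 h3 e
    rw [h2, Matrix.vecMul_vecMul, h3.1, Option.elim_none]
    split_ifs
    · rfl
    · rw [Matrix.vecMul_zero]
  · filter_upwards [row_move_none ht f (a i₀), h.slices ht, hf.row_eq ht] with n h2 h3 h4 e
    have h5 := h4 v i (Function.Embedding.some.trans e)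
    rw [h2, Matrix.vecMul_vecMul, h3.2, ← Matrix.vecMul_vecMul, Option.elim_some]
    refine (congrArg (· ᵥ* slice ht n (X.act (a i₀)) (e none)) h5).trans ?_
    split_ifs
    · rfl
    · rw [Matrix.zero_vecMul]

include ht in
/-- If `X` is made of sets with at most `d` points, then at most `d` points of a coloured morphism have the
colour `i`, or at most `d` points have other colours. -/
theorem IsColoured.bound {f : single t V ⟶ X.obj.X} {κ : V → ι}
    (hf : X.IsColoured a f κ) {d : ℕ} (hd : ∀ i, Fintype.card (X.obj.X.X i).carrier ≤ d)
    (i : ι) {b c : Fin (d + 1) → V} (hb : ∀ s, κ (b s) = i) (hc : ∀ s, κ (c s) ≠ i)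
    (hbi : Function.Injective b) (hci : Function.Injective c) : False := by
  refine Eventually.exists (f := (hyperfilter ℕ : Filter ℕ)) (p := fun _ => False) ?_ |>.choose_spec
  filter_upwards [hf.row_eq ht, real_ne_zero ht hf.ne_zero] with n h1 h2
  obtain ⟨e, he⟩ : ∃ e : V ↪ Fin n, row ht n f e ≠ 0 := by
    by_contra hcon
    push Not at hcon
    refine h2 (funext fun ⟨_, e⟩ => hcon e)
  refine weight_bound hd (fun j => slice ht n (X.act (a i)) j)
    (fun σ j p q => slice_perm ht n _ σ j p q) he (b := fun s => e (b s)) (c := fun s => e (c s))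
    (fun r s h => ?_) (e.injective.comp hbi) (e.injective.comp hci) (fun s => ?_) (fun s => ?_)
  · exact hc s (by rw [← e.injective h, hb])
  · rw [h1, if_pos (hb s)]
  · rw [h1, if_neg (hc s)]

include ht in
/-- There is a coloured morphism `f : [V] → X` such that all points outside of `V` have the same colour:
otherwise, points of at least two colours could be added again and again. -/
theorem exists_total (h : X.Spectral χ a) (h0 : X.obj.p ≠ 0) :
    ∃ (V : Type) (_ : Fintype V) (f : single t V ⟶ X.obj.X) (κ : V → ι) (i₀ : ι),
      X.IsColoured a f κ ∧
      ∀ i, i ≠ i₀ → (X.moveNone f (a i)) = 0 := by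
  classical
  by_contra hcon
  push Not at hcon
  obtain ⟨j, hj⟩ : ∃ j, (fun _ => X.obj.p j : single t (X.obj.X.X j).carrier ⟶ X.obj.X) ≠ 0 := by
    by_contra hc
    push Not at hc
    exact h0 (funext fun j => congrFun (hc j) ())
  obtain ⟨f₀, κ₀, hf₀⟩ := exists_isColoured ht h hj (by
    funext _ i
    exact congrFun (congrFun X.obj.idem j) i)
  obtain ⟨d, hd⟩ : ∃ d, ∀ i, Fintype.card (X.obj.X.X i).carrier ≤ d :=
    ⟨Finset.univ.sup fun i => Fintype.card (X.obj.X.X i).carrier, fun i =>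
      Finset.le_sup (f := fun i => Fintype.card (X.obj.X.X i).carrier) (Finset.mem_univ i)⟩
  have : Nonempty ι := by
    by_contra hemp
    rw [not_nonempty_iff] at hemp
    by_cases hV : IsEmpty (X.obj.X.X j).carrier
    · have h1 := h.act_one
      rw [Finset.univ_eq_empty, Finset.sum_empty] at h1
      -- without characters, `1` acts as `0`, but each of the points `1, …, n` acts by the identity
      refine h0 (eq_of_real ht ?_)
      filter_upwards [eventually_hyperfilter_of_ge 1 fun _ h => h] with n hn
      have h3 := slice_sMap ht n X.obj.p ⟨0, hn⟩
      rw [← X.act_one, h1] at h3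
      rw [← h3, real_zero]
      funext p q
      exact congrFun (congrFun (real_zero ht n) _) q
    · rw [not_isEmpty_iff] at hV
      exact hemp.elim (κ₀ hV.some)
  -- points can be added until one colour `i` occurs `d + 1` times
  have hA : ∀ m : ℕ, ∃ (V : Type) (_ : Fintype V) (f : single t V ⟶ X.obj.X) (κ : V → ι),
      X.IsColoured a f κ ∧ m ≤ Fintype.card V := by
    intro m
    induction m with
    | zero => exact ⟨_, inferInstance, f₀, κ₀, hf₀, Nat.zero_le _⟩
    | succ m ih =>
      obtain ⟨V, _, f, κ, hf, hm⟩ := ih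
      obtain ⟨i, -, hi⟩ := hcon V inferInstance f κ this.some hf
      exact ⟨Option V, inferInstance, _, _, hf.grow ht h hi, by
        rw [Fintype.card_option]; omega⟩
  obtain ⟨V, _, f, κ, hf, hcard⟩ := hA (Fintype.card ι * d + 1)
  obtain ⟨i, hi⟩ := Fintype.exists_lt_card_fiber_of_mul_lt_card κ
    (n := d) (by omega)
  -- from then on, points of colours other than `i` can be added until there are `d + 1` of these
  have hB : ∀ r : ℕ, ∃ (V : Type) (_ : Fintype V) (f : single t V ⟶ X.obj.X) (κ : V → ι)
      (b : Fin (d + 1) → V) (c : Fin r → V), X.IsColoured a f κ ∧ (∀ s, κ (b s) = i) ∧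
      (∀ s, κ (c s) ≠ i) ∧ Function.Injective b ∧ Function.Injective c := by
    intro r
    induction r with
    | zero =>
      let S := Finset.univ.filter fun v => κ v = i
      let b : Fin (d + 1) ↪ S := (Function.Embedding.nonempty_of_card_le (by
        rw [Fintype.card_fin, Fintype.card_coe]; exact hi)).some
      exact ⟨V, inferInstance, f, κ, fun s => (b s).1, Fin.elim0, hf,
        fun s => (Finset.mem_filter.1 (b s).2).2, fun s => s.elim0,
        Subtype.val_injective.comp b.injective, fun s => s.elim0⟩
    | succ r ih =>
      obtain ⟨V, _, f, κ, b, c, hf, hb, hc, hbi, hci⟩ := ih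
      obtain ⟨i', hne, hi'⟩ := hcon V inferInstance f κ i hf
      refine ⟨Option V, inferInstance, _, _, fun s => some (b s), Fin.cons none fun s => some (c s),
        hf.grow ht h hi', hb, fun s => ?_, (Option.some_injective V).comp hbi, ?_⟩
      · refine Fin.cases ?_ (fun s => ?_) s
        · exact hne
        · exact hc s
      · rw [Fin.cons_injective_iff]
        refine ⟨?_, (Option.some_injective V).comp hci⟩
        rintro ⟨s, hs⟩
        cases hs
  obtain ⟨V, _, f, κ, b, c, hf, hb, hc, hbi, hci⟩ := hB (d + 1)
  exact hf.bound ht hd i hb hc hbi hci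

end RepWreath
end Vectors

/-! ### Representations of finite groups -/

section FiniteGroups

universe u
variable {k : Type u} [Field k] {G : Type} [Group G]

/-- A linear map that commutes with the actions, as a morphism. -/
def homOfLinear {V W : FDRep k G} (L : V →ₗ[k] W) (h : ∀ g, L ∘ₗ V.ρ g = W.ρ g ∘ₗ L) : V ⟶ W :=
  ⟨FGModuleCat.ofHom L, fun g => by
    refine InducedCategory.hom_ext (ModuleCat.hom_ext ?_)
    exact h g⟩

theorem hom_comm {V W : FDRep k G} (f : V ⟶ W) (g : G) :
    f.hom.hom.hom ∘ₗ V.ρ g = W.ρ g ∘ₗ f.hom.hom.hom :=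
  congrArg (fun x => x.hom.hom) (f.comm g)

theorem linear_eq_smul [IsAlgClosed k] {V : FDRep k G} [Simple V] (L : V →ₗ[k] V)
    (h : ∀ g, L ∘ₗ V.ρ g = V.ρ g ∘ₗ L) : ∃ c : k, L = c • LinearMap.id := by
  have h1 := finrank_endomorphism_simple_eq_one k V
  obtain ⟨c, hc⟩ := (finrank_eq_one_iff_of_nonzero' (𝟙 V) (id_nonzero V)).1 h1 (homOfLinear L h)
  exact ⟨c, (congrArg (fun f : V ⟶ V => f.hom.hom.hom) hc).symm⟩

theorem nonempty_iso_of_linear {V W : FDRep k G} [Simple V] [Simple W] {L : V →ₗ[k] W}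
    (h : ∀ g, L ∘ₗ V.ρ g = W.ρ g ∘ₗ L) (h0 : L ≠ 0) : Nonempty (V ≅ W) := by
  have : homOfLinear L h ≠ 0 := fun h1 =>
    h0 (congrArg (fun f : V ⟶ W => f.hom.hom.hom) h1)
  have := isIso_of_hom_simple this
  exact ⟨asIso (homOfLinear L h)⟩

theorem simple_of_isIrreducible {V : FDRep k G}
    (h : Representation.IsIrreducible (k := k) V.ρ) : Simple V := by
  have hn : Nontrivial V := by
    by_contra hn
    rw [not_nontrivial_iff_subsingleton] at hn
    obtain ⟨S, T, hST⟩ := exists_pair_ne (Subrepresentation (V.ρ : Representation k G V))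
    exact hST (SetLike.ext fun x => by
      rw [Subsingleton.elim x 0]
      exact iff_of_true S.toSubmodule.zero_mem T.toSubmodule.zero_mem)
  refine ⟨fun {W} f _ => ⟨fun hf h0 => ?_, fun h0 => ?_⟩⟩
  · obtain ⟨v, hv⟩ := exists_ne (0 : V)
    have h1 : 𝟙 V = 0 := by
      rw [← IsIso.inv_hom_id f]
      exact (congrArg (fun g => inv f ≫ g) h0).trans Limits.comp_zero
    exact hv (congrArg (fun f : V ⟶ V => f.hom.hom.hom v) h1)
  · let L : W →ₗ[k] V := f.hom.hom.hom
    have hL : ∀ g w, L (W.ρ g w) = V.ρ g (L w) := fun g w => DFunLike.congr_fun (hom_comm f g) w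
    let K : Subrepresentation (W.ρ : Representation k G W) :=
      ⟨LinearMap.ker L, fun g w hw => by
        rw [LinearMap.mem_ker] at hw ⊢
        exact (hL g w).trans (by rw [hw, map_zero])⟩
    let κ : FDRep.of K.toRepresentation ⟶ W := homOfLinear K.toSubmodule.subtype fun _ => rfl
    have hκ : κ ≫ f = 0 := by
      refine Action.Hom.ext (InducedCategory.hom_ext (ModuleCat.hom_ext (LinearMap.ext fun v => ?_)))
      exact v.2
    have hκ0 : κ = 0 := (cancel_mono f).1 (hκ.trans Limits.zero_comp.symm)
    have hinj : Function.Injective L := by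
      rw [← LinearMap.ker_eq_bot, LinearMap.ker_eq_bot']
      intro w hw
      exact congrArg (fun f : FDRep.of K.toRepresentation ⟶ W => f.hom.hom.hom ⟨w, hw⟩) hκ0
    let S : Subrepresentation (V.ρ : Representation k G V) :=
      ⟨LinearMap.range L, by
        rintro g _ ⟨w, rfl⟩
        exact ⟨W.ρ g w, hL g w⟩⟩
    have hsurj : Function.Surjective L := by
      rcases h.eq_bot_or_eq_top S with hS | hS
      · refine absurd ?_ h0
        refine Action.Hom.ext (InducedCategory.hom_ext (ModuleCat.hom_ext
          (LinearMap.ext fun w => ?_)))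
        have h2 : L w ∈ S := ⟨w, rfl⟩
        rw [hS] at h2
        exact h2
      · intro v
        have h2 : v ∈ S := hS ▸ trivial
        exact h2
    let E := LinearEquiv.ofBijective L ⟨hinj, hsurj⟩
    have hE : ∀ g v, E.symm (V.ρ g v) = W.ρ g (E.symm v) := by
      intro g v
      rw [LinearEquiv.symm_apply_eq]
      refine Eq.symm ((hL g _).trans ?_)
      exact congrArg (V.ρ g) (E.apply_symm_apply v)
    refine ⟨⟨homOfLinear E.symm.toLinearMap fun g => LinearMap.ext (hE g), ?_, ?_⟩⟩
    · refine Action.Hom.ext (InducedCategory.hom_ext (ModuleCat.hom_ext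
        (LinearMap.ext fun w => ?_)))
      exact E.symm_apply_apply w
    · refine Action.Hom.ext (InducedCategory.hom_ext (ModuleCat.hom_ext
        (LinearMap.ext fun w => ?_)))
      exact E.apply_symm_apply w

/-- The matrix of an element in the chosen basis. -/
noncomputable def repMatrix (V : FDRep k G) (g : G) :
    Matrix (Fin (Module.finrank k V)) (Fin (Module.finrank k V)) k :=
  LinearMap.toMatrix (Module.finBasis k V) (Module.finBasis k V) (V.ρ g)

/-- The matrix coefficients of the simple representations span all functions: this is the decomposition
of the representations into simple ones. -/
theorem coefficient_mem_span [Fintype G] [CharZero k] (m : ℕ) (V : FDRep k G)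
    (hm : Module.finrank k V = m) (ℓ : V →ₗ[k] k) (v : V) :
    (fun g => ℓ (V.ρ g v)) ∈ Submodule.span k
      {φ : G → k | ∃ (M : FDRep k G) (_ : Simple M) (x y : _), φ = fun g => repMatrix M g x y} := by
  induction m using Nat.strong_induction_on generalizing V with
  | _ m ih =>
    by_cases hV : Representation.IsIrreducible (k := k) V.ρ
    · have := simple_of_isIrreducible hV
      have h1 : (fun g => ℓ (V.ρ g v)) = ∑ y, ∑ x,
          ((Module.finBasis k V).repr v y * ℓ (Module.finBasis k V x)) •
            fun g => repMatrix V g x y := by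
        funext g
        simp only [Finset.sum_apply, Pi.smul_apply, smul_eq_mul]
        conv_lhs => rw [← (Module.finBasis k V).sum_repr v]
        simp only [map_sum, map_smul, smul_eq_mul]
        refine Finset.sum_congr rfl fun y _ => ?_
        conv_lhs => rw [← (Module.finBasis k V).sum_repr (V.ρ g (Module.finBasis k V y))]
        rw [map_sum, Finset.mul_sum]
        refine Finset.sum_congr rfl fun x _ => ?_
        rw [map_smul, repMatrix, LinearMap.toMatrix_apply, smul_eq_mul]
        ring
      rw [h1]
      refine Submodule.sum_mem _ fun y _ => Submodule.sum_mem _ fun x _ =>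
        Submodule.smul_mem _ _ (Submodule.subset_span ⟨V, this, x, y, rfl⟩)
    · rcases subsingleton_or_nontrivial V with hs | hn
      · have : (fun g => ℓ (V.ρ g v)) = 0 := funext fun g => by
          rw [Subsingleton.elim (V.ρ g v) 0, map_zero]; rfl
        rw [this]
        exact Submodule.zero_mem _
      · obtain ⟨S, hS0, hS1⟩ : ∃ S : Subrepresentation (V.ρ : Representation k G V),
            S ≠ ⊥ ∧ S ≠ ⊤ := by
          by_contra hcon
          push Not at hcon
          refine hV { exists_pair_ne := ⟨⊥, ⊤, fun h => ?_⟩, eq_bot_or_eq_top := fun S => ?_ }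
          · obtain ⟨w, hw⟩ := exists_ne (0 : V)
            have : w ∈ (⊤ : Subrepresentation (V.ρ : Representation k G V)) := trivial
            rw [← h] at this
            exact hw this
          · exact or_iff_not_imp_left.2 (hcon S)
        obtain ⟨T, hT⟩ := exists_isCompl S
        have hST : IsCompl S.toSubmodule T.toSubmodule := by
          constructor
          · rw [disjoint_iff, ← Subrepresentation.toSubmodule_inf, hT.inf_eq_bot]; rfl
          · rw [codisjoint_iff, ← Subrepresentation.toSubmodule_sup, hT.sup_eq_top]; rfl
        have hS0' : S.toSubmodule ≠ ⊥ := fun h => hS0 (Subrepresentation.toSubmodule_injective h)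
        have hS1' : S.toSubmodule ≠ ⊤ := fun h => hS1 (Subrepresentation.toSubmodule_injective h)
        have hlt : Module.finrank k S.toSubmodule < m := hm ▸ Submodule.finrank_lt hS1'
        have hlt' : Module.finrank k T.toSubmodule < m := by
          have h2 := Submodule.finrank_add_eq_of_isCompl hST
          have h3 : 0 < Module.finrank k S.toSubmodule := by
            rw [Nat.pos_iff_ne_zero]
            exact fun h => hS0' (Submodule.finrank_eq_zero.1 h)
          omega
        have hv : v ∈ S.toSubmodule ⊔ T.toSubmodule := hST.sup_eq_top ▸ Submodule.mem_top
        obtain ⟨a, ha, b, hb, rfl⟩ := Submodule.mem_sup.1 hv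
        have h1 := ih _ hlt (FDRep.of S.toRepresentation) rfl (ℓ ∘ₗ S.toSubmodule.subtype) ⟨a, ha⟩
        have h2 := ih _ hlt' (FDRep.of T.toRepresentation) rfl (ℓ ∘ₗ T.toSubmodule.subtype) ⟨b, hb⟩
        have h3 := Submodule.add_mem _ h1 h2
        convert h3 using 1
        funext g
        exact (congrArg ℓ (map_add (V.ρ g) a b)).trans (map_add ℓ _ _)

/-- The function that is `1` at the unit element and `0` elsewhere is a linear combination of matrix
coefficients of simple representations. -/
theorem exists_delta_eq_sum [Fintype G] [DecidableEq G] [CharZero k] :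
    ∃ (m : ℕ) (c : Fin m → k) (M : Fin m → FDRep k G) (x y : ∀ r, Fin (Module.finrank k (M r))),
      (∀ r, Simple (M r)) ∧
      ∀ g : G, (if g = 1 then 1 else 0 : k) = ∑ r, c r * repMatrix (M r) g (x r) (y r) := by
  let ρ : Representation k G (G → k) :=
    { toFun g := LinearMap.funLeft k k (fun h => h * g)
      map_one' := by ext; simp [LinearMap.funLeft]
      map_mul' a b := by ext; simp [LinearMap.funLeft, mul_assoc] }
  have h1 := coefficient_mem_span _ (FDRep.of ρ) rfl (LinearMap.proj (1 : G))
    (fun g : G => if g = 1 then 1 else 0)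
  rw [Submodule.mem_span_set'] at h1
  obtain ⟨m, c, φ, hφ⟩ := h1
  choose M hM x y hxy using fun r => (φ r).2
  refine ⟨m, c, M, x, y, hM, fun g => ?_⟩
  have h2 := congrFun hφ g
  rw [Finset.sum_apply] at h2
  have h3 : (if g = 1 then 1 else 0 : k) = if 1 * g = 1 then 1 else 0 := by rw [one_mul]
  refine h3.trans (h2.symm.trans (Finset.sum_congr rfl fun r _ => ?_))
  rw [Pi.smul_apply, hxy r]
  rfl

/-- The linear map of a matrix that intertwines two representations. -/
theorem toLin_comm {H : Type} [Group H] {V : FDRep k G} {W : FDRep k H}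
    (B : Matrix (Fin (Module.finrank k W)) (Fin (Module.finrank k V)) k) {g : G} {h : H}
    (hB : B * repMatrix V g = repMatrix W h * B) :
    Matrix.toLin (Module.finBasis k V) (Module.finBasis k W) B ∘ₗ V.ρ g =
      W.ρ h ∘ₗ Matrix.toLin (Module.finBasis k V) (Module.finBasis k W) B := by
  apply (LinearMap.toMatrix (Module.finBasis k V) (Module.finBasis k W)).injective
  rw [LinearMap.toMatrix_comp _ (Module.finBasis k V), LinearMap.toMatrix_comp _
    (Module.finBasis k W), LinearMap.toMatrix_toLin]
  exact hB

theorem matrix_eq_smul [IsAlgClosed k] {V : FDRep k G} [Simple V]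
    {B : Matrix (Fin (Module.finrank k V)) (Fin (Module.finrank k V)) k}
    (hB : ∀ g, B * repMatrix V g = repMatrix V g * B) : ∃ c : k, B = c • 1 := by
  obtain ⟨c, hc⟩ := linear_eq_smul _ fun g => toLin_comm B (hB g)
  refine ⟨c, ?_⟩
  have h := congrArg (LinearMap.toMatrix (Module.finBasis k V) (Module.finBasis k V)) hc
  rwa [LinearMap.toMatrix_toLin, map_smul, LinearMap.toMatrix_id] at h

end FiniteGroups

section Tensor

universe u
variable {k : Type u} [Field k] {l : ℕ} {n : Fin l → ℕ}
  (M : ∀ j, FDRep k (Equiv.Perm (Fin (n j))))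

theorem tensorMatrix_apply (σ : ∀ j, Equiv.Perm (Fin (n j)))
    (x y : ∀ j, Fin (Module.finrank k (M j))) :
    tensorMatrix M σ x y = ∏ j, repMatrix (M j) (σ j) (x j) (y j) := rfl

theorem tensorMatrix_mulSingle (j : Fin l) (τ : Equiv.Perm (Fin (n j)))
    (x y : ∀ j, Fin (Module.finrank k (M j))) :
    tensorMatrix M (Pi.mulSingle j τ) x y =
      if Function.update x j (y j) = y then repMatrix (M j) τ (x j) (y j) else 0 := by
  have h1 : ∀ i, i ≠ j → repMatrix (M i) ((Pi.mulSingle j τ : ∀ j, Equiv.Perm (Fin (n j))) i)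
      (x i) (y i) = if x i = y i then 1 else 0 := by
    intro i hi
    rw [Pi.mulSingle_eq_of_ne hi, repMatrix, map_one]
    exact (congrFun (congrFun (LinearMap.toMatrix_one _) _) _).trans (Matrix.one_apply)
  rw [tensorMatrix_apply, ← Finset.mul_prod_erase _ _ (Finset.mem_univ j), Pi.mulSingle_eq_same]
  split_ifs with h
  · rw [Finset.prod_eq_one, mul_one]
    intro i hi
    have hi' := Finset.ne_of_mem_erase hi
    rw [h1 i hi', if_pos]
    rw [← congrFun h i, Function.update_of_ne hi']
  · obtain ⟨i, hi⟩ := Function.ne_iff.1 h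
    have hij : i ≠ j := by
      rintro rfl
      rw [Function.update_self] at hi
      exact hi rfl
    rw [Function.update_of_ne hij] at hi
    rw [Finset.prod_eq_zero (Finset.mem_erase.2 ⟨hij, Finset.mem_univ i⟩), mul_zero]
    rw [h1 i hij, if_neg hi]

theorem sum_tensorMatrix_left {E : Type*} [AddCommGroup E] [Module k E] (j : Fin l)
    (τ : Equiv.Perm (Fin (n j))) (x : ∀ j, Fin (Module.finrank k (M j)))
    (F : (∀ j, Fin (Module.finrank k (M j))) → E) :
    ∑ z, tensorMatrix M (Pi.mulSingle j τ) x z • F z =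
      ∑ c, repMatrix (M j) τ (x j) c • F (Function.update x j c) := by
  refine (Fintype.sum_of_injective (fun c => Function.update x j c)
    (Function.update_injective x j) _ _ (fun z hz => ?_) fun c => ?_).symm
  · rw [tensorMatrix_mulSingle, if_neg, zero_smul]
    exact fun h => hz ⟨z j, h⟩
  · rw [tensorMatrix_mulSingle, Function.update_self, if_pos rfl]

theorem sum_tensorMatrix_right {E : Type*} [AddCommGroup E] [Module k E] (j : Fin l)
    (τ : Equiv.Perm (Fin (n j))) (y : ∀ j, Fin (Module.finrank k (M j)))
    (F : (∀ j, Fin (Module.finrank k (M j))) → E) :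
    ∑ z, tensorMatrix M (Pi.mulSingle j τ) z y • F z =
      ∑ c, repMatrix (M j) τ c (y j) • F (Function.update y j c) := by
  refine (Fintype.sum_of_injective (fun c => Function.update y j c)
    (Function.update_injective y j) _ _ (fun z hz => ?_) fun c => ?_).symm
  · rw [tensorMatrix_mulSingle, if_neg, zero_smul]
    intro h
    refine hz ⟨z j, ?_⟩
    rw [← h]
    simp
  · rw [tensorMatrix_mulSingle, Function.update_self, if_pos]
    simp

/-- Schur's lemma for an outer tensor product of simple representations. -/
theorem tensor_eq_smul [IsAlgClosed k] [hM : ∀ j, Simple (M j)]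
    {L : Matrix (∀ j, Fin (Module.finrank k (M j))) (∀ j, Fin (Module.finrank k (M j))) k}
    (hL : ∀ σ, L * tensorMatrix M σ = tensorMatrix M σ * L) : ∃ c : k, L = c • 1 := by
  have h1 : ∀ j (y x : ∀ j, Fin (Module.finrank k (M j))), ∃ c : k, ∀ a b,
      L (Function.update y j a) (Function.update x j b) = if a = b then c else 0 := by
    intro j y x
    obtain ⟨c, hc⟩ := matrix_eq_smul (V := M j)
      (B := Matrix.of fun a b => L (Function.update y j a) (Function.update x j b)) (by
        intro τ
        ext a b
        have h2 := congrFun (congrFun (hL (Pi.mulSingle j τ)) (Function.update y j a))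
          (Function.update x j b)
        have h3 := sum_tensorMatrix_left M j τ (Function.update y j a)
          fun z => L z (Function.update x j b)
        have h4 := sum_tensorMatrix_right M j τ (Function.update x j b)
          fun z => L (Function.update y j a) z
        simp only [Function.update_self, Function.update_idem, smul_eq_mul] at h3 h4
        rw [Matrix.mul_apply, Matrix.mul_apply] at h2 ⊢
        simp only [Matrix.of_apply]
        simp only [mul_comm] at h2 h3 h4 ⊢
        rw [← h4, ← h3, h2])
    refine ⟨c, fun a b => (congrFun (congrFun hc a) b).trans ?_⟩
    simp [Matrix.one_apply]
  have hne : ∀ y x, y ≠ x → L y x = 0 := by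
    intro y x h
    obtain ⟨j, hj⟩ := Function.ne_iff.1 h
    obtain ⟨c, hc⟩ := h1 j y x
    have := hc (y j) (x j)
    rwa [Function.update_eq_self, Function.update_eq_self, if_neg hj] at this
  have heq : ∀ x y, L x x = L y y := by
    intro x y
    have key : ∀ S : Finset (Fin l), L x x = L (S.piecewise y x) (S.piecewise y x) := by
      intro S
      induction S using Finset.induction_on with
      | empty => rw [Finset.piecewise_empty]
      | insert j S hj ih =>
        obtain ⟨c, hc⟩ := h1 j (S.piecewise y x) (S.piecewise y x)
        rw [ih, Finset.piecewise_insert, hc, if_pos rfl]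
        have := hc (S.piecewise y x j) (S.piecewise y x j)
        rwa [Function.update_eq_self, if_pos rfl] at this
    have := key Finset.univ
    rwa [Finset.piecewise_univ] at this
  by_cases hemp : IsEmpty (∀ j, Fin (Module.finrank k (M j)))
  · exact ⟨0, Matrix.ext fun y _ => hemp.elim y⟩
  · rw [not_isEmpty_iff] at hemp
    obtain ⟨x₀⟩ := hemp
    refine ⟨L x₀ x₀, Matrix.ext fun y x => ?_⟩
    rw [Matrix.smul_apply, Matrix.one_apply]
    split_ifs with h
    · subst h
      rw [smul_eq_mul, mul_one]
      exact heq _ _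
    · rw [smul_zero]
      exact hne _ _ h

/-- A nonzero matrix that intertwines a tensor product gives a nonzero matrix that intertwines the
factors with the number `j`. -/
theorem exists_factor {l' : ℕ} {n' : Fin l' → ℕ} {M' : ∀ j, FDRep k (Equiv.Perm (Fin (n' j)))}
    {L : Matrix (∀ j, Fin (Module.finrank k (M' j))) (∀ j, Fin (Module.finrank k (M j))) k}
    (h0 : L ≠ 0) (j : Fin l) (j' : Fin l')
    (φ : Equiv.Perm (Fin (n j)) → Equiv.Perm (Fin (n' j')))
    (hL : ∀ τ, L * tensorMatrix M (Pi.mulSingle j τ) =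
      tensorMatrix M' (Pi.mulSingle j' (φ τ)) * L) :
    ∃ B : Matrix (Fin (Module.finrank k (M' j'))) (Fin (Module.finrank k (M j))) k, B ≠ 0 ∧
      ∀ τ, B * repMatrix (M j) τ = repMatrix (M' j') (φ τ) * B := by
  obtain ⟨y, x, hyx⟩ : ∃ y x, L y x ≠ 0 := by
    by_contra hcon
    push Not at hcon
    exact h0 (Matrix.ext hcon)
  refine ⟨Matrix.of fun a b => L (Function.update y j' a) (Function.update x j b), ?_, ?_⟩
  · intro h
    have := congrFun (congrFun h (y j')) (x j)
    rw [Matrix.of_apply, Function.update_eq_self, Function.update_eq_self] at this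
    exact hyx this
  · intro τ
    ext a b
    have h2 := congrFun (congrFun (hL τ) (Function.update y j' a)) (Function.update x j b)
    have h3 := sum_tensorMatrix_left M' j' (φ τ) (Function.update y j' a)
      fun z => L z (Function.update x j b)
    have h4 := sum_tensorMatrix_right M j τ (Function.update x j b)
      fun z => L (Function.update y j' a) z
    simp only [Function.update_self, Function.update_idem, smul_eq_mul] at h3 h4
    rw [Matrix.mul_apply, Matrix.mul_apply] at h2 ⊢
    simp only [Matrix.of_apply]
    simp only [mul_comm] at h2 h3 h4 ⊢
    rw [← h4, ← h3, h2]

/-- For a nonzero function on a product of symmetric groups, one of its sums against the matrix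
coefficients of the simple representations is nonzero. -/
theorem exists_sum_tensorMatrix_ne_zero [CharZero k] [IsAlgClosed k] {E : Type*} [AddCommGroup E]
    [Module k E] (F : (∀ j, Equiv.Perm (Fin (n j))) → E) (h : F 1 ≠ 0) :
    ∃ (M : ∀ j, FDRep k (Equiv.Perm (Fin (n j)))) (x y : ∀ j, Fin (Module.finrank k (M j))),
      (∀ j, Simple (M j)) ∧ ∑ σ, tensorMatrix M σ x y • F σ ≠ 0 := by
  choose m c M x y hM hδ using fun j => exists_delta_eq_sum (k := k) (G := Equiv.Perm (Fin (n j)))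
  by_contra hcon
  push Not at hcon
  apply h
  have h1 : ∀ σ : ∀ j, Equiv.Perm (Fin (n j)), (if σ = 1 then 1 else 0 : k) =
      ∑ r : ∀ j, Fin (m j), (∏ j, c j (r j)) *
        tensorMatrix (fun j => M j (r j)) σ (fun j => x j (r j)) (fun j => y j (r j)) := by
    intro σ
    have h2 : (if σ = 1 then 1 else 0 : k) = ∏ j, if σ j = 1 then 1 else 0 := by
      split_ifs with hσ
      · subst hσ
        simp
      · obtain ⟨j, hj⟩ := Function.ne_iff.1 hσ
        exact (Finset.prod_eq_zero (Finset.mem_univ j) (if_neg hj)).symm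
    rw [h2]
    simp only [hδ, Finset.prod_univ_sum, Fintype.piFinset_univ, Finset.prod_mul_distrib]
    rfl
  calc F 1 = ∑ σ, (if σ = 1 then 1 else 0 : k) • F σ := by simp
    _ = ∑ r : ∀ j, Fin (m j), (∏ j, c j (r j)) • ∑ σ, tensorMatrix (fun j => M j (r j)) σ
          (fun j => x j (r j)) (fun j => y j (r j)) • F σ := by
        simp only [h1, Finset.sum_smul, Finset.smul_sum, mul_smul]
        exact Finset.sum_comm
    _ = 0 := Finset.sum_eq_zero fun r _ => by
        rw [hcon _ _ _ fun j => hM j (r j), smul_zero]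

end Tensor

/-! ### Objects on which the points act through characters -/

section Coloured

open Filter Idempotents Matrix

universe u v
variable {k : Type u} [Field k] [CharZero k] {t : k}

/-- If `n` is large, then every pair of matching points of `U` and `V`, and of points outside of both, occurs
at a number `j ≤ n`. -/
theorem exists_point {U V : Type} [Fintype U] [Fintype V] {n : ℕ} (p : U ↪ Fin n) (q : V ↪ Fin n)
    (hn : Fintype.card (U ⊕ V) < n) {c : Option U} {d : Option V} (h : Matches (glued p q) c d) :
    ∃ j, pos p j = c ∧ pos q j = d := by
  rcases c with _ | u <;> rcases d with _ | v
  · obtain ⟨j, hj⟩ : ∃ j, ∀ x, Sum.elim p q x ≠ j := by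
      by_contra hcon
      push Not at hcon
      have := Fintype.card_le_of_surjective (Sum.elim p q) hcon
      rw [Fintype.card_fin] at this
      omega
    refine ⟨j, Option.eq_none_iff_forall_not_mem.2 fun u hu => ?_,
      Option.eq_none_iff_forall_not_mem.2 fun v hv => ?_⟩
    · exact hj (.inl u) ((mem_pos p j u).1 hu)
    · exact hj (.inr v) ((mem_pos q j v).1 hv)
  · refine ⟨q v, Option.eq_none_iff_forall_not_mem.2 fun u hu => ?_, (mem_pos q _ v).2 rfl⟩
    have h1 : u ∈ (glued p q).symm v := (PEquiv.mem_iff_mem _).2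
      ((mem_glued p q u v).2 ((mem_pos p _ u).1 hu))
    have h2 : (glued p q).symm v = none := h
    rw [h2] at h1
    cases h1
  · refine ⟨p u, (mem_pos p _ u).2 rfl, Option.eq_none_iff_forall_not_mem.2 fun v hv => ?_⟩
    have h1 : v ∈ glued p q u := (mem_glued p q u v).2 ((mem_pos q _ v).1 hv).symm
    have h2 : glued p q u = none := h
    rw [h2] at h1
    cases h1
  · exact ⟨p u, (mem_pos p _ u).2 rfl, (mem_pos q _ v).2 ((mem_glued p q u v).1 h).symm⟩

variable [IsAlgClosed k] (ht : Transcendental ℚ t) {A : Type v} [CommRing A] [Algebra k A]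
  {X Y Z : Mat_ (Deligne₀ t)}

theorem slice_colourMap (κ : Colouring X) (f : X ⟶ Y) : Almost fun n => ∀ j p q,
    slice ht n (colourMap κ f) j p q = spec ht (κ p.1 (pos p.2 j)) n * real ht n f p q := by
  have h : ∀ n (P : Pts n (hObj X)) q, real ht n (colourMap κ f) P q =
      spec ht (κ (hPts n X P).2.1 (pos (hPts n X P).2.2 (hPts n X P).1) *
        (f (hPts n X P).2.1 q.1 : Recollement _ _ → k) (glued (hPts n X P).2.2 q.2)) n := by
    intro n P q
    have h1 : (colourMap κ f P.1 q.1 : Recollement _ _ → k) (glued P.2 q.2) =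
        κ P.1.1 P.1.2 * sKer (f P.1.1 q.1) P.1.2 (glued P.2 q.2) := rfl
    have h2 : κ (hPts n X P).2.1 (pos (hPts n X P).2.2 (hPts n X P).1) = κ P.1.1 P.1.2 :=
      congrArg (κ P.1.1) (pos_hPt P.1.2 P.2)
    rw [h2, real, h1]
    exact congrArg (fun x => spec ht (κ P.1.1 P.1.2 * x) n) (sKer_glued _ P.1.2 P.2 q.2)
  have h2 : Almost fun n => ∀ i c i' E, spec ht (κ i c * (f i i' : Recollement _ _ → k) E) n =
      spec ht (κ i c) n * spec ht ((f i i' : Recollement _ _ → k) E) n :=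
    eventually_all.2 fun i => eventually_all.2 fun c => eventually_all.2 fun i' =>
      eventually_all.2 fun E => spec_mul ht _ _
  filter_upwards [h2] with n h2 j p q
  rw [slice, h, Equiv.apply_symm_apply, h2]
  rfl

include ht in
theorem preservesMat_iff {κ : Colouring X} {f : X ⟶ Y} {κ' : Colouring Y} :
    PreservesMat κ f κ' ↔ hMap f ≫ colourMap κ' (𝟙 Y) = colourMap κ f := by
  constructor
  · intro h
    rw [hMap_colourMap h, Category.comp_id]
  · intro h i i' E hE c d hcd
    refine eq_of_spec ht ?_
    filter_upwards [slice_hMap_comp ht f (colourMap κ' (𝟙 Y)), slice_colourMap ht κ' (𝟙 Y),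
      slice_colourMap ht κ f, spec_ne ht hE, eventually_hyperfilter_of_ge
      (Fintype.card ((X.X i).carrier ⊕ (Y.X i').carrier) + 1) fun _ h => h] with n h1 h2 h3 h4 hn
    obtain ⟨p, q, rfl⟩ := exists_glued_fin E (Nat.le_of_succ_le hn)
    obtain ⟨j, rfl, rfl⟩ := exists_point p q hn hcd
    have h5 := congrFun (congrFun (h1 j) ⟨i, p⟩) ⟨i', q⟩
    rw [h, h3, Matrix.mul_apply, Finset.sum_eq_single ⟨i', q⟩, h2, real_id, Matrix.one_apply_eq,
      mul_one, mul_comm] at h5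
    · rw [spec_zero] at h4
      exact mul_left_cancel₀ h4 h5
    · intro r _ hr
      rw [h2, real_id, Matrix.one_apply_ne hr, mul_zero, mul_zero]
    · exact fun h => absurd (Finset.mem_univ _) h

include ht in
theorem PreservesMat.comp {κ : Colouring X} {f : X ⟶ Y} {κ' : Colouring Y} {g : Y ⟶ Z}
    {κ'' : Colouring Z} (hf : PreservesMat κ f κ') (hg : PreservesMat κ' g κ'') :
    PreservesMat κ (f ≫ g) κ'' := by
  rw [preservesMat_iff ht, ← hMap_comp, Category.assoc, (preservesMat_iff ht).1 hg,
    hMap_colourMap hf]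

variable {N N' : RepS t} {χ : ∀ i, Option (N.X.X i).carrier → (A →ₐ[k] k)}
  {h : ∀ a, PreservesMat (fun i c => χ i c a) N.p (fun i c => χ i c a)}
  {χ' : ∀ i, Option (N'.X.X i).carrier → (A →ₐ[k] k)}
  {h' : ∀ a, PreservesMat (fun i c => χ' i c a) N'.p (fun i c => χ' i c a)}

include ht in
/-- The morphisms of coloured objects are the colour-preserving morphisms. -/
theorem comm_iff_preservesMat (F : N ⟶ N') (a : A) :
    (hFunctor t).map F ≫ (colouredRep N' χ' h').y a = (colouredRep N χ h).y a ≫ F ↔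
      PreservesMat (fun i c => χ i c a) F.f (fun i c => χ' i c a) := by
  have h1 : ((colouredRep N χ h).y a ≫ F).f = colourMap (fun i c => χ i c a) F.f := by
    change colourMap (fun i c => χ i c a) N.p ≫ F.f = _
    rw [colourMap_comp, Karoubi.p_comp]
  have h2 : ((hFunctor t).map F ≫ (colouredRep N' χ' h').y a).f =
      hMap F.f ≫ colourMap (fun i c => χ' i c a) (𝟙 N'.X) := by
    change hMap F.f ≫ colourMap (fun i c => χ' i c a) N'.p = _
    have h3 := hMap_colourMap (h' a) (𝟙 N'.X)
    rw [Category.comp_id] at h3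
    rw [← h3, ← Category.assoc, hMap_comp, Karoubi.comp_p]
  rw [preservesMat_iff ht, ← h1, ← h2]
  exact ⟨congrArg Karoubi.Hom.f, fun h => Karoubi.hom_ext _ _ h⟩

/-- The colour-preserving part of a morphism. -/
noncomputable def colourPart (χ : ∀ i, Option (X.X i).carrier → (A →ₐ[k] k)) (f : X ⟶ X) : X ⟶ X :=
  open Classical in
  fun i j => fun E : Recollement _ _ => if ∀ c d, Matches E c d → χ i c = χ j d then
    (f i j : Recollement _ _ → k) E else (0 : k)

theorem colourPart_preserves (χ : ∀ i, Option (X.X i).carrier → (A →ₐ[k] k)) (f : X ⟶ X) (a : A) :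
    PreservesMat (fun i c => χ i c a) (colourPart χ f) (fun i c => χ i c a) := by
  intro i j E hE c d hcd
  by_contra hne
  refine hE (if_neg fun hall => hne ?_)
  exact congrArg (fun ψ : A →ₐ[k] k => ψ a) (hall c d hcd)

open Classical in
theorem real_colourPart (χ : ∀ i, Option (X.X i).carrier → (A →ₐ[k] k)) (f : X ⟶ X) :
    Almost fun n => ∀ p q, real ht n (colourPart χ f) p q =
      if ∀ j, χ p.1 (pos p.2 j) = χ q.1 (pos q.2 j) then real ht n f p q else 0 := by
  have h1 : Almost fun n => ∀ i j, Fintype.card ((X.X i).carrier ⊕ (X.X j).carrier) < n :=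
    eventually_all.2 fun i => eventually_all.2 fun j => eventually_hyperfilter_of_ge
      (Fintype.card ((X.X i).carrier ⊕ (X.X j).carrier) + 1) fun _ h => h
  filter_upwards [h1] with n h1 p q
  have h2 : (∀ c d, Matches (glued p.2 q.2) c d → χ p.1 c = χ q.1 d) ↔
      ∀ j, χ p.1 (pos p.2 j) = χ q.1 (pos q.2 j) := by
    constructor
    · exact fun h j => h _ _ (matches_glued _ _ _)
    · intro h c d hcd
      obtain ⟨j, rfl, rfl⟩ := exists_point p.2 q.2 (h1 _ _) hcd
      exact h j
  refine (apply_ite (fun c => spec ht c n) _ _ _).trans ?_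
  rw [spec_zero]
  exact if_congr h2 rfl rfl

/-- If a projection `E` satisfies `E D E = E D` for some diagonal matrices `D`, it also does so for their
products. -/
theorem mul_diagonal_prod {P ι : Type*} [Fintype P] [DecidableEq P] {E : Matrix P P k}
    (hE : E * E = E) (d : ι → P → k) (hd : ∀ i, E * Matrix.diagonal (d i) * E = E * Matrix.diagonal (d i))
    (s : Finset ι) : E * Matrix.diagonal (∏ i ∈ s, d i) * E = E * Matrix.diagonal (∏ i ∈ s, d i) := by
  classical
  induction s using Finset.induction_on with
  | empty =>
    have h1 : (Matrix.diagonal 1 : Matrix P P k) = 1 := Matrix.diagonal_one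
    rw [Finset.prod_empty, h1, mul_one, hE]
  | insert i s hi ih =>
    have h1 : (Matrix.diagonal (d i * ∏ i ∈ s, d i) : Matrix P P k) =
        Matrix.diagonal (d i) * Matrix.diagonal (∏ i ∈ s, d i) := by
      rw [diagonal_mul_diagonal]; rfl
    rw [Finset.prod_insert hi, h1, ← mul_assoc]
    conv_lhs => rw [← hd i, mul_assoc (E * Matrix.diagonal (d i)) E, mul_assoc (E * Matrix.diagonal (d i)), ih]
    rw [← mul_assoc, hd i]

include ht in
/-- The projection to a subobject of a coloured object is determined by its colour-preserving part: the
elements of `A` that separate the characters cut out the vectors of a given colour, and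
a subobject is closed under these projections. -/
theorem stable_colourPart {e : N ⟶ N} (he : e ≫ e = e) (hs : (colouredRep N χ h).Stable e) :
    e.f ≫ colourPart χ e.f = e.f ∧ colourPart χ e.f ≫ e.f = colourPart χ e.f := by
  classical
  let ι := Set.range fun x : Σ i, Option (N.X.X i).carrier => χ x.1 x.2
  let _ : Fintype ι := Fintype.ofFinite ι
  obtain ⟨a, ha⟩ := exists_dual (k := k) (A := A) (ι := ι) (χ := Subtype.val) Subtype.val_injective
  have h1 : ∀ b : A, hMap e.f ≫ colourMap (fun i c => χ i c b) e.f =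
      hMap e.f ≫ colourMap (fun i c => χ i c b) (𝟙 N.X) := by
    intro b
    have h2 := congrArg Karoubi.Hom.f (hs b)
    change hMap e.f ≫ colourMap (fun i c => χ i c b) N.p ≫ e.f =
      hMap e.f ≫ colourMap (fun i c => χ i c b) N.p at h2
    rw [colourMap_comp, Karoubi.p_comp] at h2
    have h3 := hMap_colourMap (h b) (𝟙 N.X)
    rw [Category.comp_id] at h3
    rw [h2, ← h3, ← Category.assoc, hMap_comp, Karoubi.comp_p]
  have hee : e.f ≫ e.f = e.f := congrArg Karoubi.Hom.f he
  have h2 : Almost fun n => ∀ (i : ι) j p q,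
      slice ht n (colourMap (fun i' c => χ i' c (a i)) e.f) j p q =
        spec ht (χ p.1 (pos p.2 j) (a i)) n * real ht n e.f p q :=
    eventually_all.2 fun i => slice_colourMap ht (fun i' c => χ i' c (a i)) e.f
  have h3 : Almost fun n => ∀ (i : ι) j p q,
      slice ht n (colourMap (fun i' c => χ i' c (a i)) (𝟙 N.X)) j p q =
        spec ht (χ p.1 (pos p.2 j) (a i)) n * real ht n (𝟙 N.X) p q :=
    eventually_all.2 fun i => slice_colourMap ht (fun i' c => χ i' c (a i)) (𝟙 N.X)
  have h4 : Almost fun n => ∀ (i : ι) j,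
      slice ht n (hMap e.f ≫ colourMap (fun i' c => χ i' c (a i)) e.f) j =
        real ht n e.f * slice ht n (colourMap (fun i' c => χ i' c (a i)) e.f) j :=
    eventually_all.2 fun i => slice_hMap_comp ht _ _
  have h5 : Almost fun n => ∀ (i : ι) j,
      slice ht n (hMap e.f ≫ colourMap (fun i' c => χ i' c (a i)) (𝟙 N.X)) j =
        real ht n e.f * slice ht n (colourMap (fun i' c => χ i' c (a i)) (𝟙 N.X)) j :=
    eventually_all.2 fun i => slice_hMap_comp ht _ _
  have key : Almost fun n => ∀ q : Pts n N.X, ∃ d : Pts n N.X → k,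
      (∀ p, d p = if ∀ j, χ p.1 (pos p.2 j) = χ q.1 (pos q.2 j) then 1 else 0) ∧
      real ht n e.f * Matrix.diagonal d * real ht n e.f = real ht n e.f * Matrix.diagonal d := by
    filter_upwards [h2, h3, h4, h5, real_comp ht e.f e.f] with n h2 h3 h4 h5 h6 q
    let i : Fin n → ι := fun j => ⟨χ q.1 (pos q.2 j), ⟨q.1, pos q.2 j⟩, rfl⟩
    let d : Fin n → Pts n N.X → k := fun j p => spec ht (χ p.1 (pos p.2 j) (a (i j))) n
    have hd : ∀ j p, d j p = if χ p.1 (pos p.2 j) = χ q.1 (pos q.2 j) then 1 else 0 := by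
      intro j p
      have h7 := ha (i j) ⟨χ p.1 (pos p.2 j), ⟨p.1, pos p.2 j⟩, rfl⟩
      refine (congrArg (fun c => spec ht c n) h7).trans ?_
      rw [apply_ite (fun c => spec ht c n), spec_zero, spec_one]
      exact if_congr (Subtype.ext_iff.trans eq_comm) rfl rfl
    refine ⟨∏ j, d j, fun p => ?_, mul_diagonal_prod (by rw [← h6, hee]) d (fun j => ?_) _⟩
    · rw [Finset.prod_apply]
      simp only [hd, Finset.prod_boole, Finset.mem_univ, true_imp_iff]
    · have h7 : slice ht n (colourMap (fun i' c => χ i' c (a (i j))) e.f) j =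
          Matrix.diagonal (d j) * real ht n e.f := by
        ext p r
        rw [h2, diagonal_mul]
      have h8 : slice ht n (colourMap (fun i' c => χ i' c (a (i j))) (𝟙 N.X)) j =
          Matrix.diagonal (d j) := by
        ext p r
        rw [h3, real_id, ← mul_one (Matrix.diagonal (d j)), diagonal_mul]
      have h9 := h4 (i j) j
      rw [h1, h5, h7, h8, ← mul_assoc] at h9
      exact h9.symm
  constructor
  · refine eq_of_real ht ?_
    filter_upwards [key, real_colourPart ht χ e.f, real_comp ht e.f (colourPart χ e.f)]
      with n h6 h7 h8
    rw [h8]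
    ext p q
    obtain ⟨d, hd1, hd2⟩ := h6 q
    have h9 := congrFun (congrFun hd2 p) q
    rw [Matrix.mul_apply, mul_diagonal, hd1, if_pos fun _ => rfl, mul_one] at h9
    rw [← h9, Matrix.mul_apply]
    refine Finset.sum_congr rfl fun r _ => ?_
    rw [h7, mul_diagonal, hd1]
    split_ifs <;> simp
  · refine eq_of_real ht ?_
    filter_upwards [key, real_colourPart ht χ e.f, real_comp ht (colourPart χ e.f) e.f]
      with n h6 h7 h8
    rw [h8]
    ext p q
    obtain ⟨d, hd1, hd2⟩ := h6 p
    have h9 := congrFun (congrFun hd2 p) q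
    rw [Matrix.mul_apply, mul_diagonal, hd1] at h9
    have h10 : ∀ r : Pts n N.X, (∀ j, χ p.1 (pos p.2 j) = χ r.1 (pos r.2 j)) ↔
        ∀ j, χ r.1 (pos r.2 j) = χ p.1 (pos p.2 j) := fun r =>
      forall_congr' fun j => eq_comm
    rw [h7, Matrix.mul_apply, if_congr (h10 q) rfl rfl]
    rw [mul_ite, mul_one, mul_zero] at h9
    rw [← h9]
    refine Finset.sum_congr rfl fun r _ => ?_
    rw [h7, mul_diagonal, hd1, if_congr (h10 r) rfl rfl]
    split_ifs <;> simp

include ht in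
/-- An object on which the points act through characters is simple if its only
colour-preserving endomorphisms are the scalars. -/
theorem simple_colouredRep (h1 : 𝟙 N ≠ 0)
    (hend : ∀ F : N ⟶ N, (∀ a, PreservesMat (fun i c => χ i c a) F.f (fun i c => χ i c a)) →
      ∃ c : k, F = c • 𝟙 N) : Simple (colouredRep N χ h) := by
  rw [RepWreath.simple_iff ht]
  refine ⟨h1, fun (e : N ⟶ N) he hs => ?_⟩
  have h2 : e.f ≫ colourPart χ e.f = e.f := (stable_colourPart ht he hs).1
  have h3 : colourPart χ e.f ≫ e.f = colourPart χ e.f := (stable_colourPart ht he hs).2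
  let F : N ⟶ N := ⟨N.p ≫ colourPart χ e.f ≫ N.p, by simp [N.idem, reassoc_of% N.idem]⟩
  obtain ⟨c, hc⟩ := hend F fun a =>
    (h a).comp ht ((colourPart_preserves χ e.f a).comp ht (h a))
  have hc' : N.p ≫ colourPart χ e.f ≫ N.p = c • N.p := congrArg Karoubi.Hom.f hc
  have hp1 : N.p ≫ e.f = e.f := Karoubi.p_comp e
  have hp2 : e.f ≫ N.p = e.f := Karoubi.comp_p e
  -- `F ≫ e = F` since `C ≫ e = C` for the colour-preserving part `C` of `e`
  have h4 : c • e.f = c • N.p := by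
    rw [← hc']
    have h5 : (N.p ≫ colourPart χ e.f ≫ N.p) ≫ e.f = c • e.f := by
      rw [hc', Linear.smul_comp, hp1]
    have h6 : colourPart χ e.f ≫ N.p = colourPart χ e.f := by
      rw [← h3, Category.assoc, hp2]
    rw [← h5, Category.assoc, Category.assoc, hp1, h3, h6]
  by_cases h0 : c = 0
  · left
    refine Karoubi.hom_ext _ _ ?_
    have h5 : e.f ≫ N.p ≫ colourPart χ e.f ≫ N.p = e.f := by
      rw [reassoc_of% hp2, reassoc_of% h2, hp2]
    rw [hc', h0, zero_smul, Limits.comp_zero] at h5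
    exact h5.symm
  · right
    refine Karoubi.hom_ext _ _ ?_
    exact smul_right_injective _ h0 h4

end Coloured

/-! ### Morphisms between induced objects -/

section BlockKernel

variable {k : Type*} [Field k] [CharZero k] {U V W J J' J'' : Type}
  [Fintype U] [Fintype V] [Fintype W] [Fintype J] [Fintype J'] [Fintype J'']

/-- For a bijection `b : J ≃ J'` and a morphism `Φ : [U] → [V]` of `Rep(S_{t-|J|})`, the morphism
`[U ⊔ J] → [V ⊔ J']` of `Rep(S_t)` that is induced from `Φ ⊗ b`. It generalises `indKer`. -/
noncomputable def blockKer (b : J ≃ J') (Φ : Recollement U V → k) :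
    Recollement (U ⊕ J) (V ⊕ J') → k :=
  ker (fun E => ∀ w, Sum.inr (b w) ∈ E (Sum.inr w)) .inl .inl Φ

theorem blockKer_glued {I : Type} [DecidableEq I] (b : J ≃ J') (Φ : Recollement U V → k)
    (f : U ⊕ J ↪ I) (g : V ⊕ J' ↪ I) :
    blockKer b Φ (glued f g) =
      if ∀ w, f (Sum.inr w) = g (Sum.inr (b w)) then
        Φ (glued (Function.Embedding.inl.trans f) (Function.Embedding.inl.trans g)) else 0 := by
  simp only [blockKer, ker, mem_glued, restrict_glued]

theorem blockKer_comp (t : k) (σ : J ≃ J') (τ : J' ≃ J'') (Φ : Recollement U V → k)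
    (Ψ : Recollement V W → k) :
    comp t (blockKer σ Φ) (blockKer τ Ψ) =
      blockKer (σ.trans τ) (comp (t - Fintype.card J) Φ Ψ) := by
  refine ext_of_glued (Φ := fun t => comp t (blockKer σ Φ) (blockKer τ Ψ))
    (Ψ := fun t => blockKer (σ.trans τ) (comp (t - Fintype.card J) Φ Ψ))
    (fun E => .comp_const _ _ E) (fun E => .ker _ _ _ (fun E => ?_) _) (Fintype.card J) ?_ t
  · exact .sum _ fun C => .sum _ fun D => .mul (.const _) (.structureCoeff _ _ _ _)
  · intro n hn f h
    have hn' : (n : k) = Fintype.card (Fin n) := by simp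
    simp only [comp_glued hn', blockKer_glued]
    split_ifs with hC
    · let I' := {x : Fin n // ∀ w, f (Sum.inr w) ≠ x}
      have hI' : (n : k) - Fintype.card J = Fintype.card I' := by
        have h1 : Fintype.card I' + Fintype.card J = n := by
          have e : I' ⊕ J ≃ Fin n := Equiv.ofBijective
            (Sum.elim Subtype.val fun w => f (Sum.inr w)) <| by
              constructor
              · rintro (x | w) (x' | w') hh <;> simp only [Sum.elim_inl, Sum.elim_inr] at hh
                · rw [Subtype.ext hh]
                · exact absurd hh.symm (x.2 w')
                · exact absurd hh (x'.2 w)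
                · have := f.injective hh
                  cases this; rfl
              · intro x
                by_cases hx : ∃ w, f (Sum.inr w) = x
                · obtain ⟨w, rfl⟩ := hx; exact ⟨Sum.inr w, rfl⟩
                · push Not at hx; exact ⟨Sum.inl ⟨x, hx⟩, rfl⟩
          simpa using Fintype.card_congr e
        have h2 := congrArg (Nat.cast (R := k)) h1
        push_cast at h2
        rw [← h2]
        ring
      let f' : U ↪ I' := ⟨fun u => ⟨f (Sum.inl u), fun w hw => by
        have := f.injective hw; cases this⟩, fun u u' huu => by
        have := f.injective (congrArg Subtype.val huu); cases this; rfl⟩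
      let h' : W ↪ I' := ⟨fun u => ⟨h (Sum.inl u), fun w hw => by
        rw [hC w] at hw
        have := h.injective hw; cases this⟩, fun u u' huu => by
        have := h.injective (congrArg Subtype.val huu); cases this; rfl⟩
      let e : (V ↪ I') → (V ⊕ J' ↪ Fin n) := fun g =>
        ⟨Sum.elim (fun v => (g v).1) (fun w => f (Sum.inr (σ.symm w))), by
          rintro (x | w) (x' | w') hh <;> simp only [Sum.elim_inl, Sum.elim_inr] at hh
          · rw [g.injective (Subtype.ext hh)]
          · exact absurd hh.symm ((g x).2 _)
          · exact absurd hh ((g x').2 _)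
          · have := f.injective hh
            simpa using this⟩
      have hfh : glued (Function.Embedding.inl.trans f) (Function.Embedding.inl.trans h) =
          glued f' h' := rec_ext fun u v => by
        rw [mem_glued, mem_glued]; exact
          ⟨fun h => Subtype.ext h, fun h => congrArg Subtype.val h⟩
      have hfe : ∀ g, glued (Function.Embedding.inl.trans f) (Function.Embedding.inl.trans (e g))
          = glued f' g := fun g => rec_ext fun u v => by
        rw [mem_glued, mem_glued]; exact
          ⟨fun h => Subtype.ext h, fun h => congrArg Subtype.val h⟩
      have heh : ∀ g, glued (Function.Embedding.inl.trans (e g)) (Function.Embedding.inl.trans h)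
          = glued g h' := fun g => rec_ext fun u v => by
        rw [mem_glued, mem_glued]; exact
          ⟨fun h => Subtype.ext h, fun h => congrArg Subtype.val h⟩
      have he : Function.Injective e := fun g g' hg => Function.Embedding.ext fun v =>
        Subtype.ext (DFunLike.congr_fun hg (Sum.inl v))
      have her : ∀ (g : V ↪ I') w, e g (Sum.inr w) = f (Sum.inr (σ.symm w)) := fun _ _ => rfl
      rw [hfh, comp_glued hI']
      refine (Fintype.sum_of_injective e he _ _ ?_ ?_).symm
      · intro g hg
        by_cases hc : ∀ w, f (Sum.inr w) = g (Sum.inr (σ w))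
        · exfalso
          refine hg ⟨⟨fun v => ⟨g (Sum.inl v), fun w hw => ?_⟩, fun v v' hv => ?_⟩, ?_⟩
          · rw [hc w] at hw
            have := g.injective hw; cases this
          · have := g.injective (congrArg Subtype.val hv); cases this; rfl
          · refine Function.Embedding.ext ?_
            rintro (v | w)
            · rfl
            · rw [her, hc]; simp
        · rw [if_neg hc, zero_mul]
      · intro g
        rw [hfe, heh, if_pos, if_pos]
        · intro w
          rw [her, hC]; simp
        · intro w
          rw [her]; simp
    · refine Finset.sum_eq_zero fun g _ => ?_
      by_cases h1 : ∀ w, f (Sum.inr w) = g (Sum.inr (σ w))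
      · rw [if_neg (c := ∀ w, g (Sum.inr w) = _), mul_zero]
        exact fun h2 => hC fun w => (h1 w).trans (h2 (σ w))
      · rw [if_neg h1, zero_mul]

theorem blockKer_comp_of_eq {s t : k} (hs : s = t - Fintype.card J) (σ : J ≃ J') (τ : J' ≃ J'')
    (Φ : Recollement U V → k) (Ψ : Recollement V W → k) :
    comp t (blockKer σ Φ) (blockKer τ Ψ) = blockKer (σ.trans τ) (comp s Φ Ψ) := by
  rw [hs, blockKer_comp]

theorem blockKer_smul (c : k) (b : J ≃ J') (Φ : Recollement U V → k) :
    blockKer b (c • Φ) = c • blockKer b Φ := by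
  funext E
  simp only [blockKer, ker, Pi.smul_apply]
  split_ifs
  · rfl
  · rw [smul_zero]

/-- The disjoint union of a recollement and a bijection. -/
def joinRec (E : Recollement U V) (b : J ≃ J') : Recollement (U ⊕ J) (V ⊕ J') where
  toFun := Sum.elim (fun u => (E u).map .inl) fun w => some (.inr (b w))
  invFun := Sum.elim (fun v => (E.symm v).map .inl) fun w => some (.inr (b.symm w))
  inv := by
    have h := fun u v => PEquiv.mem_iff_mem E (a := u) (b := v)
    rintro (u | w) (v | w')
    · simpa using h u v
    · simp
    · simp
    · simpa using b.symm_apply_eq.trans eq_comm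

theorem inl_mem_joinRec (E : Recollement U V) (b : J ≃ J') (u : U) (v : V) :
    Sum.inl v ∈ joinRec E b (Sum.inl u) ↔ v ∈ E u := by
  change Sum.inl v ∈ (E u).map Sum.inl ↔ _
  simp

theorem inr_mem_joinRec (E : Recollement U V) (b : J ≃ J') (w : J) :
    Sum.inr (b w) ∈ joinRec E b (Sum.inr w) := rfl

theorem joinRec_restrict {E : Recollement (U ⊕ J) (V ⊕ J')} {b : J ≃ J'}
    (h : ∀ w, Sum.inr (b w) ∈ E (Sum.inr w)) : joinRec (E.restrict .inl .inl) b = E := by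
  refine rec_ext ?_
  rintro (u | w) (v | w')
  · rw [inl_mem_joinRec, mem_restrict]
    rfl
  · have h1 : Sum.inr w' ∉ joinRec (E.restrict .inl .inl) b (Sum.inl u) := by
      change Sum.inr w' ∉ Option.map _ _
      simp
    refine iff_of_false h1 fun h2 => ?_
    obtain ⟨w, rfl⟩ := b.surjective w'
    cases E.inj h2 (h w)
  · rw [show E (Sum.inr w) = some (Sum.inr (b w)) from h w]
    exact Iff.rfl
  · rw [show E (Sum.inr w) = some (Sum.inr (b w)) from h w]
    exact Iff.rfl

theorem restrict_joinRec (E : Recollement U V) (b : J ≃ J') :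
    (joinRec E b).restrict .inl .inl = E :=
  rec_ext fun u v => by
    rw [mem_restrict]
    exact inl_mem_joinRec E b u v

theorem blockKer_joinRec [DecidableEq (J ≃ J')] (b b' : J ≃ J') (Φ : Recollement U V → k) (E : Recollement U V) :
    blockKer b Φ (joinRec E b') = if b = b' then Φ E else 0 := by
  have h : (∀ w, Sum.inr (b w) ∈ joinRec E b' (Sum.inr w)) ↔ b = b' := by
    refine ⟨fun h => Equiv.ext fun w => ?_, ?_⟩
    · exact (Sum.inr.inj (Option.some.inj (h w))).symm
    · rintro rfl w
      rfl
  rw [blockKer, ker, restrict_joinRec]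
  simp only [h]

/-- If the points of `J` and `J'` do not have the colour of the other points, then a recollement that preserves
colours comes from a bijection `J ≃ J'`. -/
theorem exists_equiv_of_colour {C : Type*} {E : Recollement (U ⊕ J) (V ⊕ J')} {χ₁ χ₁' : C}
    {χ : J → C} {χ' : J' → C}
    (hc : ∀ c d, Matches E c d → blockColour χ₁ χ c = blockColour χ₁' χ' d)
    (h : ∀ w, χ w ≠ χ₁) (h' : ∀ w, χ' w ≠ χ₁') : χ₁ = χ₁' ∧
      ∃ b : J ≃ J', (∀ w, Sum.inr (b w) ∈ E (Sum.inr w)) ∧ ∀ w, χ' (b w) = χ w := by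
  have h0 : χ₁ = χ₁' := hc none none trivial
  have h1 : ∀ w, ∃ w', Sum.inr w' ∈ E (Sum.inr w) := by
    intro w
    rcases hw : E (Sum.inr w) with _ | v | w'
    · exact absurd ((hc (some (.inr w)) none hw).trans h0.symm) (h w)
    · exact absurd ((hc (some (.inr w)) (some (.inl v)) hw).trans h0.symm) (h w)
    · exact ⟨w', rfl⟩
  have h2 : ∀ w', ∃ w, Sum.inr w' ∈ E (Sum.inr w) := by
    intro w'
    rcases hw : E.symm (Sum.inr w') with _ | u | w
    · exact absurd ((hc none (some (.inr w')) hw).symm.trans h0) (h' w')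
    · exact absurd ((hc (some (.inl u)) (some (.inr w')) ((PEquiv.mem_iff_mem E).1 hw)).symm.trans
        h0) (h' w')
    · exact ⟨w, (PEquiv.mem_iff_mem E).1 hw⟩
  choose b hb using h1
  choose b' hb' using h2
  refine ⟨h0, ⟨b, b', fun w => ?_, fun w' => ?_⟩, hb, fun w => ?_⟩
  · exact Sum.inr.inj (E.inj (hb' (b w)) (hb w))
  · exact Sum.inr.inj (Option.mem_unique (hb (b' w')) (hb' w'))
  · exact (hc (some (.inr w)) (some (.inr (b w))) (hb w)).symm

theorem blockKer_preserves {C : Type*} (χ₁ : C) {χ : J → C} {χ' : J' → C} (ev : C → k)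
    {b : J ≃ J'} (h : ∀ w, χ' (b w) = χ w) (Φ : Recollement U V → k) :
    Preserves (fun c => ev (blockColour χ₁ χ c)) (blockKer b Φ)
      (fun c => ev (blockColour χ₁ χ' c)) := by
  intro E hE c d hcd
  have hP : ∀ w, Sum.inr (b w) ∈ E (Sum.inr w) := by
    by_contra hP
    exact hE (if_neg hP)
  rw [← joinRec_restrict hP] at hcd
  refine congrArg ev ?_
  rcases c with _ | u | w <;> rcases d with _ | v | w'
  · rfl
  · rfl
  · cases hcd
  · rfl
  · rfl
  · have h1 : Sum.inr w' ∈ (E.restrict .inl .inl u).map Sum.inl := hcd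
    simp at h1
  · cases hcd
  · cases hcd
  · have h1 : some (Sum.inr (b w)) = some (Sum.inr w' : V ⊕ J') := hcd
    obtain rfl : b w = w' := Sum.inr.inj (Option.some.inj h1)
    exact (h w).symm

end BlockKernel

section BlockMap

open Idempotents

universe u
variable {k : Type u} [Field k] [CharZero k] {s t : k} {J J' J'' β β' β'' : Type}
  [Fintype J] [Fintype J'] [Fintype J''] [Fintype β] [Fintype β'] [Fintype β'']
  {X Y Z : Mat_ (Deligne₀ s)}

/-- The morphism `e_{(f, g)} ⊗ b_x ↦ ∑_y F_{xy}(e_f) ⊗ e_{g ∘ b⁻¹} ⊗ b_y`. -/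
noncomputable def blockMap (t : k) (b : J ≃ J') (F : β → β' → (X ⟶ Y)) :
    indMat t X J β ⟶ indMat t Y J' β' :=
  fun p q => blockKer b (F p.2 q.2 p.1 q.1)

/-- The component of a morphism between induced objects that belongs to a bijection `J ≃ J'`. -/
noncomputable def blockPart (b : J ≃ J') (f : indMat t X J β ⟶ indMat t Y J' β') (x : β) (y : β') :
    X ⟶ Y :=
  fun i j => fun E : Recollement _ _ => (f (i, x) (j, y) : Recollement _ _ → k) (joinRec E b)

theorem blockKer_sum {U V ι : Type} (s : Finset ι) (b : J ≃ J') (Φ : ι → Recollement U V → k) :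
    ∑ i ∈ s, blockKer b (Φ i) = blockKer b (∑ i ∈ s, Φ i) := by
  rw [← Finset.sum_coe_sort, ← Finset.sum_coe_sort s Φ]
  exact ker_sum _ _ _ _

theorem mat_sum_apply {r : k} {P Q : Mat_ (Deligne₀ r)} {ι : Type*} (S : Finset ι) (f : ι → (P ⟶ Q))
    (p : P.ι) (q : Q.ι) : (∑ i ∈ S, f i) p q = ∑ i ∈ S, f i p q := by
  classical
  induction S using Finset.induction_on with
  | empty => rfl
  | insert a S ha ih =>
    rw [Finset.sum_insert ha, Finset.sum_insert ha, ← ih]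
    rfl

theorem hom_sum_apply {r : k} {P Q : Deligne₀ r} {ι : Type*} (S : Finset ι) (f : ι → (P ⟶ Q))
    (E : Recollement P.carrier Q.carrier) :
    (∑ i ∈ S, f i : P ⟶ Q) E = ∑ i ∈ S, (f i : Recollement _ _ → k) E := by
  classical
  induction S using Finset.induction_on with
  | empty => rfl
  | insert a S ha ih =>
    rw [Finset.sum_insert ha, Finset.sum_insert ha, ← ih]
    rfl

theorem blockMap_comp (hs : s = t - Fintype.card J) (b : J ≃ J') (c : J' ≃ J'')
    (F : β → β' → (X ⟶ Y)) (F' : β' → β'' → (Y ⟶ Z)) :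
    blockMap t b F ≫ blockMap t c F' =
      blockMap t (b.trans c) fun x z => ∑ y, F x y ≫ F' y z := by
  funext p q
  rw [comp_eq]
  refine (Fintype.sum_prod_type (f := fun r : Y.ι × β' =>
    comp t (blockMap t b F p r) (blockMap t c F' r q))).trans ?_
  have h1 : ∀ (i : Y.ι) (y : β'),
      comp t (blockMap t b F p (i, y)) (blockMap t c F' (i, y) q) =
        blockKer (b.trans c) (comp s (F p.2 y p.1 i) (F' y q.2 i q.1)) := fun i y =>
    blockKer_comp_of_eq hs b c _ _
  refine (Finset.sum_congr rfl fun i _ => Finset.sum_congr rfl fun y _ => h1 i y).trans ?_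
  refine Finset.sum_comm.trans ?_
  change _ = blockKer (b.trans c) ((∑ y, F p.2 y ≫ F' y q.2) p.1 q.1)
  rw [mat_sum_apply]
  refine Eq.trans ?_ (blockKer_sum _ _ _)
  refine Finset.sum_congr rfl fun y _ => ?_
  rw [comp_eq]
  exact blockKer_sum _ _ _

theorem blockPart_blockMap [DecidableEq (J ≃ J')] (b c : J ≃ J') (F : β → β' → (X ⟶ Y)) (x : β) (y : β') :
    blockPart b (blockMap t c F) x y = if c = b then F x y else 0 := by
  funext i j
  funext E
  refine (blockKer_joinRec c b (F x y i j) E).trans ?_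
  split_ifs
  · rfl
  · rfl

theorem blockPart_sum {ι : Type*} (S : Finset ι) (b : J ≃ J')
    (f : ι → (indMat t X J β ⟶ indMat t Y J' β')) (x : β) (y : β') :
    blockPart b (∑ i ∈ S, f i) x y = ∑ i ∈ S, blockPart b (f i) x y := by
  classical
  induction S using Finset.induction_on with
  | empty => rfl
  | insert a S ha ih =>
    rw [Finset.sum_insert ha, Finset.sum_insert ha, ← ih]
    rfl

theorem blockPart_smul (c : k) (b : J ≃ J') (f : indMat t X J β ⟶ indMat t Y J' β') (x : β)
    (y : β') : blockPart b (c • f) x y = c • blockPart b f x y := rfl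

/-- All recollements that occur in `f` come from bijections `J ≃ J'`. -/
def IsBlock (f : indMat t X J β ⟶ indMat t Y J' β') : Prop :=
  ∀ p q (E : Recollement _ _), (f p q : Recollement _ _ → k) E ≠ 0 →
    ∃ b : J ≃ J', ∀ w, Sum.inr (b w) ∈ E (Sum.inr w)

theorem IsBlock.eq_sum [DecidableEq J] [DecidableEq J'] {f : indMat t X J β ⟶ indMat t Y J' β'}
    (hf : IsBlock f) : f = ∑ b : J ≃ J', blockMap t b (blockPart b f) := by
  classical
  funext p q
  funext E
  rw [mat_sum_apply]
  refine Eq.trans ?_ (hom_sum_apply _ _ E).symm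
  by_cases h : ∃ b : J ≃ J', ∀ w, Sum.inr (b w) ∈ E (Sum.inr w)
  · obtain ⟨b, hb⟩ := h
    rw [← joinRec_restrict hb]
    have h1 : ∀ c : J ≃ J', (blockMap t c (blockPart c f) p q : Recollement _ _ → k)
        (joinRec (E.restrict .inl .inl) b) =
        if c = b then (f p q : Recollement _ _ → k) (joinRec (E.restrict .inl .inl) c) else 0 :=
      fun c => blockKer_joinRec c b (blockPart c f p.2 q.2 p.1 q.1) _
    refine Eq.trans ?_ (Finset.sum_congr rfl fun c _ => h1 c).symm
    rw [Finset.sum_ite_eq', if_pos (Finset.mem_univ b)]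
    rfl
  · have h0 : (f p q : Recollement _ _ → k) E = 0 := by
      by_contra hne
      exact h (hf p q E hne)
    rw [h0]
    refine (Finset.sum_eq_zero fun c _ => ?_).symm
    exact if_neg fun hc => h ⟨c, hc⟩

theorem IsBlock.ext {f g : indMat t X J β ⟶ indMat t Y J' β'} (hf : IsBlock f) (hg : IsBlock g)
    (h : ∀ b : J ≃ J', ∀ x y, blockPart b f x y = blockPart b g x y) : f = g := by
  classical
  rw [hf.eq_sum, hg.eq_sum]
  refine Finset.sum_congr rfl fun b _ => ?_
  rw [funext fun x => funext fun y => h b x y]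

end BlockMap

section Formula

open Idempotents

universe u
variable {k : Type u} [Field k] [CharZero k] {s t : k} {G G' J J' β β' : Type} [Group G] [Group G']
  [Fintype G] [Fintype G'] [Fintype J] [Fintype J'] [Fintype β] [Fintype β'] [DecidableEq β]
  [DecidableEq β']

theorem indTerm_eq_blockMap (θ : G →* Equiv.Perm J) (R : G →* Matrix β β k) (M : RepS s) (σ : G) :
    indTerm t θ R M σ = blockMap t (θ σ) fun x y => R σ y x • M.p := by
  funext p q
  exact (blockKer_smul _ _ _).symm

theorem indTerm_indIdem (hs : s = t - Fintype.card J) (θ : G →* Equiv.Perm J)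
    (R : G →* Matrix β β k) (M : RepS s) (σ : G) :
    indTerm t θ R M σ ≫ indIdem t θ R M = indIdem t θ R M := by
  rw [indIdem, Linear.comp_smul, Preadditive.comp_sum]
  simp only [indTerm_comp hs]
  congr 1
  exact Fintype.sum_equiv (Equiv.mulRight σ) _ _ fun _ => rfl

theorem indIdem_indTerm (hs : s = t - Fintype.card J) (θ : G →* Equiv.Perm J)
    (R : G →* Matrix β β k) (M : RepS s) (σ : G) :
    indIdem t θ R M ≫ indTerm t θ R M σ = indIdem t θ R M := by
  rw [indIdem, Linear.smul_comp, Preadditive.sum_comp]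
  simp only [indTerm_comp hs]
  congr 1
  exact Fintype.sum_equiv (Equiv.mulLeft σ) _ _ fun _ => rfl

variable {θ : G →* Equiv.Perm J} {R : G →* Matrix β β k} {M M' : RepS s}
  {θ' : G' →* Equiv.Perm J'} {R' : G' →* Matrix β' β' k}
  {f : indMat t M.X J β ⟶ indMat t M'.X J' β'}

/-- The equivariance of the components of a morphism between induced objects, on the left. -/
theorem blockPart_left (hs : s = t - Fintype.card J) (hb : IsBlock f)
    (h : indIdem t θ R M ≫ f = f) (τ : G) (b : J ≃ J') (x : β) (y : β') :
    blockPart ((θ τ).trans b) f x y = ∑ z, R τ z x • (M.p ≫ blockPart b f z y) := by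
  classical
  have h1 : indTerm t θ R M τ ≫ f = f := by
    rw [← h, ← Category.assoc, indTerm_indIdem hs]
  conv_lhs => rw [← h1, indTerm_eq_blockMap, hb.eq_sum, Preadditive.comp_sum, blockPart_sum]
  simp only [blockMap_comp hs, blockPart_blockMap]
  rw [Finset.sum_eq_single b]
  · rw [if_pos rfl]
    simp only [Linear.smul_comp]
  · intro c _ hc
    exact if_neg fun h2 => hc (Equiv.ext fun w => by
      obtain ⟨w, rfl⟩ := (θ τ).surjective w
      exact DFunLike.congr_fun h2 w)
  · exact fun h => absurd (Finset.mem_univ _) h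

/-- The equivariance of the components of a morphism between induced objects, on the right. -/
theorem blockPart_right (hs : s = t - Fintype.card J) (hs' : s = t - Fintype.card J')
    (hb : IsBlock f) (h : f ≫ indIdem t θ' R' M' = f) (τ : G') (b : J ≃ J') (x : β) (y : β') :
    blockPart (b.trans (θ' τ)) f x y = ∑ z, R' τ y z • (blockPart b f x z ≫ M'.p) := by
  classical
  have h1 : f ≫ indTerm t θ' R' M' τ = f := by
    rw [← h, Category.assoc, indIdem_indTerm hs']
  conv_lhs => rw [← h1, indTerm_eq_blockMap, hb.eq_sum, Preadditive.sum_comp, blockPart_sum]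
  simp only [blockMap_comp hs, blockPart_blockMap]
  rw [Finset.sum_eq_single b]
  · rw [if_pos rfl]
    simp only [Linear.comp_smul]
  · intro c _ hc
    exact if_neg fun h2 => hc (Equiv.ext fun w => (θ' τ).injective (DFunLike.congr_fun h2 w))
  · exact fun h => absurd (Finset.mem_univ _) h

end Formula

/-! ### Intertwiners of the inducing objects -/

section Intertwiners

open Idempotents

universe u
variable {k : Type u} [Field k] [CharZero k] {s s' t : k} {G G' J J' β β' : Type} [Group G]
  [Group G'] [Fintype G] [Fintype G'] [Fintype J] [Fintype J'] [Fintype β] [Fintype β']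
  [DecidableEq β] [DecidableEq β'] {θ : G →* Equiv.Perm J} {R : G →* Matrix β β k}
  {θ' : G' →* Equiv.Perm J'} {R' : G' →* Matrix β' β' k}

theorem p_ne_zero_of_simple (M : RepS s) [Simple M] : M.p ≠ 0 := fun h =>
  id_nonzero M (Karoubi.hom_ext _ _ h)

/-- The recollements that occur in the projection to the invariants come from elements of the group. -/
theorem indIdem_support {M : RepS s} {p q} {E : Recollement _ _}
    (h : (indIdem t θ R M p q : Recollement _ _ → k) E ≠ 0) :
    ∃ τ, ∀ w, Sum.inr (θ τ w) ∈ E (Sum.inr w) := by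
  by_contra hcon
  push Not at hcon
  refine h ?_
  have h1 : (indIdem t θ R M p q : Recollement _ _ → k) E = (Fintype.card G : k)⁻¹ *
      ((∑ σ, indTerm t θ R M σ) p q : Recollement _ _ → k) E := rfl
  rw [h1, mat_sum_apply]
  have h2 : (∑ σ, indTerm t θ R M σ p q : _ ⟶ _) E =
      ∑ σ, (indTerm t θ R M σ p q : Recollement _ _ → k) E := hom_sum_apply _ _ E
  rw [h2, Finset.sum_eq_zero, mul_zero]
  intro σ _
  obtain ⟨w, hw⟩ := hcon σ
  have h3 : (indTerm t θ R M σ p q : Recollement _ _ → k) E =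
    R σ q.2 p.2 * indKer (θ σ) (M.p p.1 q.1) E := rfl
  have h4 : indKer (θ σ) (M.p p.1 q.1) E = 0 := if_neg fun h => hw (h w)
  rw [h3, h4, mul_zero]

theorem blockPart_indIdem (hθ : Function.Injective θ) (M : RepS s) (σ : G) (x y : β) :
    blockPart (θ σ) (indIdem t θ R M) x y = (Fintype.card G : k)⁻¹ • R σ y x • M.p := by
  classical
  rw [indIdem, blockPart_smul, blockPart_sum]
  simp only [indTerm_eq_blockMap, blockPart_blockMap, hθ.eq_iff]
  rw [Finset.sum_ite_eq', if_pos (Finset.mem_univ σ)]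

/-- A morphism between induced objects is determined by one of its components, if the group permutes the
components transitively. -/
theorem ext_of_blockPart (hs : s = t - Fintype.card J) (hs' : s = t - Fintype.card J')
    {M M' : RepS s} (b : J ≃ J') {f g : indMat t M.X J β ⟶ indMat t M'.X J' β'}
    (hf : f ≫ indIdem t θ' R' M' = f) (hg : g ≫ indIdem t θ' R' M' = g)
    (hfb : ∀ p q (E : Recollement _ _), (f p q : Recollement _ _ → k) E ≠ 0 →
      ∃ τ, ∀ w, Sum.inr (θ' τ (b w)) ∈ E (Sum.inr w))
    (hgb : ∀ p q (E : Recollement _ _), (g p q : Recollement _ _ → k) E ≠ 0 →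
      ∃ τ, ∀ w, Sum.inr (θ' τ (b w)) ∈ E (Sum.inr w))
    (h : ∀ x y, blockPart b f x y = blockPart b g x y) : f = g := by
  have hf' : IsBlock f := fun p q E hE => (hfb p q E hE).imp' (fun τ => b.trans (θ' τ)) fun _ h => h
  have hg' : IsBlock g := fun p q E hE => (hgb p q E hE).imp' (fun τ => b.trans (θ' τ)) fun _ h => h
  have key : ∀ {f : indMat t M.X J β ⟶ indMat t M'.X J' β'}, (∀ p q (E : Recollement _ _),
      (f p q : Recollement _ _ → k) E ≠ 0 → ∃ τ, ∀ w, Sum.inr (θ' τ (b w)) ∈ E (Sum.inr w)) →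
      ∀ c : J ≃ J', (∀ τ, c ≠ b.trans (θ' τ)) → ∀ x y, blockPart c f x y = 0 := by
    intro f hfb c hc x y
    funext i j
    funext E
    by_contra hne
    obtain ⟨τ, hτ⟩ := hfb (i, x) (j, y) (joinRec E c) hne
    exact hc τ (Equiv.ext fun w => Sum.inr.inj (Option.mem_unique (inr_mem_joinRec E c w) (hτ w)))
  refine hf'.ext hg' fun c x y => ?_
  by_cases hc : ∃ τ, c = b.trans (θ' τ)
  · obtain ⟨τ, rfl⟩ := hc
    rw [blockPart_right hs hs' hf' hf, blockPart_right hs hs' hg' hg]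
    simp only [h]
  · push Not at hc
    rw [key hfb c hc, key hgb c hc]

/-- If the components of a morphism between induced objects are multiples of one isomorphism, then the
coefficients form an intertwining matrix. -/
theorem intertwines_of_blockPart (hs : s = t - Fintype.card J) (hs' : s = t - Fintype.card J')
    {M M' : RepS s} {b : J ≃ J'} {f : indMat t M.X J β ⟶ indMat t M'.X J' β'} (hb : IsBlock f)
    (hf : indIdem t θ R M ≫ f = f) (hf' : f ≫ indIdem t θ' R' M' = f) {i : M ⟶ M'}
    (hi : i ≠ 0) {L : Matrix β' β k} (hL : ∀ x y, blockPart b f x y = L y x • i.f) {τ : G} {τ' : G'}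
    (hτ : (θ τ).trans b = b.trans (θ' τ')) : L * R τ = R' τ' * L := by
  ext y x
  have h1 := (blockPart_left hs hb hf τ b x y).symm.trans
    ((congrArg (fun c => blockPart c f x y) hτ).trans (blockPart_right hs hs' hb hf' τ' b x y))
  simp only [hL, Linear.comp_smul, Linear.smul_comp, Karoubi.p_comp, Karoubi.comp_p, smul_smul,
    ← Finset.sum_smul] at h1
  have h2 : i.f ≠ 0 := fun h => hi (Karoubi.hom_ext _ _ h)
  have h3 := smul_left_injective k h2 h1
  rw [Matrix.mul_apply, Matrix.mul_apply]
  simpa only [mul_comm] using h3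

variable [IsAlgClosed k]

/-- A nonzero morphism between induced objects gives an isomorphism between the inducing objects, and a
nonzero intertwining matrix. -/
theorem exists_intertwiner (hst : Transcendental ℚ s) (hs : s = t - Fintype.card J)
    (hs' : s' = t - Fintype.card J') {M : RepS s} {M' : RepS s'} [hM : Simple M] [hM' : Simple M']
    (b : J ≃ J') {f : indMat t M.X J β ⟶ indMat t M'.X J' β'} (h0 : f ≠ 0)
    (hf : indIdem t θ R M ≫ f = f) (hf' : f ≫ indIdem t θ' R' M' = f)
    (hfb : ∀ p q (E : Recollement _ _), (f p q : Recollement _ _ → k) E ≠ 0 →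
      ∃ τ, ∀ w, Sum.inr (θ' τ (b w)) ∈ E (Sum.inr w)) :
    IsoOver (RepS (k := k)) M M' ∧ ∃ L : Matrix β' β k, L ≠ 0 ∧ ∀ τ τ',
      (θ τ).trans b = b.trans (θ' τ') → L * R τ = R' τ' * L := by
  obtain rfl : s = s' := by rw [hs, hs', Fintype.card_congr b]
  have hb : IsBlock f := fun p q E hE => (hfb p q E hE).imp' (fun τ => b.trans (θ' τ)) fun _ h => h
  have hl : ∀ x y, M.p ≫ blockPart b f x y = blockPart b f x y := by
    intro x y
    have h1 := blockPart_left hs hb hf 1 b x y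
    simp only [map_one, Matrix.one_apply, ite_smul, one_smul, zero_smul, Finset.sum_ite_eq',
      Finset.mem_univ, if_true] at h1
    exact h1.symm
  have hr : ∀ x y, blockPart b f x y ≫ M'.p = blockPart b f x y := by
    intro x y
    have h1 := blockPart_right hs hs' hb hf' 1 b x y
    simp only [map_one, Matrix.one_apply, ite_smul, one_smul, zero_smul, Finset.sum_ite_eq,
      Finset.mem_univ, if_true] at h1
    exact h1.symm
  let φ : β → β' → (M ⟶ M') := fun x y => ⟨blockPart b f x y, by rw [hr, hl]⟩
  obtain ⟨x₀, y₀, h1⟩ : ∃ x y, φ x y ≠ 0 := by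
    by_contra hcon
    push Not at hcon
    refine h0 (ext_of_blockPart (θ' := θ') (R' := R') hs hs' b hf' Limits.zero_comp hfb
      (fun p q E hE => absurd rfl hE) fun x y => ?_)
    exact congrArg Karoubi.Hom.f (hcon x y)
  have := isIso_of_simple hst h1
  let i : M ≅ M' := asIso (φ x₀ y₀)
  choose L hL using fun x y => hom_eq_smul hst i (φ x y)
  refine ⟨⟨rfl, ⟨i⟩⟩, Matrix.of fun y x => L x y, fun h => ?_, fun τ τ' hτ => ?_⟩
  · refine h1 ?_
    have h2 : L x₀ y₀ = 0 := congrFun (congrFun h y₀) x₀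
    rw [hL, h2, zero_smul]
  · exact intertwines_of_blockPart hs hs' hb hf hf' (i := i.hom) h1
      (fun x y => congrArg Karoubi.Hom.f (hL x y)) hτ

/-- An isomorphism of the inducing objects and a nonzero intertwining matrix give a nonzero morphism
between the induced objects. -/
theorem exists_hom_of_intertwiner (hs : s = t - Fintype.card J) (hs' : s' = t - Fintype.card J')
    {M : RepS s} {M' : RepS s'} (hM : M.p ≠ 0) (hMM' : IsoOver (RepS (k := k)) M M')
    (hθ : Function.Injective θ) (b : J ≃ J') {L : Matrix β' β k} (hL0 : L ≠ 0)
    (hL : ∀ τ', ∃ τ, (θ τ).trans b = b.trans (θ' τ') ∧ L * R τ = R' τ' * L) :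
    ∃ (f : indMat t M.X J β ⟶ indMat t M'.X J' β') (Φ : ∀ _ _, Recollement _ _ → k),
      f ≠ 0 ∧ indIdem t θ R M ≫ f = f ∧ f ≫ indIdem t θ' R' M' = f ∧
      f = indIdem t θ R M ≫ fun p q => blockKer b (Φ p q) := by
  classical
  obtain ⟨rfl, ⟨i⟩⟩ := hMM'
  change M ≅ M' at i
  let F : β → β' → (M.X ⟶ M'.X) := fun x y => L y x • i.hom.f
  have hi : i.hom.f ≠ 0 := by
    intro h
    apply hM
    have h1 := congrArg Karoubi.Hom.f i.hom_inv_id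
    change i.hom.f ≫ i.inv.f = M.p at h1
    rw [← h1, h, Limits.zero_comp]
  have hcomm : ∀ τ τ', (θ τ).trans b = b.trans (θ' τ') → L * R τ = R' τ' * L →
      blockMap t b F ≫ indTerm t θ' R' M' τ' = indTerm t θ R M τ ≫ blockMap t b F := by
    intro τ τ' h1 h2
    rw [indTerm_eq_blockMap, indTerm_eq_blockMap, blockMap_comp hs, blockMap_comp hs, h1]
    congr 1
    funext x z
    simp only [F, Linear.comp_smul, Linear.smul_comp, Karoubi.p_comp, Karoubi.comp_p, smul_smul,
      ← Finset.sum_smul]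
    congr 1
    have h3 := congrFun (congrFun h2 z) x
    rw [Matrix.mul_apply, Matrix.mul_apply] at h3
    simpa only [mul_comm] using h3.symm
  refine ⟨indIdem t θ R M ≫ blockMap t b F, fun p q => F p.2 q.2 p.1 q.1, ?_, ?_, ?_, rfl⟩
  · intro h
    obtain ⟨y, x, hyx⟩ : ∃ y x, L y x ≠ 0 := by
      by_contra hcon
      push Not at hcon
      exact hL0 (Matrix.ext hcon)
    have h1 : blockPart b (indIdem t θ R M ≫ blockMap t b F) x y =
        (Fintype.card G : k)⁻¹ • L y x • i.hom.f := by
      rw [indIdem, Linear.smul_comp, Preadditive.sum_comp, blockPart_smul, blockPart_sum]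
      simp only [indTerm_eq_blockMap, blockMap_comp hs, blockPart_blockMap]
      congr 1
      rw [Finset.sum_eq_single 1]
      · rw [if_pos (by rw [map_one]; rfl), map_one]
        rw [Finset.sum_eq_single x]
        · rw [Matrix.one_apply_eq, one_smul, Linear.comp_smul, Karoubi.p_comp]
        · intro z _ hz
          rw [Matrix.one_apply_ne hz, zero_smul, Limits.zero_comp]
        · exact fun h => absurd (Finset.mem_univ _) h
      · intro σ _ hσ
        refine if_neg fun h2 => hσ (hθ ?_)
        rw [map_one]
        exact Equiv.ext fun w => b.injective (DFunLike.congr_fun h2 w)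
      · exact fun h => absurd (Finset.mem_univ _) h
    rw [h] at h1
    have h2 : (0 : M.X ⟶ M'.X) = (Fintype.card G : k)⁻¹ • L y x • i.hom.f := h1
    have hG : (Fintype.card G : k)⁻¹ ≠ 0 := inv_ne_zero (Nat.cast_ne_zero.2 Fintype.card_ne_zero)
    exact smul_ne_zero hG (smul_ne_zero hyx hi) h2.symm
  · rw [← Category.assoc, indIdem_comp hs]
  · choose c hc1 hc2 using hL
    have hG : (Fintype.card G' : k) ≠ 0 := Nat.cast_ne_zero.2 Fintype.card_ne_zero
    have h1 : ∀ τ', (indIdem t θ R M ≫ blockMap t b F) ≫ indTerm t θ' R' M' τ' =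
        indIdem t θ R M ≫ blockMap t b F := by
      intro τ'
      rw [Category.assoc, hcomm _ _ (hc1 τ') (hc2 τ'), ← Category.assoc, indIdem_indTerm hs]
    conv_lhs => rw [indIdem.eq_def t θ' R' M', Linear.comp_smul, Preadditive.comp_sum]
    simp only [h1, Finset.sum_const, Finset.card_univ]
    rw [← Nat.cast_smul_eq_nsmul k, smul_smul, inv_mul_cancel₀ hG, one_smul]

end Intertwiners

/-! ### Simplicity of the induced objects -/

theorem transcendental_sub_natCast {k : Type*} [Field k] [CharZero k] {t : k}
    (ht : Transcendental ℚ t) (n : ℕ) : Transcendental ℚ (t - n) := fun h => by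
  have h1 := h.add (isAlgebraic_natCast (R := ℚ) (A := k) n)
  rw [sub_add_cancel] at h1
  exact ht h1

/-- A permutation of a disjoint union that preserves its parts is a family of permutations of the parts. -/
theorem exists_sigmaCongrRightHom_eq {l : ℕ} {n : Fin l → ℕ} (e : Equiv.Perm (Σ j, Fin (n j)))
    (h : ∀ w, (e w).1 = w.1) :
    ∃ τ, Equiv.Perm.sigmaCongrRightHom (fun j => Fin (n j)) τ = e := by
  have h1 : ∀ j x, ∃ y : Fin (n j), e ⟨j, x⟩ = ⟨j, y⟩ := by
    intro j x
    have h1 := h ⟨j, x⟩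
    rcases he : e ⟨j, x⟩ with ⟨j', y⟩
    rw [he] at h1
    obtain rfl : j' = j := h1
    exact ⟨y, rfl⟩
  choose f hf using h1
  have hinj : ∀ j, Function.Injective (f j) := fun j x x' hx => by
    have h2 := e.injective ((hf j x).trans ((congrArg (Sigma.mk j) hx).trans (hf j x').symm))
    exact eq_of_heq (Sigma.mk.inj_iff.1 h2).2
  exact ⟨fun j => Equiv.ofBijective (f j) (Finite.injective_iff_bijective.1 (hinj j)),
    Equiv.ext fun ⟨j, x⟩ => (hf j x).symm⟩

section SymmetricGroups

universe u
variable {k : Type u} [Field k] {m m' : ℕ}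
  {V : FDRep k (Equiv.Perm (Fin m))} {W : FDRep k (Equiv.Perm (Fin m'))}

theorem isoOver_of_matrix [Simple V] [Simple W] (hm : m = m')
    {B : Matrix (Fin (Module.finrank k W)) (Fin (Module.finrank k V)) k} (h0 : B ≠ 0)
    (hB : ∀ τ, B * repMatrix V τ = repMatrix W ((finCongr hm).permCongr τ) * B) :
    IsoOver (fun m => FDRep k (Equiv.Perm (Fin m))) V W := by
  subst hm
  refine ⟨rfl, nonempty_iso_of_linear (fun τ => toLin_comm B (h := τ) (hB τ)) fun h => h0 ?_⟩
  exact (Matrix.toLin _ _).map_eq_zero_iff.1 h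

theorem exists_matrix_of_isoOver [Simple V]
    (h : IsoOver (fun m => FDRep k (Equiv.Perm (Fin m))) V W) :
    ∃ (hm : m = m') (B : Matrix (Fin (Module.finrank k W)) (Fin (Module.finrank k V)) k),
      B ≠ 0 ∧ ∀ τ, B * repMatrix V τ = repMatrix W ((finCongr hm).permCongr τ) * B := by
  obtain ⟨rfl, ⟨i⟩⟩ := h
  change V ≅ W at i
  refine ⟨rfl, LinearMap.toMatrix (Module.finBasis k V) (Module.finBasis k W) i.hom.hom.hom.hom,
    fun h => ?_, fun τ => ?_⟩
  · have h1 : i.hom.hom.hom.hom = 0 := (LinearMap.toMatrix _ _).map_eq_zero_iff.1 h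
    have h2 : i.hom = 0 := Action.Hom.ext (InducedCategory.hom_ext (ModuleCat.hom_ext h1))
    refine id_nonzero V ?_
    rw [← i.hom_inv_id, h2, Limits.zero_comp]
  · have h1 : repMatrix W ((finCongr rfl).permCongr τ) = repMatrix W τ := rfl
    rw [h1]
    exact (LinearMap.toMatrix_comp _ _ _ _ _).symm.trans ((congrArg _ (hom_comm i.hom τ)).trans
      (LinearMap.toMatrix_comp _ _ _ _ _))

theorem finrank_pos_of_simple [Simple V] : 0 < Module.finrank k V := by
  rw [Nat.pos_iff_ne_zero]
  intro h
  have := Module.finrank_zero_iff.1 h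
  refine id_nonzero V (Action.Hom.ext (InducedCategory.hom_ext (ModuleCat.hom_ext
    (LinearMap.ext fun v => ?_))))
  exact Subsingleton.elim (α := V) _ _

end SymmetricGroups

namespace InductionDatum

open Idempotents

universe u v
variable {k : Type u} [Field k] [CharZero k] [IsAlgClosed k] {t : k} (ht : Transcendental ℚ t)
  {A : Type v} [CommRing A] [Algebra k A] {d d' : InductionDatum A t}

/-- The colour-preserving morphisms consist of recollements that match the blocks of equal characters. -/
theorem Admissible.exists_equiv (hd : d.Admissible) (hd' : d'.Admissible)
    {f : d.indS.X ⟶ d'.indS.X}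
    (hf : ∀ a, PreservesMat (fun i c => indColour d.χ₁ (fun w : d.J => d.χ w.1) i c a) f
      (fun i c => indColour d'.χ₁ (fun w : d'.J => d'.χ w.1) i c a)) {p q}
    {E : Recollement _ _} (hE : (f p q : Recollement _ _ → k) E ≠ 0) :
    d.χ₁ = d'.χ₁ ∧ ∃ b : d.J ≃ d'.J, (∀ w, Sum.inr (b w) ∈ E (Sum.inr w)) ∧
      ∀ w, d'.χ (b w).1 = d.χ w.1 :=
  exists_equiv_of_colour (χ := fun w : d.J => d.χ w.1) (χ' := fun w : d'.J => d'.χ w.1)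
    (fun c e hce => AlgHom.ext fun a => hf a p q E hE c e hce) (fun w => hd.ne w.1)
    fun w => hd'.ne w.1

include ht in
/-- The component at the identity of `J` of a colour-preserving endomorphism is a multiple of the identity of
`M₁` by Schur's lemma for `M₁`, tensored with a matrix, which is a scalar by Schur's lemma for the `M j`. -/
theorem Admissible.simple (hd : d.Admissible) : Simple d.ind := by
  have := hd.simple_M₁
  have := hd.simple_M
  have hst := transcendental_sub_natCast ht (∑ j, d.n j)
  have hinj : Function.Injective (Equiv.Perm.sigmaCongrRightHom fun j => Fin (d.n j)) :=
    Equiv.Perm.sigmaCongrRightHom_injective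
  have hG : (Fintype.card (∀ j, Equiv.Perm (Fin (d.n j))) : k) ≠ 0 :=
    Nat.cast_ne_zero.2 Fintype.card_ne_zero
  have hM := p_ne_zero_of_simple d.M₁
  have hpart := blockPart_indIdem (t := t) hinj (R := tensorMatrix d.M) d.M₁ 1
  simp only [map_one] at hpart
  refine simple_colouredRep ht ?_ fun F hF => ?_
  · intro h
    let x : ∀ j, Fin (Module.finrank k (d.M j)) := fun j => ⟨0, finrank_pos_of_simple⟩
    have h1 := hpart x x
    have h2 : indIdem t (Equiv.Perm.sigmaCongrRightHom fun j => Fin (d.n j)) (tensorMatrix d.M)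
      d.M₁ = 0 := congrArg Karoubi.Hom.f h
    rw [h2, Matrix.one_apply_eq, one_smul] at h1
    exact smul_ne_zero (inv_ne_zero hG) hM h1.symm
  · have hFp : indIdem t (Equiv.Perm.sigmaCongrRightHom fun j => Fin (d.n j)) (tensorMatrix d.M)
      d.M₁ ≫ F.f = F.f := Karoubi.p_comp F
    have hFp' : F.f ≫ indIdem t (Equiv.Perm.sigmaCongrRightHom fun j => Fin (d.n j))
      (tensorMatrix d.M) d.M₁ = F.f := Karoubi.comp_p F
    have hsupp : ∀ p q (E : Recollement _ _), (F.f p q : Recollement _ _ → k) E ≠ 0 →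
        ∃ τ, ∀ w, Sum.inr (Equiv.Perm.sigmaCongrRightHom (fun j => Fin (d.n j)) τ w) ∈
          E (Sum.inr w) := by
      intro p q E hE
      obtain ⟨-, b, hb, hb'⟩ := hd.exists_equiv hd hF hE
      obtain ⟨τ, rfl⟩ := exists_sigmaCongrRightHom_eq b fun w => hd.injective (hb' w)
      exact ⟨τ, hb⟩
    have hblock : IsBlock F.f := fun p q E hE => (hsupp p q E hE).imp' _ fun _ h => h
    have h1 : ∀ x y, ∃ c : k, blockPart (Equiv.refl d.J) F.f x y = c • d.M₁.p := by
      intro x y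
      have hl := blockPart_left d.card_J hblock hFp 1 (Equiv.refl _) x y
      have hr := blockPart_right d.card_J d.card_J hblock hFp' 1 (Equiv.refl _) x y
      simp only [map_one, Matrix.one_apply, ite_smul, one_smul, zero_smul, Finset.sum_ite_eq',
        Finset.sum_ite_eq, Finset.mem_univ, if_true] at hl hr
      have hl' : d.M₁.p ≫ blockPart (Equiv.refl d.J) F.f x y =
        blockPart (Equiv.refl d.J) F.f x y := hl.symm
      have hr' : blockPart (Equiv.refl d.J) F.f x y ≫ d.M₁.p =
        blockPart (Equiv.refl d.J) F.f x y := hr.symm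
      obtain ⟨c, hc⟩ := end_eq_smul hst (M := d.M₁)
        ⟨blockPart (Equiv.refl d.J) F.f x y, by rw [hr', hl']⟩
      exact ⟨c, congrArg Karoubi.Hom.f hc⟩
    choose L hL using h1
    obtain ⟨c, hc⟩ := tensor_eq_smul d.M (L := Matrix.of fun y x => L x y) fun σ =>
      intertwines_of_blockPart (i := 𝟙 d.M₁) d.card_J d.card_J hblock hFp hFp' (id_nonzero _)
        (fun x y => hL x y) (τ := σ) (τ' := σ) (Equiv.ext fun _ => rfl)
    refine ⟨c * Fintype.card (∀ j, Equiv.Perm (Fin (d.n j))), Karoubi.hom_ext _ _ ?_⟩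
    change F.f = (c * Fintype.card (∀ j, Equiv.Perm (Fin (d.n j)))) • indIdem t
      (Equiv.Perm.sigmaCongrRightHom fun j => Fin (d.n j)) (tensorMatrix d.M) d.M₁
    refine ext_of_blockPart d.card_J d.card_J (Equiv.refl _) hFp' ?_ hsupp ?_ fun x y => ?_
    · rw [Linear.smul_comp, indIdem_comp d.card_J]
    · intro p q E hE
      exact indIdem_support fun h => hE ((congrArg _ h).trans (mul_zero _))
    · have h2 : L x y = c * (1 : Matrix _ _ k) y x := congrFun (congrFun hc y) x
      refine (hL x y).trans ?_
      rw [h2, blockPart_smul]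
      refine Eq.trans ?_ (congrArg _ (hpart x y)).symm
      rw [smul_smul, smul_smul]
      congr 1
      field_simp

end InductionDatum

/-! ### Isomorphisms between the induced objects -/

section Blocks

variable {l l' : ℕ} {n : Fin l → ℕ} {n' : Fin l' → ℕ}

/-- A bijection that respects injective labels of nonempty blocks permutes the blocks. -/
theorem exists_block_equiv {C : Type*} {χ : Fin l → C} {χ' : Fin l' → C}
    (hχ : Function.Injective χ) (hχ' : Function.Injective χ') (hn : ∀ j, 0 < n j)
    (hn' : ∀ j, 0 < n' j) (b : (Σ j, Fin (n j)) ≃ Σ j, Fin (n' j))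
    (hb : ∀ w, χ' (b w).1 = χ w.1) :
    ∃ π : Fin l ≃ Fin l', (∀ j, n j = n' (π j)) ∧ ∀ j, χ j = χ' (π j) := by
  have hb' : ∀ w, χ (b.symm w).1 = χ' w.1 := fun w => by rw [← hb, b.apply_symm_apply]
  let π : Fin l ≃ Fin l' :=
    { toFun := fun j => (b ⟨j, ⟨0, hn j⟩⟩).1
      invFun := fun j => (b.symm ⟨j, ⟨0, hn' j⟩⟩).1
      left_inv := fun j => hχ ((hb' _).trans (hb _))
      right_inv := fun j => hχ' ((hb _).trans (hb' _)) }
  have hπ : ∀ j, χ j = χ' (π j) := fun j => (hb ⟨j, ⟨0, hn j⟩⟩).symm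
  refine ⟨π, fun j => ?_, hπ⟩
  have e : {w : Σ j, Fin (n j) // w.1 = j} ≃ {w : Σ j, Fin (n' j) // w.1 = π j} :=
    b.subtypeEquiv fun w => by rw [← hχ.eq_iff, ← hχ'.eq_iff, hb, ← hπ]
  simpa using Fintype.card_congr
    ((Equiv.sigmaSubtype (β := fun j => Fin (n j)) j).symm.trans (e.trans (Equiv.sigmaSubtype _)))

/-- The bijection between the unions of the blocks that is given by a bijection between the blocks. -/
abbrev blockEquiv (π : Fin l ≃ Fin l') (h : ∀ j, n j = n' (π j)) :
    (Σ j, Fin (n j)) ≃ Σ j, Fin (n' j) :=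
  Equiv.sigmaCongr π fun j => finCongr (h j)

theorem blockEquiv_comm (π : Fin l ≃ Fin l') (h : ∀ j, n j = n' (π j))
    {τ : ∀ j, Equiv.Perm (Fin (n j))} {τ' : ∀ j, Equiv.Perm (Fin (n' j))}
    (hτ : ∀ j, τ' (π j) = (finCongr (h j)).permCongr (τ j)) :
    (Equiv.Perm.sigmaCongrRightHom (fun j => Fin (n j)) τ).trans (blockEquiv π h) =
      (blockEquiv π h).trans (Equiv.Perm.sigmaCongrRightHom (fun j => Fin (n' j)) τ') := by
  refine Equiv.ext fun ⟨j, x⟩ => ?_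
  change (⟨π j, finCongr (h j) (τ j x)⟩ : Σ j, Fin (n' j)) = ⟨π j, τ' (π j) (finCongr (h j) x)⟩
  rw [hτ]
  simp [Equiv.permCongr_apply]

universe u
variable {k : Type u} [Field k] {M : ∀ j, FDRep k (Equiv.Perm (Fin (n j)))}
  {M' : ∀ j, FDRep k (Equiv.Perm (Fin (n' j)))}

/-- The tensor product of intertwining matrices is an intertwining matrix. -/
theorem exists_tensor_intertwiner (π : Fin l ≃ Fin l') (h : ∀ j, n j = n' (π j))
    (B : ∀ j, Matrix (Fin (Module.finrank k (M' (π j)))) (Fin (Module.finrank k (M j))) k)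
    (h0 : ∀ j, B j ≠ 0)
    (hB : ∀ j τ, B j * repMatrix (M j) τ =
      repMatrix (M' (π j)) ((finCongr (h j)).permCongr τ) * B j) :
    ∃ L : Matrix (∀ j, Fin (Module.finrank k (M' j))) (∀ j, Fin (Module.finrank k (M j))) k,
      L ≠ 0 ∧ ∀ τ τ', (∀ j, τ' (π j) = (finCongr (h j)).permCongr (τ j)) →
        L * tensorMatrix M τ = tensorMatrix M' τ' * L := by
  let e := Equiv.piCongrLeft (fun j => Fin (Module.finrank k (M' j))) π
  refine ⟨Matrix.of fun y x => ∏ j, B j (y (π j)) (x j), fun hL => ?_, fun τ τ' hτ => ?_⟩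
  · have h1 : ∀ j, ∃ y x, B j y x ≠ 0 := by
      intro j
      by_contra hcon
      push Not at hcon
      exact h0 j (Matrix.ext hcon)
    choose y x hyx using h1
    have h2 : ∏ j, B j (e y (π j)) (x j) = 0 := congrFun (congrFun hL (e y)) x
    simp only [e, Equiv.piCongrLeft_apply_apply] at h2
    exact Finset.prod_ne_zero_iff.2 (fun j _ => hyx j) h2
  · ext y x
    simp only [Matrix.mul_apply, Matrix.of_apply, tensorMatrix_apply]
    rw [← e.sum_comp]
    simp only [← π.prod_comp fun j => repMatrix (M' j) (τ' j) _ _, e,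
      Equiv.piCongrLeft_apply_apply, ← Finset.prod_mul_distrib, hτ]
    have h1 : ∀ j, ∑ c, B j (y (π j)) c * repMatrix (M j) (τ j) c (x j) =
        ∑ c, repMatrix (M' (π j)) ((finCongr (h j)).permCongr (τ j)) (y (π j)) c *
          B j c (x j) := fun j => by
      have := congrFun (congrFun (hB j (τ j)) (y (π j))) (x j)
      simpa only [Matrix.mul_apply] using this
    have h2 := congrArg (fun F : Fin l → k => ∏ j, F j) (funext h1)
    simpa only [Finset.prod_univ_sum, Fintype.piFinset_univ] using h2

end Blocks

namespace InductionDatum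

open Idempotents

universe u v
variable {k : Type u} [Field k] [CharZero k] [IsAlgClosed k] {t : k} (ht : Transcendental ℚ t)
  {A : Type v} [CommRing A] [Algebra k A] {d d' : InductionDatum A t}

include ht in
/-- A nonzero morphism between induced objects matches the blocks by their characters, and gives intertwiners of
the representations of matching blocks. -/
theorem Admissible.equivalent (hd : d.Admissible) (hd' : d'.Admissible) (f : d.ind ⟶ d'.ind)
    (h0 : f ≠ 0) : d.Equivalent d' := by
  have := hd.simple_M₁
  have := hd'.simple_M₁
  have := hd.simple_M
  have := hd'.simple_M
  let F : d.indS ⟶ d'.indS := RepWreath.Hom.hom f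
  have hF0 : F.f ≠ 0 := fun h => h0 (RepWreath.hom_ext (Karoubi.hom_ext _ _ h))
  have hF : ∀ a, PreservesMat (fun i c => indColour d.χ₁ (fun w : d.J => d.χ w.1) i c a) F.f
      (fun i c => indColour d'.χ₁ (fun w : d'.J => d'.χ w.1) i c a) := fun a =>
    (comm_iff_preservesMat ht F a).1 (RepWreath.Hom.comm f a)
  obtain ⟨p, q, E, hE⟩ : ∃ p q, ∃ E : Recollement _ _, (F.f p q : Recollement _ _ → k) E ≠ 0 := by
    by_contra hcon
    push Not at hcon
    exact hF0 (funext fun p => funext fun q => funext fun E => hcon p q E)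
  obtain ⟨hχ₁, b, -, hb⟩ := hd.exists_equiv hd' hF hE
  obtain ⟨π, hn, hχ⟩ := exists_block_equiv hd.injective hd'.injective hd.pos hd'.pos b hb
  obtain ⟨h1, L, hL0, hL⟩ := exists_intertwiner (transcendental_sub_natCast ht _) d.card_J
    d'.card_J (blockEquiv π hn) hF0 (Karoubi.p_comp F) (Karoubi.comp_p F) fun p q E hE => by
      obtain ⟨-, c, hc, hc'⟩ := hd.exists_equiv hd' hF hE
      obtain ⟨τ, hτ⟩ := exists_sigmaCongrRightHom_eq ((blockEquiv π hn).symm.trans c) fun w => by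
        obtain ⟨⟨j, x⟩, rfl⟩ := (blockEquiv π hn).surjective w
        rw [Equiv.trans_apply, Equiv.symm_apply_apply]
        exact hd'.injective ((hc' _).trans (hχ j))
      refine ⟨τ, fun w => ?_⟩
      rw [hτ, Equiv.trans_apply, Equiv.symm_apply_apply]
      exact hc w
  refine ⟨hχ₁, h1, π, fun j => ⟨hχ j, ?_⟩⟩
  obtain ⟨B, hB0, hB⟩ := exists_factor d.M hL0 j (π j) (finCongr (hn j)).permCongr fun τ =>
    hL _ _ (blockEquiv_comm π hn fun i => by
      by_cases hi : i = j
      · subst hi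
        rw [Pi.mulSingle_eq_same, Pi.mulSingle_eq_same]
      · rw [Pi.mulSingle_eq_of_ne hi, Pi.mulSingle_eq_of_ne (π.injective.ne hi)]
        ext; simp [Equiv.permCongr_apply])
  exact isoOver_of_matrix (hn j) hB0 hB

include ht in
theorem Equivalent.nonempty_iso (h : d.Equivalent d') (hd : d.Admissible) (hd' : d'.Admissible) :
    Nonempty (d.ind ≅ d'.ind) := by
  have := hd.simple_M₁
  have := hd.simple_M
  obtain ⟨π, hπ⟩ := h.exists_perm
  choose hn B hB0 hB using fun j => exists_matrix_of_isoOver (hπ j).2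
  obtain ⟨L, hL0, hL⟩ := exists_tensor_intertwiner π hn B hB0 hB
  have hp : ∀ j, d'.χ (π j) = d.χ j := fun j => (hπ j).1.symm
  obtain ⟨f, Φ, hf0, hf, hf', hfΦ⟩ := exists_hom_of_intertwiner d.card_J d'.card_J
    (p_ne_zero_of_simple d.M₁) h.iso₁ (Equiv.Perm.sigmaCongrRightHom_injective) (blockEquiv π hn)
    hL0 (θ' := Equiv.Perm.sigmaCongrRightHom fun j => Fin (d'.n j)) (R := tensorMatrix d.M)
    (R' := tensorMatrix d'.M) fun τ' => by
      have hτ : ∀ j, τ' (π j) = (finCongr (hn j)).permCongr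
          ((finCongr (hn j)).permCongr.symm (τ' (π j))) := fun j =>
        ((finCongr (hn j)).permCongr.apply_symm_apply _).symm
      exact ⟨_, blockEquiv_comm π hn hτ, hL _ _ hτ⟩
  let F : d.indS ⟶ d'.indS := ⟨f, by
    change indIdem _ _ _ _ ≫ f ≫ indIdem _ _ _ _ = f
    rw [hf', hf]⟩
  have hF : ∀ a, PreservesMat (fun i c => indColour d.χ₁ (fun w : d.J => d.χ w.1) i c a) F.f
      (fun i c => indColour d'.χ₁ (fun w : d'.J => d'.χ w.1) i c a) := by
    intro a
    change PreservesMat _ f _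
    rw [hfΦ, ← h.χ₁_eq]
    exact (indIdem_preserves d.χ₁ (fun w : d.J => d.χ w.1) (fun χ => χ a) (fun _ _ => rfl) _ _).comp
      ht fun p q => blockKer_preserves d.χ₁ (fun χ => χ a) (fun w => hp w.1) (Φ p q)
  have := hd.simple ht
  have := hd'.simple ht
  let g : d.ind ⟶ d'.ind := RepWreath.Hom.mk F fun a => (comm_iff_preservesMat ht F a).2 (hF a)
  have hg : g ≠ 0 := fun h => hf0 (congrArg (fun g => (RepWreath.Hom.hom g).f) h)
  have := RepWreath.isIso_of_simple ht hg
  exact ⟨asIso g⟩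

include ht in
theorem Admissible.nonempty_iso_iff (hd : d.Admissible) (hd' : d'.Admissible) :
    Nonempty (d.ind ≅ d'.ind) ↔ d.Equivalent d' := by
  refine ⟨fun ⟨i⟩ => hd.equivalent ht hd' i.hom fun h => ?_, fun h => h.nonempty_iso ht hd hd'⟩
  have := hd.simple ht
  refine id_nonzero d.ind ?_
  rw [← i.hom_inv_id, h, Limits.zero_comp]

end InductionDatum

/-! ### Every simple object is induced -/

section Summand

open Idempotents

universe u
variable {k : Type u} [Field k] [IsAlgClosed k] [CharZero k] {s : k} (hst : Transcendental ℚ s)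

include hst in
/-- A linear map that does not vanish on the identity of `N` does not vanish on the projection to some
simple summand of `N`. -/
theorem exists_simple_summand {E : Type*} [AddCommGroup E] [Module k E] (m : ℕ) (N : RepS s)
    (hm : Module.finrank k (N ⟶ N) = m) (Ψ : (N ⟶ N) →ₗ[k] E) (h : Ψ (𝟙 N) ≠ 0) :
    ∃ (M : RepS s) (i : M ⟶ N) (p : N ⟶ M), Simple M ∧ Ψ (p ≫ i) ≠ 0 := by
  induction m using Nat.strong_induction_on generalizing N with
  | _ m ih =>
  by_cases hN : Simple N
  · exact ⟨N, 𝟙 N, 𝟙 N, hN, by rwa [Category.comp_id]⟩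
  have h1 : 𝟙 N ≠ 0 := fun h0 => h (by rw [h0, map_zero])
  rw [simple_iff_idempotents hst] at hN
  push Not at hN
  obtain ⟨e, he, he0, he1⟩ := hN h1
  obtain ⟨e, he, he1, hΨ⟩ : ∃ e : N ⟶ N, e ≫ e = e ∧ e ≠ 𝟙 N ∧ Ψ e ≠ 0 := by
    by_cases hΨ : Ψ e = 0
    · refine ⟨𝟙 N - e, ?_, ?_, ?_⟩
      · simp [he]
      · exact fun h2 => he0 (by simpa using h2)
      · rwa [map_sub, hΨ, sub_zero]
    · exact ⟨e, he, he1, hΨ⟩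
  let φ : (summand N e he ⟶ summand N e he) →ₗ[k] (N ⟶ N) :=
    { toFun := fun f => summandπ N e he ≫ f ≫ summandι N e he
      map_add' := fun f g => by simp
      map_smul' := fun c f => by simp }
  have hφ : Function.Injective φ := by
    intro f g hfg
    have h2 : summandι N e he ≫ φ f ≫ summandπ N e he =
        summandι N e he ≫ φ g ≫ summandπ N e he := by rw [hfg]
    simpa [φ, summandι_π, reassoc_of% summandι_π N e he] using h2
  -- the endomorphisms of the summand are those of the form `e f e`, and the identity is not
  have hlt : Module.finrank k (summand N e he ⟶ summand N e he) < m := by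
    rw [← hm, ← LinearMap.finrank_range_of_inj hφ]
    refine Submodule.finrank_lt fun htop => he1 ?_
    obtain ⟨f, hf⟩ : 𝟙 N ∈ LinearMap.range φ := htop ▸ Submodule.mem_top
    have h2 : φ f ≫ e = φ f := by
      change (summandπ N e he ≫ f ≫ summandι N e he) ≫ e = _
      rw [Category.assoc, Category.assoc, summandι_comp]
      rfl
    rwa [hf, Category.id_comp] at h2
  obtain ⟨M, i, p, hM, hp⟩ := ih _ hlt _ rfl (Ψ.comp φ) (by
    change Ψ (summandπ N e he ≫ 𝟙 _ ≫ summandι N e he) ≠ 0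
    rwa [Category.id_comp, summandπ_ι])
  refine ⟨M, i ≫ summandι N e he, summandπ N e he ≫ p, hM, ?_⟩
  rw [Category.assoc, ← Category.assoc p]
  exact hp

end Summand

/-- A coloured set is the disjoint union of the points of one colour `i₀` and of the blocks of the points of the
other colours, which are numbered in the decreasing order of their sizes. -/
theorem exists_block_decomposition {V : Type} [Fintype V] {ι : Type*} (κ : V → ι) (i₀ : ι) :
    ∃ (l : ℕ) (n : Fin l → ℕ) (c : Fin l → ι) (φ : V ≃ {v // κ v = i₀} ⊕ Σ j, Fin (n j)),
      Function.Injective c ∧ (∀ j, c j ≠ i₀) ∧ (∀ j, 0 < n j) ∧ Antitone n ∧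
      ∀ o : Option V, blockColour i₀ (fun w : Σ j, Fin (n j) => c w.1) (o.map φ) =
        o.elim i₀ κ := by
  classical
  let S : Finset ι := (Finset.univ.image κ).erase i₀
  let size : ι → ℕ := fun i => Fintype.card {v // κ v = i}
  let c₀ : Fin S.card → ι := fun j => (S.equivFin.symm j).1
  let σ := Tuple.sort fun j => OrderDual.toDual (size (c₀ j))
  let c : Fin S.card → ι := c₀ ∘ σ
  have hc : Function.Injective c :=
    (Subtype.val_injective.comp S.equivFin.symm.injective).comp σ.injective
  have hS : ∀ j, c j ∈ S := fun j => (S.equivFin.symm (σ j)).2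
  have hS' : ∀ i ∈ S, ∃ j, c j = i := fun i hi =>
    ⟨σ.symm (S.equivFin ⟨i, hi⟩), by simp [c, c₀]⟩
  let ψ : {v // κ v = i₀} ⊕ (Σ j, Fin (size (c j))) → V :=
    Sum.elim Subtype.val fun w => ((Fintype.equivFin {v // κ v = c w.1}).symm w.2).1
  have hκ : ∀ x, κ (ψ x) = blockColour i₀ (fun w : Σ j, Fin (size (c j)) => c w.1) (some x) := by
    rintro (u | w)
    · exact u.2
    · exact ((Fintype.equivFin {v // κ v = c w.1}).symm w.2).2
  have hne : ∀ j, c j ≠ i₀ := fun j => Finset.ne_of_mem_erase (hS j)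
  have hψ : Function.Bijective ψ := by
    constructor
    · rintro (u | ⟨j, x⟩) (u' | ⟨j', x'⟩) h
      · exact congrArg Sum.inl (Subtype.ext h)
      · exact absurd ((hκ _).symm.trans ((congrArg κ h).trans (hκ _))).symm (hne j')
      · exact absurd ((hκ _).symm.trans ((congrArg κ h).trans (hκ _))) (hne j)
      · obtain rfl : j = j' := hc ((hκ _).symm.trans ((congrArg κ h).trans (hκ _)))
        obtain rfl : x = x' :=
          (Fintype.equivFin {v // κ v = c j}).symm.injective (Subtype.ext h)
        rfl
    · intro v
      by_cases hv : κ v = i₀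
      · exact ⟨.inl ⟨v, hv⟩, rfl⟩
      · obtain ⟨j, hj⟩ := hS' (κ v) (Finset.mem_erase.2
          ⟨hv, Finset.mem_image_of_mem κ (Finset.mem_univ v)⟩)
        refine ⟨.inr ⟨j, Fintype.equivFin {v // κ v = c j} ⟨v, hj.symm⟩⟩, ?_⟩
        simp [ψ]
  refine ⟨S.card, fun j => size (c j), c, (Equiv.ofBijective ψ hψ).symm, hc, hne, fun j => ?_,
    fun j j' hjj => Tuple.monotone_sort (fun j => OrderDual.toDual (size (c₀ j))) hjj, fun o => ?_⟩
  · obtain ⟨v, -, hv⟩ := Finset.mem_image.1 (Finset.mem_of_mem_erase (hS j))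
    exact Fintype.card_pos_iff.2 ⟨⟨v, hv⟩⟩
  · rcases o with _ | v
    · rfl
    · obtain ⟨x, rfl⟩ := hψ.2 v
      refine Eq.trans ?_ (hκ x).symm
      exact congrArg _ (congrArg some ((Equiv.ofBijective ψ hψ).symm_apply_apply x))

section Colours

open Filter Idempotents

universe u v
variable {k : Type u} [Field k] [CharZero k] [IsAlgClosed k] {s t : k} (ht : Transcendental ℚ t)
  {A : Type v} [CommRing A] [Algebra k A]

theorem pos_equiv_trans {U V I : Type} (φ : V ≃ U) (p : U ↪ I) (i : I) :
    pos p i = (pos (φ.toEmbedding.trans p) i).map φ := by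
  refine Option.ext fun u => ?_
  change u ∈ pos p i ↔ u ∈ (pos (φ.toEmbedding.trans p) i).map φ
  rw [mem_pos, Option.mem_map]
  constructor
  · rintro rfl
    exact ⟨φ.symm u, (mem_pos _ _ _).2 (by simp), by simp⟩
  · rintro ⟨v, hv, rfl⟩
    exact (mem_pos (φ.toEmbedding.trans p) i v).1 hv

include ht in
/-- A morphism out of `[V]` gives one out of `[U ⊔ J]` along a bijection `V ≃ U ⊔ J`. -/
theorem exists_relabel {V U J : Type} [Fintype V] [Fintype U] [Fintype J] {O : Mat_ (Deligne₀ t)}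
    (φ : V ≃ U ⊕ J) {f : single t V ⟶ O} (h0 : f ≠ 0) :
    ∃ g : indMat t (single s U) J Unit ⟶ O, g ≠ 0 ∧ (∀ q : O ⟶ O, f ≫ q = f → g ≫ q = g) ∧
      ∀ (F : hObj O ⟶ O) (κ : Option V → k) (κ' : Option (U ⊕ J) → k),
        (∀ o, κ' (o.map φ) = κ o) → hMap f ≫ F = colourMap (fun _ => κ) f →
        hMap g ≫ F = colourMap (fun _ => κ') g := by
  let g : indMat t (single s U) J Unit ⟶ O := fun _ j => fun E : Recollement (U ⊕ J) _ =>
    (f () j : Recollement _ _ → k) (E.restrict φ.toEmbedding (.refl _))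
  have hg : ∀ n (p : Pts n (indMat t (single s U) J Unit)) q,
      real ht n g p q = real ht n f ⟨(), φ.toEmbedding.trans p.2⟩ q := by
    intro n p q
    refine congrArg (fun E => spec ht ((f () q.1 : Recollement _ _ → k) E) n) ?_
    exact restrict_glued p.2 q.2 φ.toEmbedding (.refl _)
  refine ⟨g, fun h => h0 ?_, fun q hq => eq_of_real ht ?_, fun F κ κ' hκ hF => eq_of_slice ht ?_⟩
  · funext _ j
    funext E
    have h1 : (g ((), ()) j : Recollement _ _ → k)
        (E.restrict φ.symm.toEmbedding (.refl _)) = 0 := by rw [h]; rfl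
    refine (congrArg (f () j : Recollement _ _ → k) (rec_ext fun v w => ?_)).trans h1
    refine Iff.trans ?_ ((mem_restrict (W := V) (X := (O.X j).carrier) _ φ.toEmbedding
      (.refl _) v w).trans (mem_restrict E φ.symm.toEmbedding (.refl _) _ _)).symm
    simp
  · filter_upwards [real_comp ht g q, real_comp ht f q] with n h1 h2
    rw [hq] at h2
    funext p r
    rw [h1, hg, h2, Matrix.mul_apply, Matrix.mul_apply]
    simp only [hg]
  · filter_upwards [slice_hMap_comp ht g F, slice_hMap_comp ht f F, slice_colourMap ht (fun _ => κ) f,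
      slice_colourMap ht (fun _ => κ') g] with n h1 h2 h3 h4 j
    funext p r
    have h5 := congrFun (congrFun (h2 j) ⟨(), φ.toEmbedding.trans p.2⟩) r
    rw [hF, h3] at h5
    rw [h1, h4, Matrix.mul_apply]
    simp only [hg]
    refine h5.symm.trans ?_
    congr 2
    rw [← hκ]
    exact congrArg κ' (pos_equiv_trans φ (p.2 : U ⊕ J ↪ Fin n) j).symm

theorem PreservesMat.sum {ι : Type*} {S : Finset ι} {X Y : Mat_ (Deligne₀ t)} {κ : Colouring X}
    {f : ι → (X ⟶ Y)} {κ' : Colouring Y} (h : ∀ i, PreservesMat κ (f i) κ') :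
    PreservesMat κ (∑ i ∈ S, f i) κ' := by
  intro p q E hE
  rw [mat_sum_apply] at hE
  have h1 : ∑ i ∈ S, (f i p q : Recollement _ _ → k) E ≠ 0 := by
    rwa [← hom_sum_apply]
  obtain ⟨i, -, hi⟩ := Finset.exists_ne_zero_of_sum_ne_zero h1
  exact h i p q E hi

namespace RepWreath

variable {X : RepWreath A t} {ι : Type*} [Fintype ι] [DecidableEq ι] {χ : ι → (A →ₐ[k] k)}
  {a : ι → A} {V : Type} [Fintype V]

/-- If the points of `V` have the colours `κ`, and the points outside have no other component than that of the
colour `i₀`, then all points act through their characters. -/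
theorem IsColoured.hMap_act (h : X.Spectral χ a) {f : single t V ⟶ X.obj.X} {κ : V → ι} {i₀ : ι}
    (hf : X.IsColoured a f κ) (hn : ∀ i, i ≠ i₀ → X.moveNone f (a i) = 0) (b : A) :
    hMap f ≫ X.act b = colourMap (fun _ c => χ (c.elim i₀ κ) b) f := by
  refine eq_of_compAt fun c => ?_
  have h1 : ∀ b, compAt (hMap f ≫ X.act b) c = ∑ i, χ i b • X.move f c (a i) := by
    intro b
    rw [h.act_eq, Preadditive.comp_sum, compAt_sum]
    simp only [Linear.comp_smul]
    rfl
  rw [h1]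
  rcases c with _ | v
  · have h2 : ∀ b, ∑ i, χ i b • X.move f none (a i) = χ i₀ b • X.move f none (a i₀) := by
      intro b
      refine Finset.sum_eq_single i₀ (fun i _ hi => ?_) fun h => absurd (Finset.mem_univ _) h
      have h3 : X.move f none (a i) = 0 := hn i hi
      rw [h3, smul_zero]
    have h3 : X.move f none 1 = X.move f none (a i₀) := by
      refine (h1 1).trans ((h2 1).trans ?_)
      rw [map_one, one_smul]
    rw [h2, ← h3, move_one X hf.comp_p]
    rfl
  · have h2 : ∑ i, χ i b • moveSome X f v (a i) = χ (κ v) b • f := by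
      simp only [hf.move_eq, smul_ite, smul_zero, Finset.sum_ite_eq, Finset.mem_univ, if_true]
    refine Eq.trans h2 ?_
    funext _ j
    exact congrArg (fun Φ => χ (κ v) b • Φ) (sKer_some (f () j) v).symm

end RepWreath

end Colours

section Classification

open Idempotents

universe u v
variable {k : Type u} [Field k] [CharZero k] [IsAlgClosed k] {t : k} (ht : Transcendental ℚ t)
  {A : Type v} [CommRing A] [Algebra k A]

theorem blockKer_idCoeff {U J : Type} [Fintype U] [Fintype J] :
    blockKer (Equiv.refl J) (idCoeff : Recollement U U → k) = idCoeff := by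
  funext E
  have h : (∀ w : J, Sum.inr w ∈ E (Sum.inr w)) → E.restrict .inl .inl = PEquiv.refl U →
      E = PEquiv.refl _ := by
    intro h1 h2
    refine PEquiv.ext fun x => ?_
    rcases x with u | w
    · have h3 : u ∈ E.restrict .inl .inl u := by rw [h2]; rfl
      exact (mem_restrict E .inl .inl u u).1 h3
    · exact h1 w
  by_cases hE : E = PEquiv.refl _
  · subst hE
    have h2 : Recollement.restrict (PEquiv.refl (U ⊕ J)) .inl .inl = PEquiv.refl U :=
      rec_ext fun u v => (mem_restrict _ _ _ u v).trans (by
        simp [PEquiv.refl_apply])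
    refine (if_pos fun w => rfl).trans ?_
    rw [h2]
    exact (if_pos rfl).trans (if_pos rfl).symm
  · refine Eq.trans ?_ (if_neg hE).symm
    unfold blockKer ker
    split_ifs with h1
    · exact if_neg fun h2 => hE (h h1 h2)
    · rfl

theorem blockKer_zero {U W J J' : Type} (b : J ≃ J') :
    blockKer b (0 : Recollement U W → k) = 0 :=
  funext fun _ => ite_self _

theorem blockKer_add {U W J J' : Type} (b : J ≃ J') (Φ Ψ : Recollement U W → k) :
    blockKer b (Φ + Ψ) = blockKer b Φ + blockKer b Ψ := by
  funext E
  simp only [blockKer, ker, Pi.add_apply]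
  split_ifs
  · rfl
  · rw [add_zero]

theorem blockMap_refl_one {s : k} {J : Type} [Fintype J] (X : Mat_ (Deligne₀ s)) :
    blockMap t (Equiv.refl J) (fun _ _ : Unit => 𝟙 X) = 𝟙 (indMat t X J Unit) := by
  classical
  funext ⟨i, _⟩ ⟨j, _⟩
  by_cases h : i = j
  · subst h
    refine Eq.trans ?_ (Mat_.id_apply_self (indMat t X J Unit) (i, ())).symm
    refine Eq.trans ?_ (blockKer_idCoeff (U := (X.X i).carrier))
    exact congrArg (blockKer _) (Mat_.id_apply_self X i)
  · refine Eq.trans ?_ (Mat_.id_apply_of_ne (indMat t X J Unit) (i, ()) (j, ())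
      fun h1 => h (congrArg Prod.fst h1)).symm
    refine Eq.trans ?_ (blockKer_zero (Equiv.refl J))
    exact congrArg (blockKer _) (Mat_.id_apply_of_ne X i j h)

/-- A nonzero morphism out of `⨁ [U_i ⊔ J]`, which is induced from `Y` and the regular representation of the
permutations of the blocks, is nonzero on the part that is induced from some simple summand `M₁` of
`Y` and some simple representations `M j`. The morphism `K` is the map from the induced
object that the vector `x₀` of the dual of `⨂ M j` defines. -/
theorem exists_hom_of_block {l : ℕ} {n : Fin l → ℕ} {s : k} {Y : Mat_ (Deligne₀ s)}
    (hs : s = t - Fintype.card (Σ j, Fin (n j))) (hst : Transcendental ℚ s)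
    {O : Mat_ (Deligne₀ t)} {f : indMat t Y (Σ j, Fin (n j)) Unit ⟶ O} (h0 : f ≠ 0) :
    ∃ (M₁ : RepS s) (M : ∀ j, FDRep k (Equiv.Perm (Fin (n j)))) (i : M₁.X ⟶ Y)
      (x₀ : ∀ j, Fin (Module.finrank k (M j))),
      Simple M₁ ∧ (∀ j, Simple (M j)) ∧
      let K := ∑ σ, blockMap t (Equiv.Perm.sigmaCongrRightHom (fun j => Fin (n j)) σ)
        (fun x (_ : Unit) => tensorMatrix M σ x₀ x • i)
      K ≫ f ≠ 0 ∧ indIdem t (Equiv.Perm.sigmaCongrRightHom fun j => Fin (n j)) (tensorMatrix M)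
        M₁ ≫ K = K := by
  let θ := Equiv.Perm.sigmaCongrRightHom fun j => Fin (n j)
  let N : RepS s := ⟨Y, 𝟙 Y, Category.comp_id _⟩
  let Ψ : (N ⟶ N) →ₗ[k] (indMat t Y (Σ j, Fin (n j)) Unit ⟶ O) :=
    { toFun := fun g => blockMap t (Equiv.refl _) (fun _ _ : Unit => g.f) ≫ f
      map_add' := fun g h => by
        rw [← Preadditive.add_comp]
        congr 1
        funext p q
        exact blockKer_add _ _ _
      map_smul' := fun c g => by
        rw [RingHom.id_apply, ← Linear.smul_comp]
        congr 1
        funext p q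
        exact blockKer_smul _ _ _ }
  obtain ⟨M₁, i, p, hM₁, hp⟩ := exists_simple_summand hst _ N rfl Ψ (by
    change blockMap t (Equiv.refl _) (fun _ _ : Unit => 𝟙 Y) ≫ f ≠ 0
    rwa [blockMap_refl_one, Category.id_comp])
  obtain ⟨M, x₀, y₀, hM, hne⟩ := exists_sum_tensorMatrix_ne_zero (k := k)
    (fun σ => blockMap t (θ σ) (fun _ _ : Unit => p.f ≫ i.f) ≫ f) (by
      rw [map_one]
      exact hp)
  refine ⟨M₁, M, i.f, x₀, hM₁, hM, fun h => hne ?_, ?_⟩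
  · classical
    -- the component of `K` on the basis vector `y₀` is the given combination
    let q : indMat t Y (Σ j, Fin (n j)) Unit ⟶ indMat t M₁.X (Σ j, Fin (n j))
        (∀ j, Fin (Module.finrank k (M j))) :=
      blockMap t (Equiv.refl _) fun _ x => if x = y₀ then p.f else 0
    rw [← Limits.comp_zero (f := q), ← h, ← Category.assoc, Preadditive.comp_sum,
      Preadditive.sum_comp]
    refine Finset.sum_congr rfl fun σ _ => ?_
    rw [blockMap_comp hs, ← Linear.smul_comp]
    congr 1
    have h1 : ∀ x, (if x = y₀ then p.f else 0) ≫ (tensorMatrix M σ x₀ x • i.f) =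
        if x = y₀ then tensorMatrix M σ x₀ y₀ • p.f ≫ i.f else 0 := by
      intro x
      split_ifs with hx
      · rw [hx, Linear.comp_smul]
      · rw [Limits.zero_comp]
    simp only [h1, Finset.sum_ite_eq', Finset.mem_univ, if_true]
    funext p q
    exact (blockKer_smul _ _ _).symm
  · have hG : (Fintype.card (∀ j, Equiv.Perm (Fin (n j))) : k) ≠ 0 :=
      Nat.cast_ne_zero.2 Fintype.card_ne_zero
    have h1 : ∀ τ, indTerm t θ (tensorMatrix M) M₁ τ ≫ (∑ σ, blockMap t (θ σ)
        (fun x (_ : Unit) => tensorMatrix M σ x₀ x • i.f)) = ∑ σ, blockMap t (θ σ)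
        (fun x (_ : Unit) => tensorMatrix M σ x₀ x • i.f) := by
      intro τ
      rw [Preadditive.comp_sum]
      refine Fintype.sum_equiv (Equiv.mulRight τ) _ _ fun σ => ?_
      rw [indTerm_eq_blockMap, blockMap_comp hs, Equiv.coe_mulRight, map_mul, map_mul]
      congr 1
      funext x _
      simp only [Linear.comp_smul, Linear.smul_comp, Karoubi.p_comp, smul_smul, ← Finset.sum_smul]
      rfl
    change indIdem t θ (tensorMatrix M) M₁ ≫ _ = _
    rw [indIdem, Linear.smul_comp, Preadditive.sum_comp]
    refine (congrArg _ (Finset.sum_congr rfl fun τ _ => h1 τ)).trans ?_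
    rw [Finset.sum_const, Finset.card_univ, ← Nat.cast_smul_eq_nsmul k, smul_smul,
      inv_mul_cancel₀ hG, one_smul]

/-- A morphism of the additive envelope that absorbs the projections and commutes with the actions is a
morphism from the coloured object. -/
theorem exists_hom_of_colouredRep {N : RepS t} {χ : ∀ i, Option (N.X.X i).carrier → (A →ₐ[k] k)}
    {h : ∀ a, PreservesMat (fun i c => χ i c a) N.p (fun i c => χ i c a)} {X : RepWreath A t}
    {f : N.X ⟶ X.obj.X} (hp : N.p ≫ f = f) (hp' : f ≫ X.obj.p = f)
    (hf : ∀ b, hMap f ≫ X.act b = colourMap (fun i c => χ i c b) f) :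
    ∃ F : colouredRep N χ h ⟶ X, (RepWreath.Hom.hom F).f = f := by
  let G : N ⟶ X.obj := ⟨f, by rw [hp', hp]⟩
  have hG : ∀ b, (hFunctor t).map G ≫ X.y b = (colouredRep N χ h).y b ≫ G := by
    intro b
    refine Karoubi.hom_ext _ _ ?_
    change hMap f ≫ X.act b = colourMap (fun i c => χ i c b) N.p ≫ f
    rw [hf, colourMap_comp, hp]
  exact ⟨RepWreath.Hom.mk G hG, rfl⟩

include ht in
/-- The blocks are the colour classes of a coloured morphism `[V] → X`, apart from the class of `χ₁`. -/
theorem RepWreath.exists_iso_ind (X : RepWreath A t) [hX : Simple X] :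
    ∃ d : InductionDatum A t, d.Admissible ∧ Nonempty (X ≅ d.ind) := by
  have h0 : X.obj.p ≠ 0 := fun h =>
    id_nonzero X (RepWreath.hom_ext (Karoubi.hom_ext _ _ h))
  obtain ⟨ι, _, _, χ, a, hχ⟩ := exists_spectral ht (X := X)
  obtain ⟨V, _, f, κ, i₀, hf, hn⟩ := exists_total ht hχ h0
  obtain ⟨l, n, c, φ, hc, hci, hpos, hanti, hφ⟩ := exists_block_decomposition κ i₀
  classical
  let s : k := t - ((∑ j, n j : ℕ) : k)
  have hs : s = t - Fintype.card (Σ j, Fin (n j)) := by simp [s]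
  have hst : Transcendental ℚ s := transcendental_sub_natCast ht _
  obtain ⟨g, hg0, hgp, hg⟩ := exists_relabel (s := s) ht φ hf.ne_zero
  obtain ⟨M₁, M, i, x₀, hM₁, hM, hK0, hK⟩ := exists_hom_of_block hs hst hg0
  let d : InductionDatum A t := ⟨l, n, χ i₀, M₁, fun j => χ (c j), M⟩
  have hd : d.Admissible :=
    ⟨hM₁, hM, hpos, hanti, hχ.injective.comp hc, fun j h => hci j (hχ.injective h)⟩
  refine ⟨d, hd, ?_⟩
  have := hd.simple ht
  set K := ∑ σ, blockMap t (Equiv.Perm.sigmaCongrRightHom (fun j => Fin (n j)) σ)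
    (fun x (_ : Unit) => tensorMatrix M σ x₀ x • i) with hKdef
  have hfp : (K ≫ g) ≫ X.obj.p = K ≫ g := by rw [Category.assoc, hgp _ hf.comp_p]
  have hG : ∀ b, hMap (K ≫ g) ≫ X.act b = colourMap (fun i o =>
      indColour (Y := M₁.X) (χ i₀) (fun w : Σ j, Fin (n j) => χ (c w.1)) i o b) (K ≫ g) := by
    intro b
    have h1 := hg (X.act b) (fun o => χ (o.elim i₀ κ) b)
      (fun o => blockColour (χ i₀) (fun w : Σ j, Fin (n j) => χ (c w.1)) o b) (fun o => by
        rw [← hφ o]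
        rcases o.map φ with _ | u | w <;> rfl) (hf.hMap_act hχ hn b)
    rw [← hMap_comp, Category.assoc, h1]
    refine hMap_colourMap ?_ g
    refine PreservesMat.sum fun σ p q => ?_
    exact blockKer_preserves (χ := fun w : Σ j, Fin (n j) => χ (c w.1))
      (χ' := fun w : Σ j, Fin (n j) => χ (c w.1))
      (b := Equiv.Perm.sigmaCongrRightHom (fun j => Fin (n j)) σ)
      (χ i₀) (fun χ => χ b) (fun _ => rfl) _
  obtain ⟨F, hF⟩ : ∃ F : d.ind ⟶ X, (RepWreath.Hom.hom F).f = K ≫ g := exists_hom_of_colouredRep (N := d.indS)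
    (h := fun a => indIdem_preserves d.χ₁ (fun w : d.J => d.χ w.1) (fun χ => χ a) (fun _ _ => rfl) _ _)
    ((Category.assoc _ _ _).symm.trans (congrArg (· ≫ g) hK)) hfp hG
  have hF0 : F ≠ 0 := fun h =>
    hK0 (hF.symm.trans (congrArg (fun g => (RepWreath.Hom.hom g).f) h))
  have := RepWreath.isIso_of_simple ht hF0
  exact ⟨(asIso F).symm⟩

end Classification

end DeligneWreath

theorem mainTheorem4 {k : Type*} [Field k] [IsAlgClosed k] [CharZero k]
    {A : Type*} [CommRing A] [Algebra k A] [Algebra.FiniteType k A]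
    (t : k) (ht : Transcendental ℚ t) :
    (∀ X : DeligneWreath.RepWreath A t, CategoryTheory.Simple X →
      ∃ d : DeligneWreath.InductionDatum A t, d.Admissible ∧ Nonempty (X ≅ d.ind)) ∧
    (∀ d : DeligneWreath.InductionDatum A t, d.Admissible → CategoryTheory.Simple d.ind) ∧
    (∀ d d' : DeligneWreath.InductionDatum A t, d.Admissible → d'.Admissible →
      (Nonempty (d.ind ≅ d'.ind) ↔ d.Equivalent d')) :=
  ⟨fun X _ => DeligneWreath.RepWreath.exists_iso_ind ht X, fun _ hd => hd.simple ht,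
    fun _ _ hd hd' => hd.nonempty_iso_iff ht hd'⟩
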